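/- **Theorem 3.3.** *Setting.* A locally $C^*$-algebra is a complete Hausdorff complex topological $*$-algebra $A$ whose topology is determined by the set $S(A)$ of its continuous $C^*$-seminorms (ordered pointwise). For $p\in S(A)$ let $A_p=A/\ker p$, with the norm induced by $p$, and let $\pi_p:A\to A_p$ and $\pi_{pq}:A_p\to A_q$ ($p\ge q$) be the canonical maps. The multiplier algebra $M(A)$ is the $*$-algebra of pairs $(l,r)$ of linear maps $A\to A$ with $l(ab)=l(a)b$, $r(ab)=a\,r(b)$, $a\,l(b)=r(a)b$, with the seminorms $p_{M(A)}(l,r)=\sup\{p(l(a)):p(a)\le 1\}$; it is identified with $L_A(A)$ by $(l,r)\mapsto l$, and $A\subseteq M(A)$ through left and right multiplications. $M(A_p)$ is defined in the same way from the norm of $A_p$; $\pi_p$ and $\pi_{pq}$ extend to $*$-homomorphisms $\pi_p'':M(A)\to M(A_p)$ and $\pi_{pq}'':M(A_p)\to M(A_q)$. Let $E$ be a Hilbert $A$-module: a right $A$-module with an $A$-valued inner product $\langle\cdot,\cdot\rangle$, linear in the second variable, complete for the seminorms $\bar p_E(\xi)=p(\langle\xi,\xi\rangle)^{1/2}$,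 $p\in S(A)$. Let $E_p=E/\ker\bar p_E$, a Hilbert $A_p$-module, with canonical maps $\sigma_p:E\to E_p$ and $\sigma_{pq}:E_p\to E_q$. The multiplier module of $E$ is $M(E)=L_A(A,E)$, the adjointable module maps $A\to E$, with $t\cdot m=t\circ m$ and $\langle s,t\rangle=s^*\circ t\in M(A)$; likewise $M(E_p)=L_{A_p}(A_p,E_p)$. Let $(\pi_p)_*:M(E)\to M(E_p)$ and $(\pi_{pq})_*:M(E_p)\to M(E_q)$ be given by $(\pi_p)_*(t)(\pi_p(a))=\sigma_p(t(a))$ and $(\pi_{pq})_*(t)(\pi_{pq}(x))=\sigma_{pq}(t(x))$. The strict topology on $M(E)$ is generated by the seminorms $t\mapsto\bar p_E(t(a))+p(t^*(\xi))$, $p\in S(A)$, $a\in A$, $\xi\in E$; the one on $M(E_p)$ by $t\mapsto\|t(x)\|+\|t^*(y)\|$, $x\in A_p$, $y\in E_p$. *Claim.* 1. $\{M(E_p);(\pi_{pq})_*\}_{p\ge q}$ is an inverse system of Hilbert $C^*$-modules: each $M(A_p)$ is a $C^*$-algebra (all its elements being bounded), each $M(E_p)$ is a Hilbert $M(A_p)$-module,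 $(\pi_{pq})_*(t\cdot m)=(\pi_{pq})_*(t)\cdot\pi_{pq}''(m)$, $\langle(\pi_{pq})_*(s),(\pi_{pq})_*(t)\rangle=\pi_{pq}''(\langle s,t\rangle)$, and both $\pi''_{pq}$ and $(\pi_{pq})_*$ satisfy the identity and composition laws of an inverse system. 2. $M(A)$, with the (finite) seminorms $p_{M(A)}$, is a locally $C^*$-algebra and $M(E)$ is a Hilbert $M(A)$-module; so are $\varprojlim_p M(A_p)$, with the seminorms $(m_p)_p\mapsto\|m_p\|$, and $\varprojlim_p M(E_p)$ over it. The map $\Phi(m)=(\pi_p''(m))_p$ is a $*$-isomorphism of $M(A)$ onto $\varprojlim_p M(A_p)$ with $\|\pi_p''(m)\|=p_{M(A)}(m)$ for all $p$, and, with these algebras identified through $\Phi$, the map $U(t)=((\pi_p)_*(t))_p$ is a unitary operator from $M(E)$ to $\varprojlim_p M(E_p)$; in particular these Hilbert $M(A)$-modules are unitarily equivalent. 3. The maps $(\pi_{pq})_*$ are strictly continuous, and $U$ is a homeomorphism from $M(E)$ with the strict topology onto $\varprojlim_p M(E_p)$ with the inverse limit of the strict topologies of the $M(E_p)$. 4.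 $M(E)$ is complete with respect to the strict topology. 5. The map $i_E:E\to M(E)$, $i_E(\xi)(a)=\xi a$, embeds $E$ as a closed submodule of $M(E)$: it is linear, $i_E(\xi a)=i_E(\xi)\cdot a$, $\langle i_E(\xi),i_E(\eta)\rangle=\langle\xi,\eta\rangle$, it is a homeomorphism onto a closed subset of $M(E)$ for the Hilbert module topologies, and its range is invariant under the action of $M(A)$. Moreover $t\cdot a=i_E(t(a))$ and $\langle t,i_E(\xi)\rangle=t^*(\xi)$ for all $t\in M(E)$, $a\in A$, $\xi\in E$. 6. The image of $i_E$ is dense in $M(E)$ with respect to the strict topology. -/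

import Mathlib

set_option linter.unusedSectionVars false

noncomputable section

namespace HilbertMult

universe u v w

section Completion

open UniformSpace UniformSpace.Completion

variable (R : Type u) [NonUnitalNormedRing R] [StarRing R] [CStarRing R] [NormedSpace ℂ R]
  [IsScalarTower ℂ R R] [SMulCommClass ℂ R R] [StarModule ℂ R]

variable {R}

/-- Multiplication on the completion of a normed non-unital ring. -/
@[reducible]
def completionMul : Mul (Completion R) :=
  ⟨Function.curry <| (isDenseInducing_coe.prodMap isDenseInducing_coe).extend
    (((↑) : R → Completion R) ∘ Function.uncurry (· * ·))⟩

/-- Involution on the completion of a pre-C*-algebra. -/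
@[reducible]
def completionStar : Star (Completion R) := ⟨Completion.map star⟩

attribute [local instance] completionMul completionStar

lemma completion_coe_mul (a b : R) : ((a * b : R) : Completion R) = a * b :=
  ((isDenseInducing_coe.prodMap isDenseInducing_coe).extend_eq
      ((continuous_coe R).comp (continuous_mul : Continuous fun p : R × R => p.1 * p.2))
      (a, b)).symm

lemma completion_uniformContinuous_star : UniformContinuous (star : R → R) :=
  (Isometry.of_dist_eq fun a b => by
    rw [dist_eq_norm, dist_eq_norm, ← star_sub, norm_star]).uniformContinuous

lemma completion_coe_star (a : R) : ((star a : R) : Completion R) = star (a : Completion R) :=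
  (map_coe completion_uniformContinuous_star a).symm

lemma completion_continuousMul : ContinuousMul (Completion R) where
  continuous_mul := by
    let m := (AddMonoidHom.mul : R →+ R →+ R).compr₂ toCompl
    have : Continuous fun p : R × R => m p.1 p.2 := (continuous_coe R).comp continuous_mul
    have di : IsDenseInducing (toCompl : R → Completion R) := isDenseInducing_coe
    exact (di.extend_Z_bilin di this :)

lemma completion_continuousStar : ContinuousStar (Completion R) where
  continuous_star := continuous_map

attribute [local instance] completion_continuousMul completion_continuousStar

lemma completion_norm_le (x : Completion R) : ‖x‖ * ‖x‖ ≤ ‖star x * x‖ :=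
  Completion.induction_on x (isClosed_le (by fun_prop) (by fun_prop)) fun a => by
    rw [← completion_coe_star, ← completion_coe_mul, norm_coe, norm_coe]
    exact CStarRing.norm_mul_self_le a

lemma completion_continuous_smul (c : ℂ) : Continuous fun x : Completion R => c • x :=
  (uniformContinuous_const_smul c).continuous

lemma completion_smul_mul (c : ℂ) (x y : Completion R) : (c • x) * y = c • (x * y) :=
  Completion.induction_on₂ x y
    (isClosed_eq
      (((completion_continuous_smul c).comp continuous_fst).mul continuous_snd)
      ((completion_continuous_smul c).comp (continuous_fst.mul continuous_snd))) fun a b => by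
    rw [← coe_smul, ← completion_coe_mul, ← completion_coe_mul, ← coe_smul, smul_mul_assoc]

lemma completion_mul_smul (c : ℂ) (x y : Completion R) : c • (x * y) = x * (c • y) :=
  Completion.induction_on₂ x y
    (isClosed_eq
      ((completion_continuous_smul c).comp (continuous_fst.mul continuous_snd))
      (continuous_fst.mul ((completion_continuous_smul c).comp continuous_snd))) fun a b => by
    rw [← coe_smul, ← completion_coe_mul, ← completion_coe_mul, ← coe_smul, mul_smul_comm]

lemma completion_star_smul (c : ℂ) (x : Completion R) : star (c • x) = star c • star x :=
  Completion.induction_on x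
    (isClosed_eq (continuous_star.comp (completion_continuous_smul c))
      ((completion_continuous_smul (star c)).comp continuous_star)) fun a => by
    rw [← coe_smul, ← completion_coe_star, star_smul, coe_smul, completion_coe_star]

/-- The completion of a pre-C*-algebra is a C*-algebra. -/
@[reducible]
def completionCStarAlgebra : NonUnitalCStarAlgebra (Completion R) where
  __ := (inferInstance : NormedAddCommGroup (Completion R))
  __ := (inferInstance : NormedSpace ℂ (Completion R))
  __ := (inferInstance : CompleteSpace (Completion R))
  __ := (completionMul : Mul (Completion R))
  __ := (completionStar : Star (Completion R))
  left_distrib x y z := Completion.induction_on₃ x y z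
    (isClosed_eq (by fun_prop) (by fun_prop)) fun a b c => by
      rw [← coe_add, ← completion_coe_mul, ← completion_coe_mul, ← completion_coe_mul, ← coe_add,
        mul_add]
  right_distrib x y z := Completion.induction_on₃ x y z
    (isClosed_eq (by fun_prop) (by fun_prop)) fun a b c => by
      rw [← coe_add, ← completion_coe_mul, ← completion_coe_mul, ← completion_coe_mul, ← coe_add,
        add_mul]
  zero_mul x := Completion.induction_on x (isClosed_eq (by fun_prop) continuous_const) fun a => by
    rw [← coe_zero, ← completion_coe_mul, zero_mul]
  mul_zero x := Completion.induction_on x (isClosed_eq (by fun_prop) continuous_const) fun a => by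
    rw [← coe_zero, ← completion_coe_mul, mul_zero]
  mul_assoc x y z := Completion.induction_on₃ x y z
    (isClosed_eq (by fun_prop) (by fun_prop)) fun a b c => by
      simp only [← completion_coe_mul, mul_assoc]
  norm_mul_le x y := Completion.induction_on₂ x y
    (isClosed_le (by fun_prop) (by fun_prop)) fun a b => by
      rw [← completion_coe_mul, norm_coe, norm_coe, norm_coe]; exact norm_mul_le a b
  star_involutive x := Completion.induction_on x
    (isClosed_eq (by fun_prop) continuous_id) fun a => by
      rw [← completion_coe_star, ← completion_coe_star, star_star]
  star_mul x y := Completion.induction_on₂ x y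
    (isClosed_eq (by fun_prop) (by fun_prop)) fun a b => by
      rw [← completion_coe_mul, ← completion_coe_star, star_mul, completion_coe_mul,
        completion_coe_star, completion_coe_star]
  star_add x y := Completion.induction_on₂ x y
    (isClosed_eq (by fun_prop) (by fun_prop)) fun a b => by
      rw [← coe_add, ← completion_coe_star, star_add, coe_add,
        completion_coe_star, completion_coe_star]
  norm_mul_self_le x := completion_norm_le x
  smul_assoc c x y := completion_smul_mul c x y
  smul_comm c x y := completion_mul_smul c x y
  star_smul c x := completion_star_smul c x

variable (R) in
/-- Every pre-C*-algebra embeds isometrically into a C*-algebra. -/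
lemma exists_cstar_embedding : ∃ (B : Type u) (_ : NonUnitalCStarAlgebra B) (φ : R →ₗᵢ[ℂ] B),
    (∀ a b, φ (a * b) = φ a * φ b) ∧ ∀ a, φ (star a) = star (φ a) :=
  ⟨Completion R, completionCStarAlgebra, (toComplₗᵢ : R →ₗᵢ[ℂ] Completion R),
    completion_coe_mul, completion_coe_star⟩

/-- The Cauchy-Schwarz inequality, for the Gram entries of two vectors over a pre-C*-algebra. -/
lemma norm_sq_le_of_gram {x y c : R} (hx : ∃ d, x = star d * d)
    (h : ∀ a : R, ∃ d : R, star a * x * a - star a * c - star c * a + y = star d * d) :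
    ‖c‖ ^ 2 ≤ ‖x‖ * ‖y‖ := by
  obtain ⟨B, _, ψ, emul, estar⟩ := exists_cstar_embedding R
  let _ : PartialOrder B := CStarAlgebra.spectralOrder B
  have _ : StarOrderedRing B := CStarAlgebra.spectralOrderedRing B
  obtain ⟨φ, hφ⟩ : ∃ φ : R → B, φ = ψ := ⟨_, rfl⟩
  rw [← hφ] at emul estar
  have hsa : IsSelfAdjoint (φ x) := by
    obtain ⟨d, rfl⟩ := hx
    rw [emul, estar]
    exact IsSelfAdjoint.star_mul_self _
  have key : ∀ r : ℝ, ‖x‖ < r → ‖c‖ ^ 2 ≤ r * ‖y‖ := by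
    intro r hr
    have hr0 : 0 < r := (norm_nonneg x).trans_lt hr
    obtain ⟨d, hd⟩ := h ((r⁻¹ : ℝ) • c)
    have hd' := congrArg φ hd
    set C := star (φ c) * φ c with hC
    have hCsa : star (φ c) * φ x * φ c ≤ ‖φ x‖ • C :=
      CStarAlgebra.star_left_conjugate_le_norm_smul
    have hnx : ‖φ x‖ = ‖x‖ := hφ ▸ ψ.norm_map x
    have hny : ‖φ y‖ = ‖y‖ := hφ ▸ ψ.norm_map y
    have hnc : ‖φ c‖ = ‖c‖ := hφ ▸ ψ.norm_map c
    have hC0 : 0 ≤ C := star_mul_self_nonneg _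
    have hle : star (φ c) * φ x * φ c ≤ r • C :=
      hCsa.trans (smul_le_smul_of_nonneg_right (by rw [hnx]; exact hr.le) hC0)
    have hexp : (r⁻¹ * r⁻¹ : ℝ) • (star (φ c) * φ x * φ c) - r⁻¹ • C - r⁻¹ • C + φ y
        = star (φ d) * φ d := by
      have e1 : ∀ t : ℝ, ∀ z : R, φ (t • z) = t • φ z := fun t z => by
        rw [hφ]
        exact map_smul ψ (t : ℂ) z
      have st : ∀ t : ℝ, ∀ z : R, star (t • z) = t • star z := fun t z => by
        change star ((t : ℂ) • z) = (t : ℂ) • star z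
        rw [star_smul, Complex.star_def, Complex.conj_ofReal]
      have eadd : ∀ z z' : R, φ (z + z') = φ z + φ z' := fun z z' => hφ ▸ map_add ψ z z'
      have esub : ∀ z z' : R, φ (z - z') = φ z - φ z' := fun z z' => hφ ▸ map_sub ψ z z'
      have sm : ∀ (t : ℝ) (z z' : R), (t • z) * z' = t • (z * z') := fun t z z' =>
        smul_mul_assoc (t : ℂ) z z'
      have ms : ∀ (t : ℝ) (z z' : R), z * (t • z') = t • (z * z') := fun t z z' =>
        mul_smul_comm (t : ℂ) z z'
      rw [← estar d, ← emul] 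
      rw [← hd, st, sm, sm, ms, sm, ms]
      simp only [eadd, esub, e1, smul_smul, hC, emul, estar]
    have h0 : 0 ≤ (r⁻¹ * r⁻¹ : ℝ) • (star (φ c) * φ x * φ c) - r⁻¹ • C - r⁻¹ • C + φ y := by
      rw [hexp]; exact star_mul_self_nonneg _
    have h1 : (r⁻¹ * r⁻¹ : ℝ) • (star (φ c) * φ x * φ c) ≤ r⁻¹ • C := by
      calc _ ≤ (r⁻¹ * r⁻¹ : ℝ) • (r • C) := smul_le_smul_of_nonneg_left hle (by positivity)
        _ = r⁻¹ • C := by rw [smul_smul]; congr 1; field_simp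
    have h2 : r⁻¹ • C ≤ φ y := by
      have := h0.trans (add_le_add_left (sub_le_sub_right (sub_le_sub_right h1 _) _) (φ y))
      rw [sub_self, zero_sub] at this
      simpa [add_comm, ← sub_eq_add_neg] using this
    have h3 := CStarAlgebra.norm_le_norm_of_nonneg_of_le (smul_nonneg (by positivity) hC0) h2
    rw [norm_smul, hC, CStarRing.norm_star_mul_self, hny, hnc, Real.norm_eq_abs,
      abs_of_pos (by positivity)] at h3
    rw [pow_two]
    have := mul_le_mul_of_nonneg_left h3 hr0.le
    rwa [← mul_assoc, mul_inv_cancel₀ hr0.ne', one_mul] at this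
  have hlim : Filter.Tendsto (fun r : ℝ => r * ‖y‖) (nhdsWithin ‖x‖ (Set.Ioi ‖x‖))
      (nhds (‖x‖ * ‖y‖)) :=
    ((continuous_id.mul continuous_const).tendsto _).mono_left nhdsWithin_le_nhds
  exact ge_of_tendsto hlim (by filter_upwards [self_mem_nhdsWithin] with r hr using key r hr)

end Completion

/-! ### Completeness and topology for families of seminorms -/

section Families

variable {ι : Type*} {X : Type*} [AddCommGroup X]

/-- The topology generated by the open balls of a family of seminorms `N i`. -/
@[reducible]
def seminormTopology (N : ι → X → ℝ) : TopologicalSpace X :=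
  TopologicalSpace.generateFrom
    {S | ∃ (i : ι) (x : X) (ε : ℝ), 0 < ε ∧ S = {y | N i (y - x) < ε}}

/-- Completeness with respect to a family of seminorms: every Cauchy filter converges. -/
def IsCompleteFor (N : ι → X → ℝ) : Prop :=
  ∀ F : Filter X, F.NeBot →
    (∀ i, ∀ ε : ℝ, 0 < ε → ∃ S ∈ F, ∀ x ∈ S, ∀ y ∈ S, N i (x - y) < ε) →
    ∃ x, ∀ i, ∀ ε : ℝ, 0 < ε → ∀ᶠ y in F, N i (y - x) < ε

end Families

/-! ### Locally C*-algebras -/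

section Algebras

variable (A : Type u) [NonUnitalRing A] [StarRing A] [Module ℂ A]

/-- A C*-seminorm on a complex *-algebra. -/
structure CStarSeminorm extends Seminorm ℂ A where
  mul_le' : ∀ a b, toSeminorm (a * b) ≤ toSeminorm a * toSeminorm b
  star_mul_self' : ∀ a, toSeminorm (star a * a) = toSeminorm a ^ 2

/-- The set `S(A)` of all continuous C*-seminorms on a topological *-algebra `A`. -/
structure ContCStarSeminorm [TopologicalSpace A] extends CStarSeminorm A where
  continuous' : Continuous toSeminorm

variable {A} in
/-- The elements `b* b`. In a locally C*-algebra (in particular in a C*-algebra) these are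
exactly the positive elements. -/
def IsPositiveElt (a : A) : Prop := ∃ b : A, a = star b * b

/-- A family of C*-seminorms `N i` that separates the points of the *-algebra `A` and for which
`A` is complete; that is, `A` is a locally C*-algebra for the topology defined by this family. -/
structure IsLocallyCStarFor {ι : Type*} (N : ι → A → ℝ) : Prop where
  cstar : ∀ i, ∃ s : CStarSeminorm A, ∀ a, s.toSeminorm a = N i a
  separating : ∀ a, (∀ i, N i a = 0) → a = 0
  complete : IsCompleteFor N

/-- `A` is a C*-algebra with respect to the norm `N`. -/
def IsCStarFor (N : A → ℝ) : Prop := IsLocallyCStarFor A fun _ : Unit => N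

/-- A locally C*-algebra: a complete Hausdorff topological *-algebra whose topology is the one
defined by its continuous C*-seminorms. (Continuity of the algebra operations follows.) -/
class LocallyCStarAlgebra [UniformSpace A] : Prop extends
    IsUniformAddGroup A, T2Space A, CompleteSpace A where
  withSeminorms : WithSeminorms fun p : ContCStarSeminorm A => p.toSeminorm

end Algebras

section SeminormLemmas

variable {A : Type u} [NonUnitalRing A] [StarRing A] [Module ℂ A]

namespace ContCStarSeminorm

variable [TopologicalSpace A]

instance : CoeFun (ContCStarSeminorm A) fun _ => A → ℝ := ⟨fun p => p.toSeminorm⟩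

lemma ext' {p q : ContCStarSeminorm A} (h : p.toSeminorm = q.toSeminorm) : p = q := by
  obtain ⟨⟨p, _, _⟩, _⟩ := p
  obtain ⟨⟨q, _, _⟩, _⟩ := q
  cases h
  rfl

/-- `S(A)` with the pointwise order. -/
instance : PartialOrder (ContCStarSeminorm A) :=
  PartialOrder.lift (fun p => p.toSeminorm) fun _ _ => ext'

lemma apply_le {p q : ContCStarSeminorm A} (h : q ≤ p) (a : A) : q a ≤ p a := h a

variable (p : ContCStarSeminorm A)

lemma mul_le (a b : A) : p (a * b) ≤ p a * p b := p.mul_le' a b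

lemma star_mul_self (a : A) : p (star a * a) = p a ^ 2 := p.star_mul_self' a

lemma le_star (a : A) : p a ≤ p (star a) := by
  have h1 : p a ^ 2 ≤ p (star a) * p a := by rw [← p.star_mul_self]; exact p.mul_le _ _
  have h0 : 0 ≤ p a := apply_nonneg _ _
  have h0' : 0 ≤ p (star a) := apply_nonneg _ _
  rcases h0.eq_or_lt with h | h
  · rw [← h]; exact h0'
  · nlinarith

lemma apply_star (a : A) : p (star a) = p a :=
  le_antisymm (by simpa using p.le_star (star a)) (p.le_star a)

/-- The ideal `ker p = {a | p a = 0}`. -/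
def ker : Submodule ℂ A where
  carrier := {a | p a = 0}
  add_mem' {a b} ha hb := by
    have h := map_add_le_add p.toSeminorm a b
    have h0 : 0 ≤ p (a + b) := apply_nonneg _ _
    simp only [Set.mem_ofPred_eq] at *
    linarith
  zero_mem' := map_zero p.toSeminorm
  smul_mem' c a ha := by
    simp only [Set.mem_ofPred_eq] at *
    rw [map_smul_eq_mul, ha, mul_zero]

lemma mem_ker {a : A} : a ∈ p.ker ↔ p a = 0 := Iff.rfl

lemma mul_mem_left {b : A} (a : A) (hb : b ∈ p.ker) : a * b ∈ p.ker := by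
  have h := p.mul_le a b
  rw [mem_ker] at *
  rw [hb, mul_zero] at h
  exact le_antisymm h (apply_nonneg _ _)

lemma mul_mem_right {a : A} (b : A) (ha : a ∈ p.ker) : a * b ∈ p.ker := by
  have h := p.mul_le a b
  rw [mem_ker] at *
  rw [ha, zero_mul] at h
  exact le_antisymm h (apply_nonneg _ _)

lemma star_mem {a : A} (ha : a ∈ p.ker) : star a ∈ p.ker := by
  rw [mem_ker, apply_star]; exact ha

lemma apply_eq_of_sub_mem {a b : A} (h : a - b ∈ p.ker) : p a = p b := by
  have h1 : p a ≤ p (a - b) + p b := by simpa using map_add_le_add p.toSeminorm (a - b) b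
  have h2 : p b ≤ p (b - a) + p a := by simpa using map_add_le_add p.toSeminorm (b - a) a
  have h3 : p (b - a) = 0 := by
    rw [← neg_sub]; exact p.ker.neg_mem h
  rw [mem_ker] at h
  linarith

end ContCStarSeminorm

end SeminormLemmas

/-! ### The C*-algebras `A_p = A / ker p` -/

section QuotAlg

variable {A : Type u} [NonUnitalRing A] [StarRing A] [Module ℂ A] [TopologicalSpace A]

/-- The quotient *-algebra `A_p = A / ker p`. -/
def QuotAlg (p : ContCStarSeminorm A) : Type u := A ⧸ p.ker

namespace QuotAlg

variable {p : ContCStarSeminorm A}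

instance : AddCommGroup (QuotAlg p) := inferInstanceAs (AddCommGroup (A ⧸ p.ker))
instance : Module ℂ (QuotAlg p) := inferInstanceAs (Module ℂ (A ⧸ p.ker))

/-- The canonical map `A → A_p` as a linear map. -/
def mkₗ (p : ContCStarSeminorm A) : A →ₗ[ℂ] QuotAlg p := p.ker.mkQ

lemma mkₗ_surjective : Function.Surjective (mkₗ p) := p.ker.mkQ_surjective

lemma mkₗ_eq_zero {a : A} : mkₗ p a = 0 ↔ p a = 0 := Submodule.Quotient.mk_eq_zero _

lemma mkₗ_eq {a b : A} : mkₗ p a = mkₗ p b ↔ a - b ∈ p.ker := Submodule.Quotient.eq _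

instance : Mul (QuotAlg p) where
  mul x y := Quotient.liftOn₂' x y (fun a b => mkₗ p (a * b)) fun a b a' b' h h' => by
    have h1 : a - a' ∈ p.ker := (Submodule.quotientRel_def _).1 h
    have h2 : b - b' ∈ p.ker := (Submodule.quotientRel_def _).1 h'
    refine mkₗ_eq.2 ?_
    have : a * b - a' * b' = (a - a') * b + a' * (b - b') := by
      rw [sub_mul, mul_sub]; abel
    rw [this]
    exact p.ker.add_mem (p.mul_mem_right _ h1) (p.mul_mem_left _ h2)

instance : Star (QuotAlg p) where
  star x := Quotient.liftOn' x (fun a => mkₗ p (star a)) fun a a' h => by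
    have h1 : a - a' ∈ p.ker := (Submodule.quotientRel_def _).1 h
    refine mkₗ_eq.2 ?_
    rw [← star_sub]
    exact p.star_mem h1

instance : Norm (QuotAlg p) where
  norm x := Quotient.liftOn' x (fun a => p a) fun _ _ h =>
    p.apply_eq_of_sub_mem ((Submodule.quotientRel_def _).1 h)

lemma mkₗ_mul (a b : A) : mkₗ p (a * b) = mkₗ p a * mkₗ p b := rfl
lemma mkₗ_star (a : A) : mkₗ p (star a) = star (mkₗ p a) := rfl
/-- The norm of `A_p` is the one induced by `p`. -/
lemma norm_mkₗ (a : A) : ‖mkₗ p a‖ = p a := rfl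

instance : NonUnitalRing (QuotAlg p) where
  left_distrib x y z := by
    obtain ⟨a, rfl⟩ := mkₗ_surjective x
    obtain ⟨b, rfl⟩ := mkₗ_surjective y
    obtain ⟨c, rfl⟩ := mkₗ_surjective z
    simp only [← map_add, ← mkₗ_mul, mul_add]
  right_distrib x y z := by
    obtain ⟨a, rfl⟩ := mkₗ_surjective x
    obtain ⟨b, rfl⟩ := mkₗ_surjective y
    obtain ⟨c, rfl⟩ := mkₗ_surjective z
    simp only [← map_add, ← mkₗ_mul, add_mul]
  zero_mul x := by
    obtain ⟨a, rfl⟩ := mkₗ_surjective x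
    rw [← map_zero (mkₗ p), ← mkₗ_mul, zero_mul]
  mul_zero x := by
    obtain ⟨a, rfl⟩ := mkₗ_surjective x
    rw [← map_zero (mkₗ p), ← mkₗ_mul, mul_zero]
  mul_assoc x y z := by
    obtain ⟨a, rfl⟩ := mkₗ_surjective x
    obtain ⟨b, rfl⟩ := mkₗ_surjective y
    obtain ⟨c, rfl⟩ := mkₗ_surjective z
    simp only [← mkₗ_mul, mul_assoc]

instance : StarRing (QuotAlg p) where
  star_involutive x := by
    obtain ⟨a, rfl⟩ := mkₗ_surjective x
    rw [← mkₗ_star, ← mkₗ_star, star_star]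
  star_mul x y := by
    obtain ⟨a, rfl⟩ := mkₗ_surjective x
    obtain ⟨b, rfl⟩ := mkₗ_surjective y
    rw [← mkₗ_mul, ← mkₗ_star, star_mul, mkₗ_mul, mkₗ_star, mkₗ_star]
  star_add x y := by
    obtain ⟨a, rfl⟩ := mkₗ_surjective x
    obtain ⟨b, rfl⟩ := mkₗ_surjective y
    rw [← map_add, ← mkₗ_star, star_add, map_add, mkₗ_star, mkₗ_star]

instance [IsScalarTower ℂ A A] : IsScalarTower ℂ (QuotAlg p) (QuotAlg p) where
  smul_assoc c x y := by
    obtain ⟨a, rfl⟩ := mkₗ_surjective x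
    obtain ⟨b, rfl⟩ := mkₗ_surjective y
    simp only [smul_eq_mul, ← map_smul, ← mkₗ_mul, smul_mul_assoc]

instance [SMulCommClass ℂ A A] : SMulCommClass ℂ (QuotAlg p) (QuotAlg p) where
  smul_comm c x y := by
    obtain ⟨a, rfl⟩ := mkₗ_surjective x
    obtain ⟨b, rfl⟩ := mkₗ_surjective y
    simp only [smul_eq_mul, ← map_smul, ← mkₗ_mul, mul_smul_comm]

instance [StarModule ℂ A] : StarModule ℂ (QuotAlg p) where
  star_smul c x := by
    obtain ⟨a, rfl⟩ := mkₗ_surjective x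
    rw [← map_smul, ← mkₗ_star, star_smul, map_smul, mkₗ_star]

lemma normCore : NormedSpace.Core ℂ (QuotAlg p) where
  norm_nonneg x := by
    obtain ⟨a, rfl⟩ := mkₗ_surjective x
    exact apply_nonneg p.toSeminorm a
  norm_smul c x := by
    obtain ⟨a, rfl⟩ := mkₗ_surjective x
    exact map_smul_eq_mul p.toSeminorm c a
  norm_triangle x y := by
    obtain ⟨a, rfl⟩ := mkₗ_surjective x
    obtain ⟨b, rfl⟩ := mkₗ_surjective y
    exact map_add_le_add p.toSeminorm a b
  norm_eq_zero_iff x := by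
    obtain ⟨a, rfl⟩ := mkₗ_surjective x
    exact mkₗ_eq_zero.symm

instance : NonUnitalNormedRing (QuotAlg p) where
  __ := NormedAddCommGroup.ofCore (normCore (p := p))
  __ := (inferInstance : NonUnitalRing (QuotAlg p))
  norm_mul_le x y := by
    obtain ⟨a, rfl⟩ := mkₗ_surjective x
    obtain ⟨b, rfl⟩ := mkₗ_surjective y
    exact p.mul_le a b

instance : NormedSpace ℂ (QuotAlg p) where
  norm_smul_le c x := (normCore.norm_smul c x).le

instance : CStarRing (QuotAlg p) where
  norm_mul_self_le x := by
    obtain ⟨a, rfl⟩ := mkₗ_surjective x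
    change p a * p a ≤ p (star a * a)
    rw [p.star_mul_self, pow_two]

/-- The canonical *-homomorphism `π_p : A → A_p`. -/
def mk (p : ContCStarSeminorm A) : A →⋆ₙₐ[ℂ] QuotAlg p where
  toFun := mkₗ p
  map_smul' := map_smul (mkₗ p)
  map_zero' := map_zero (mkₗ p)
  map_add' := map_add (mkₗ p)
  map_mul' := mkₗ_mul
  map_star' := mkₗ_star

lemma mk_surjective : Function.Surjective (mk p) := mkₗ_surjective

lemma ker_mono {p q : ContCStarSeminorm A} (h : q ≤ p) : p.ker ≤ q.ker := fun a ha => by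
  rw [ContCStarSeminorm.mem_ker] at *
  exact le_antisymm ((ContCStarSeminorm.apply_le h a).trans ha.le) (apply_nonneg _ _)

/-- The map `π_pq : A_p → A_q` for `p ≥ q` as a linear map. -/
def transₗ {p q : ContCStarSeminorm A} (h : q ≤ p) : QuotAlg p →ₗ[ℂ] QuotAlg q :=
  p.ker.mapQ q.ker LinearMap.id (ker_mono h)

/-- The canonical *-homomorphism `π_pq : A_p → A_q` for `p ≥ q`, given by
`π_pq (π_p a) = π_q a`. -/
def trans {p q : ContCStarSeminorm A} (h : q ≤ p) : QuotAlg p →⋆ₙₐ[ℂ] QuotAlg q where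
  toFun := transₗ h
  map_smul' := map_smul (transₗ h)
  map_zero' := map_zero (transₗ h)
  map_add' := map_add (transₗ h)
  map_mul' x y := by
    obtain ⟨a, rfl⟩ := mkₗ_surjective x
    obtain ⟨b, rfl⟩ := mkₗ_surjective y
    rfl
  map_star' x := by
    obtain ⟨a, rfl⟩ := mkₗ_surjective x
    rfl

lemma trans_mk {p q : ContCStarSeminorm A} (h : q ≤ p) (a : A) :
    trans h (mk p a) = mk q a := rfl

lemma trans_surjective {p q : ContCStarSeminorm A} (h : q ≤ p) :
    Function.Surjective (trans h) := fun y => by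
  obtain ⟨a, rfl⟩ := mk_surjective y
  exact ⟨mk p a, rfl⟩

end QuotAlg

end QuotAlg


/-! ### Hilbert modules -/

section InnerModules

/-- A right module over the complex *-algebra `A`, compatible with the complex structure, with an
`A`-valued hermitian form that is `ℂ`- and `A`-linear in the second variable. -/
class InnerModule (A : Type u) [NonUnitalRing A] [StarRing A] [Module ℂ A]
    (E : Type v) [AddCommGroup E] [Module ℂ E] where
  /-- The right action `ξ a`. -/
  act : E → A → E
  /-- The form `⟨ξ, η⟩`. -/
  ip : E → E → A
  add_act : ∀ ξ η a, act (ξ + η) a = act ξ a + act η a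
  act_add : ∀ ξ a b, act ξ (a + b) = act ξ a + act ξ b
  act_mul : ∀ ξ a b, act ξ (a * b) = act (act ξ a) b
  smul_act : ∀ (c : ℂ) ξ a, act (c • ξ) a = c • act ξ a
  act_smul : ∀ (c : ℂ) ξ a, act ξ (c • a) = c • act ξ a
  ip_add_right : ∀ ξ η ζ, ip ξ (η + ζ) = ip ξ η + ip ξ ζ
  ip_smul_right : ∀ (c : ℂ) ξ η, ip ξ (c • η) = c • ip ξ η
  ip_act_right : ∀ ξ η a, ip ξ (act η a) = ip ξ η * a
  star_ip : ∀ ξ η, star (ip ξ η) = ip η ξ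

end InnerModules

open InnerModule

section Modules

/-- The form of an inner product module is an inner product, that is, `E` is a pre-Hilbert
`A`-module. -/
class PreHilbertModule (A : Type u) [NonUnitalRing A] [StarRing A] [Module ℂ A]
    (E : Type v) [AddCommGroup E] [Module ℂ E] [InnerModule A E] : Prop where
  ip_self_nonneg : ∀ ξ : E, IsPositiveElt (ip ξ ξ : A)
  ip_self_eq_zero : ∀ ξ : E, (ip ξ ξ : A) = 0 → ξ = 0

variable {A : Type u} [NonUnitalRing A] [StarRing A] [Module ℂ A]
variable {E : Type v} [AddCommGroup E] [Module ℂ E] [InnerModule A E]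
variable {F : Type w} [AddCommGroup F] [Module ℂ F] [InnerModule A F]

section Lemmas

lemma ip_add_left (ξ η ζ : E) : (ip (ξ + η) ζ : A) = ip ξ ζ + ip η ζ := by
  rw [← star_ip, ip_add_right, star_add, star_ip, star_ip]

lemma ip_zero_right (ξ : E) : (ip ξ 0 : A) = 0 := by
  have := ip_smul_right (A := A) 0 ξ 0
  simpa using this

lemma ip_zero_left (ξ : E) : (ip 0 ξ : A) = 0 := by
  rw [← star_ip, ip_zero_right, star_zero]

lemma ip_sub_right (ξ η ζ : E) : (ip ξ (η - ζ) : A) = ip ξ η - ip ξ ζ := by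
  have := ip_add_right (A := A) ξ (η - ζ) ζ
  rw [sub_add_cancel] at this
  rw [this, add_sub_cancel_right]

lemma ip_sub_left (ξ η ζ : E) : (ip (ξ - η) ζ : A) = ip ξ ζ - ip η ζ := by
  rw [← star_ip, ip_sub_right, star_sub, star_ip, star_ip]

lemma ip_smul_left [StarModule ℂ A] (c : ℂ) (ξ η : E) :
    (ip (c • ξ) η : A) = star c • ip ξ η := by
  rw [← star_ip, ip_smul_right, star_smul, star_ip]

lemma ip_act_left (ξ η : E) (a : A) : (ip (act ξ a) η : A) = star a * ip ξ η := by
  rw [← star_ip, ip_act_right, star_mul, star_ip]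

lemma zero_act (a : A) : act (0 : E) a = 0 := by
  have := smul_act (A := A) 0 (0 : E) a
  simpa using this

lemma sub_act (ξ η : E) (a : A) : act (ξ - η) a = act ξ a - act η a := by
  have := add_act (ξ - η) η a
  rw [sub_add_cancel] at this
  rw [this, add_sub_cancel_right]

/-- Vectors of a pre-Hilbert module are determined by their inner products. -/
lemma ip_ext [PreHilbertModule A E] {ξ η : E} (h : ∀ ζ : E, (ip ζ ξ : A) = ip ζ η) : ξ = η := by
  rw [← sub_eq_zero]
  apply PreHilbertModule.ip_self_eq_zero (A := A)
  rw [ip_sub_right, h, sub_self]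

end Lemmas

/-- The norm or seminorm `√(N ⟨ξ, ξ⟩)` on an inner product module defined by the norm or
seminorm `N` of the algebra. -/
def hnorm (N : A → ℝ) (ξ : E) : ℝ := √(N (ip ξ ξ))

variable (E) in
/-- `E` is a Hilbert module over the algebra `A` whose topology is given by the seminorms `N i`:
it is a pre-Hilbert module that is complete for the seminorms `√(N i ⟨ξ, ξ⟩)`. -/
def IsHilbertModuleFor {ι : Type*} (N : ι → A → ℝ) : Prop :=
  PreHilbertModule A E ∧ IsCompleteFor fun i (ξ : E) => hnorm (N i) ξ

/-- `A` as a right module over itself, with `⟨a, b⟩ = a* b`. -/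
instance InnerModule.self [IsScalarTower ℂ A A] [SMulCommClass ℂ A A] : InnerModule A A where
  act a b := a * b
  ip a b := star a * b
  add_act := add_mul
  act_add := mul_add
  act_mul a b c := (mul_assoc a b c).symm
  smul_act c a b := smul_mul_assoc c a b
  act_smul c a b := mul_smul_comm c a b
  ip_add_right a b c := mul_add _ b c
  ip_smul_right c a b := mul_smul_comm c _ b
  ip_act_right a b c := (mul_assoc _ b c).symm
  star_ip a b := by rw [star_mul, star_star]

lemma act_self [IsScalarTower ℂ A A] [SMulCommClass ℂ A A] (a b : A) : act a b = a * b := rfl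
lemma ip_self [IsScalarTower ℂ A A] [SMulCommClass ℂ A A] (a b : A) :
    (ip a b : A) = star a * b := rfl

instance {A : Type u} [NonUnitalRing A] [StarRing A] [Module ℂ A] [IsScalarTower ℂ A A]
    [SMulCommClass ℂ A A] [UniformSpace A] [LocallyCStarAlgebra A] : PreHilbertModule A A where
  ip_self_nonneg a := ⟨a, rfl⟩
  ip_self_eq_zero a h := by
    by_contra ha
    obtain ⟨p, hp⟩ := LocallyCStarAlgebra.withSeminorms.separating_of_T1 a ha
    apply hp
    have h1 := p.star_mul_self a
    rw [show star a * a = 0 from h] at h1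
    have h2 : (0 : ℝ) = p a ^ 2 := by rw [← h1]; exact (map_zero p.toSeminorm).symm
    exact pow_eq_zero_iff two_ne_zero |>.1 h2.symm

instance [IsScalarTower ℂ A A] [SMulCommClass ℂ A A] [TopologicalSpace A]
    (p : ContCStarSeminorm A) : PreHilbertModule (QuotAlg p) (QuotAlg p) where
  ip_self_nonneg a := ⟨a, rfl⟩
  ip_self_eq_zero a h := CStarRing.star_mul_self_eq_zero_iff a |>.1 h

end Modules

/-! ### The Hilbert modules `E_p = E / ker p̄_E` -/

section QuotMod

variable {A : Type u} [NonUnitalRing A] [StarRing A] [Module ℂ A] [IsScalarTower ℂ A A]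
  [SMulCommClass ℂ A A] [StarModule ℂ A] [TopologicalSpace A]
variable {E : Type v} [AddCommGroup E] [Module ℂ E] [InnerModule A E] [PreHilbertModule A E]

/-- The Cauchy-Schwarz inequality. -/
lemma cauchy_schwarz (p : ContCStarSeminorm A) (ξ η : E) :
    p (ip ξ η) ^ 2 ≤ p (ip ξ ξ) * p (ip η η) := by
  refine norm_sq_le_of_gram (R := QuotAlg p) (x := QuotAlg.mk p (ip ξ ξ))
    (y := QuotAlg.mk p (ip η η)) (c := QuotAlg.mk p (ip ξ η)) ?_ ?_
  · obtain ⟨d, hd⟩ := PreHilbertModule.ip_self_nonneg (A := A) ξ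
    exact ⟨QuotAlg.mk p d, by rw [hd, map_mul, map_star]⟩
  · intro a
    obtain ⟨a, rfl⟩ := QuotAlg.mk_surjective a
    obtain ⟨d, hd⟩ := PreHilbertModule.ip_self_nonneg (A := A) (act ξ a - η)
    refine ⟨QuotAlg.mk p d, ?_⟩
    rw [← map_star, ← map_star, ← map_star, ← map_mul, ← map_mul, ← map_mul, ← map_mul, ← map_mul,
      ← map_sub, ← map_sub, ← map_add, ← hd, star_ip]
    congr 1
    rw [ip_sub_left, ip_sub_right, ip_sub_right, ip_act_left, ip_act_left, ip_act_right,
      ip_act_right, ← mul_assoc]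
    abel

lemma ip_mem_ker_right {p : ContCStarSeminorm A} {ξ : E} (h : hnorm p ξ = 0) (η : E) :
    (ip ξ η : A) ∈ p.ker := by
  have h0 : p (ip ξ ξ) = 0 := by
    rwa [hnorm, Real.sqrt_eq_zero (apply_nonneg _ _)] at h
  have := cauchy_schwarz p ξ η
  rw [h0, zero_mul] at this
  exact pow_eq_zero_iff two_ne_zero |>.1 (le_antisymm this (sq_nonneg _))

lemma ip_mem_ker_left {p : ContCStarSeminorm A} {η : E} (h : hnorm p η = 0) (ξ : E) :
    (ip ξ η : A) ∈ p.ker := by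
  rw [← star_ip]
  exact p.star_mem (ip_mem_ker_right h ξ)

lemma hnorm_eq_zero {p : ContCStarSeminorm A} {ξ : E} :
    hnorm p ξ = 0 ↔ (ip ξ ξ : A) ∈ p.ker := by
  rw [hnorm, Real.sqrt_eq_zero (apply_nonneg _ _), p.mem_ker]

variable (E) in
/-- The submodule `ker p̄_E = {ξ | p̄_E ξ = 0}`. -/
def hker (p : ContCStarSeminorm A) : Submodule ℂ E where
  carrier := {ξ | hnorm p ξ = 0}
  add_mem' {ξ η} hξ hη := by
    simp only [Set.mem_ofPred_eq] at *
    rw [hnorm_eq_zero, ip_add_left]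
    exact p.ker.add_mem (ip_mem_ker_right hξ _) (ip_mem_ker_right hη _)
  zero_mem' := by
    simp only [Set.mem_ofPred_eq]
    rw [hnorm_eq_zero, ip_zero_left]
    exact p.ker.zero_mem
  smul_mem' c ξ hξ := by
    simp only [Set.mem_ofPred_eq] at *
    rw [hnorm_eq_zero, ip_smul_left]
    exact p.ker.smul_mem _ (ip_mem_ker_right hξ _)

lemma mem_hker {p : ContCStarSeminorm A} {ξ : E} : ξ ∈ hker E p ↔ hnorm p ξ = 0 := Iff.rfl

lemma act_mem_hker {p : ContCStarSeminorm A} {ξ : E} (h : ξ ∈ hker E p) (a : A) :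
    act ξ a ∈ hker E p := by
  rw [mem_hker, hnorm_eq_zero, ip_act_left]
  exact p.mul_mem_left _ (ip_mem_ker_right h _)

lemma act_mem_hker' {p : ContCStarSeminorm A} {a : A} (h : a ∈ p.ker) (ξ : E) :
    act ξ a ∈ hker E p := by
  rw [mem_hker, hnorm_eq_zero, ip_act_right]
  exact p.mul_mem_left _ h

variable (E) in
/-- The quotient `E_p = E / ker p̄_E`. -/
def QuotMod (p : ContCStarSeminorm A) : Type v := E ⧸ hker E p

namespace QuotMod

variable {p : ContCStarSeminorm A}

instance : AddCommGroup (QuotMod E p) := inferInstanceAs (AddCommGroup (E ⧸ hker E p))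
instance : Module ℂ (QuotMod E p) := inferInstanceAs (Module ℂ (E ⧸ hker E p))

variable (E) in
/-- The canonical map `σ_p : E → E_p`. -/
def mk (p : ContCStarSeminorm A) : E →ₗ[ℂ] QuotMod E p := (hker E p).mkQ

lemma mk_surjective : Function.Surjective (mk E p) := (hker E p).mkQ_surjective

lemma mk_eq {ξ η : E} : mk E p ξ = mk E p η ↔ ξ - η ∈ hker E p := Submodule.Quotient.eq _

lemma mk_eq_zero {ξ : E} : mk E p ξ = 0 ↔ hnorm p ξ = 0 := Submodule.Quotient.mk_eq_zero _

/-- The action `(σ_p ξ) (π_p a) = σ_p (ξ a)`. -/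
def qact (x : QuotMod E p) (y : QuotAlg p) : QuotMod E p :=
  Quotient.liftOn₂' x y (fun ξ a => mk E p (act ξ a)) fun ξ a ξ' a' h h' => by
    have h1 : ξ - ξ' ∈ hker E p := (Submodule.quotientRel_def _).1 h
    have h2 : a - a' ∈ p.ker := (Submodule.quotientRel_def _).1 h'
    refine mk_eq.2 ?_
    have e : act ξ a - act ξ' a' = act (ξ - ξ') a + act ξ' (a - a') := by
      have := act_add ξ' (a - a') a'
      rw [sub_add_cancel] at this
      rw [sub_act, this]; abel
    rw [e]
    exact (hker E p).add_mem (act_mem_hker h1 _) (act_mem_hker' h2 _)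

/-- The inner product `⟨σ_p ξ, σ_p η⟩ = π_p ⟨ξ, η⟩`. -/
def qip (x y : QuotMod E p) : QuotAlg p :=
  Quotient.liftOn₂' x y (fun ξ η => QuotAlg.mk p (ip ξ η)) fun ξ η ξ' η' h h' => by
    have h1 : ξ - ξ' ∈ hker E p := (Submodule.quotientRel_def _).1 h
    have h2 : η - η' ∈ hker E p := (Submodule.quotientRel_def _).1 h'
    refine QuotAlg.mkₗ_eq.2 ?_
    have e : (ip ξ η : A) - ip ξ' η' = ip (ξ - ξ') η + ip ξ' (η - η') := by
      rw [ip_sub_left, ip_sub_right]; abel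
    rw [e]
    exact p.ker.add_mem (ip_mem_ker_right h1 _) (ip_mem_ker_left h2 _)

lemma qact_mk (ξ : E) (a : A) : qact (mk E p ξ) (QuotAlg.mk p a) = mk E p (act ξ a) := rfl
lemma qip_mk (ξ η : E) : qip (mk E p ξ) (mk E p η) = QuotAlg.mk p (ip ξ η) := rfl

/-- `E_p` is an inner product module over `A_p`. -/
instance : InnerModule (QuotAlg p) (QuotMod E p) where
  act := qact
  ip := qip
  add_act x y a := by
    obtain ⟨ξ, rfl⟩ := mk_surjective x
    obtain ⟨η, rfl⟩ := mk_surjective y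
    obtain ⟨a, rfl⟩ := QuotAlg.mk_surjective a
    rw [← map_add, qact_mk, qact_mk, qact_mk, add_act, map_add]
  act_add x a b := by
    obtain ⟨ξ, rfl⟩ := mk_surjective x
    obtain ⟨a, rfl⟩ := QuotAlg.mk_surjective a
    obtain ⟨b, rfl⟩ := QuotAlg.mk_surjective b
    rw [← map_add, qact_mk, qact_mk, qact_mk, act_add, map_add]
  act_mul x a b := by
    obtain ⟨ξ, rfl⟩ := mk_surjective x
    obtain ⟨a, rfl⟩ := QuotAlg.mk_surjective a
    obtain ⟨b, rfl⟩ := QuotAlg.mk_surjective b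
    rw [← map_mul, qact_mk, qact_mk, qact_mk, act_mul]
  smul_act c x a := by
    obtain ⟨ξ, rfl⟩ := mk_surjective x
    obtain ⟨a, rfl⟩ := QuotAlg.mk_surjective a
    rw [← map_smul, qact_mk, qact_mk, smul_act, map_smul]
  act_smul c x a := by
    obtain ⟨ξ, rfl⟩ := mk_surjective x
    obtain ⟨a, rfl⟩ := QuotAlg.mk_surjective a
    rw [← map_smul, qact_mk, qact_mk, act_smul, map_smul]
  ip_add_right x y z := by
    obtain ⟨ξ, rfl⟩ := mk_surjective x
    obtain ⟨η, rfl⟩ := mk_surjective y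
    obtain ⟨ζ, rfl⟩ := mk_surjective z
    rw [← map_add, qip_mk, qip_mk, qip_mk, ip_add_right, map_add]
  ip_smul_right c x y := by
    obtain ⟨ξ, rfl⟩ := mk_surjective x
    obtain ⟨η, rfl⟩ := mk_surjective y
    rw [← map_smul, qip_mk, qip_mk, ip_smul_right, map_smul]
  ip_act_right x y a := by
    obtain ⟨ξ, rfl⟩ := mk_surjective x
    obtain ⟨η, rfl⟩ := mk_surjective y
    obtain ⟨a, rfl⟩ := QuotAlg.mk_surjective a
    rw [qact_mk, qip_mk, qip_mk, ip_act_right, map_mul]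
  star_ip x y := by
    obtain ⟨ξ, rfl⟩ := mk_surjective x
    obtain ⟨η, rfl⟩ := mk_surjective y
    rw [qip_mk, qip_mk, ← map_star, star_ip]

instance : PreHilbertModule (QuotAlg p) (QuotMod E p) where
  ip_self_nonneg x := by
    obtain ⟨ξ, rfl⟩ := mk_surjective x
    obtain ⟨d, hd⟩ := PreHilbertModule.ip_self_nonneg (A := A) ξ
    exact ⟨QuotAlg.mk p d, by
      change QuotAlg.mk p (ip ξ ξ) = _
      rw [hd, map_mul, map_star]⟩
  ip_self_eq_zero x h := by
    obtain ⟨ξ, rfl⟩ := mk_surjective x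
    rw [mk_eq_zero, hnorm_eq_zero]
    exact QuotAlg.mkₗ_eq_zero.1 h

lemma hker_mono {p q : ContCStarSeminorm A} (h : q ≤ p) : hker E p ≤ hker E q := fun ξ hξ => by
  rw [mem_hker, hnorm_eq_zero] at *
  exact QuotAlg.ker_mono h hξ

variable (E) in
/-- The canonical map `σ_pq : E_p → E_q` for `p ≥ q`, given by `σ_pq (σ_p ξ) = σ_q ξ`. -/
def trans {p q : ContCStarSeminorm A} (h : q ≤ p) : QuotMod E p →ₗ[ℂ] QuotMod E q :=
  (hker E p).mapQ (hker E q) LinearMap.id (hker_mono h)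

lemma trans_mk {p q : ContCStarSeminorm A} (h : q ≤ p) (ξ : E) :
    trans E h (mk E p ξ) = mk E q ξ := rfl

end QuotMod

end QuotMod


/-! ### Adjointable operators -/

section Adjointable

variable {A : Type u} [NonUnitalRing A] [StarRing A] [Module ℂ A]
variable {X : Type v} [AddCommGroup X] [Module ℂ X] [InnerModule A X]
variable {Y : Type w} [AddCommGroup Y] [Module ℂ Y] [InnerModule A Y]
variable {Z : Type*} [AddCommGroup Z] [Module ℂ Z] [InnerModule A Z]

variable (A X Y) in
/-- The adjointable `A`-module morphisms `L_A(X, Y)`: module morphisms `T : X → Y` together with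
a module morphism `T* : Y → X` such that `⟨T x, y⟩ = ⟨x, T* y⟩`. For pre-Hilbert modules the
adjoint `T*` is determined by `T`, see `AdjointableMap.ext_of_toFun`. -/
structure AdjointableMap where
  /-- The operator `T`. -/
  toFun : X →ₗ[ℂ] Y
  /-- The adjoint `T*`. -/
  adj : Y →ₗ[ℂ] X
  map_act : ∀ x (a : A), toFun (act x a) = act (toFun x) a
  adj_act : ∀ y (a : A), adj (act y a) = act (adj y) a
  ip_adj : ∀ x y, (ip (toFun x) y : A) = ip x (adj y)

namespace AdjointableMap

instance : CoeFun (AdjointableMap A X Y) fun _ => X → Y := ⟨fun T => T.toFun⟩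

lemma ext' {S T : AdjointableMap A X Y} (h : S.toFun = T.toFun) (h' : S.adj = T.adj) : S = T := by
  cases S; cases T; cases h; cases h'; rfl

lemma ext_of_toFun [PreHilbertModule A X] {S T : AdjointableMap A X Y}
    (h : ∀ x, S x = T x) : S = T := by
  refine ext' (LinearMap.ext h) (LinearMap.ext fun y => ip_ext (A := A) fun x => ?_)
  rw [← S.ip_adj, ← T.ip_adj, h]

lemma ip_adj' (T : AdjointableMap A X Y) (y : Y) (x : X) : (ip (T.adj y) x : A) = ip y (T x) := by
  rw [← star_ip, ← T.ip_adj, star_ip]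

/-- The adjoint operator. -/
def adjoint (T : AdjointableMap A X Y) : AdjointableMap A Y X where
  toFun := T.adj
  adj := T.toFun
  map_act := T.adj_act
  adj_act := T.map_act
  ip_adj := T.ip_adj'

/-- Composition of adjointable operators. -/
def comp (S : AdjointableMap A Y Z) (T : AdjointableMap A X Y) : AdjointableMap A X Z where
  toFun := S.toFun ∘ₗ T.toFun
  adj := T.adj ∘ₗ S.adj
  map_act x a := by simp only [LinearMap.comp_apply, T.map_act, S.map_act]
  adj_act x a := by simp only [LinearMap.comp_apply, T.adj_act, S.adj_act]
  ip_adj x z := by simp only [LinearMap.comp_apply, T.ip_adj, S.ip_adj]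

lemma neg_act (x : X) (a : A) : act (-x) a = -act x a := by
  rw [← zero_sub, sub_act, zero_act, zero_sub]

instance : Add (AdjointableMap A X Y) where
  add S T :=
    { toFun := S.toFun + T.toFun
      adj := S.adj + T.adj
      map_act := fun x a => by simp only [LinearMap.add_apply, S.map_act, T.map_act, add_act]
      adj_act := fun x a => by simp only [LinearMap.add_apply, S.adj_act, T.adj_act, add_act]
      ip_adj := fun x y => by
        simp only [LinearMap.add_apply, ip_add_left, ip_add_right, S.ip_adj, T.ip_adj] }

instance : Zero (AdjointableMap A X Y) where
  zero :=
    { toFun := 0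
      adj := 0
      map_act := fun x a => by simp only [LinearMap.zero_apply, zero_act]
      adj_act := fun x a => by simp only [LinearMap.zero_apply, zero_act]
      ip_adj := fun x y => by simp only [LinearMap.zero_apply, ip_zero_left, ip_zero_right] }

instance : Neg (AdjointableMap A X Y) where
  neg T :=
    { toFun := -T.toFun
      adj := -T.adj
      map_act := fun x a => by simp only [LinearMap.neg_apply, T.map_act, neg_act]
      adj_act := fun x a => by simp only [LinearMap.neg_apply, T.adj_act, neg_act]
      ip_adj := fun x y => by
        simp only [LinearMap.neg_apply]
        rw [← zero_sub, ← zero_sub (T.adj y), ip_sub_left, ip_sub_right, T.ip_adj, ip_zero_left,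
          ip_zero_right] }

instance : AddCommGroup (AdjointableMap A X Y) where
  add_assoc _ _ _ := ext' (add_assoc _ _ _) (add_assoc _ _ _)
  zero_add _ := ext' (zero_add _) (zero_add _)
  add_zero _ := ext' (add_zero _) (add_zero _)
  neg_add_cancel _ := ext' (neg_add_cancel _) (neg_add_cancel _)
  add_comm _ _ := ext' (add_comm _ _) (add_comm _ _)
  nsmul := nsmulRec
  zsmul := zsmulRec

lemma add_toFun (S T : AdjointableMap A X Y) : (S + T).toFun = S.toFun + T.toFun := rfl
lemma add_adj (S T : AdjointableMap A X Y) : (S + T).adj = S.adj + T.adj := rfl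

variable [StarModule ℂ A]

instance : SMul ℂ (AdjointableMap A X Y) where
  smul c T :=
    { toFun := c • T.toFun
      adj := star c • T.adj
      map_act := fun x a => by simp only [LinearMap.smul_apply, T.map_act, smul_act]
      adj_act := fun x a => by simp only [LinearMap.smul_apply, T.adj_act, smul_act]
      ip_adj := fun x y => by
        simp only [LinearMap.smul_apply, ip_smul_left, ip_smul_right, T.ip_adj] }

instance : Module ℂ (AdjointableMap A X Y) where
  one_smul _ := ext' (one_smul _ _) (by change star (1 : ℂ) • _ = _; rw [star_one, one_smul])
  mul_smul c d T := ext' (mul_smul _ _ _) (by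
    change star (c * d) • T.adj = star c • star d • T.adj
    rw [star_mul', mul_smul])
  smul_zero _ := ext' (smul_zero _) (smul_zero _)
  smul_add _ _ _ := ext' (smul_add _ _ _) (smul_add _ _ _)
  add_smul c d T := ext' (add_smul _ _ _) (by
    change star (c + d) • T.adj = star c • T.adj + star d • T.adj
    rw [star_add, add_smul])
  zero_smul T := ext' (zero_smul _ _) (by
    change star (0 : ℂ) • T.adj = 0
    rw [star_zero, zero_smul])

lemma smul_toFun (c : ℂ) (T : AdjointableMap A X Y) : (c • T).toFun = c • T.toFun := rfl
lemma smul_adj (c : ℂ) (T : AdjointableMap A X Y) : (c • T).adj = star c • T.adj := rfl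

end AdjointableMap

end Adjointable

/-! ### The multiplier algebra -/

section Multiplier

/-- The multipliers of `A`: pairs `(l, r)` of linear maps `A → A` with `l (a b) = l(a) b`,
`r (a b) = a r(b)` and `a l(b) = r(a) b`. -/
@[ext]
structure Multiplier (A : Type u) [NonUnitalRing A] [StarRing A] [Module ℂ A] where
  l : A →ₗ[ℂ] A
  r : A →ₗ[ℂ] A
  l_mul : ∀ a b, l (a * b) = l a * b
  r_mul : ∀ a b, r (a * b) = a * r b
  central : ∀ a b, a * l b = r a * b

namespace Multiplier

variable {A : Type u} [NonUnitalRing A] [StarRing A] [Module ℂ A]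

instance : Add (Multiplier A) where
  add m n :=
    { l := m.l + n.l
      r := m.r + n.r
      l_mul := fun a b => by simp only [LinearMap.add_apply, m.l_mul, n.l_mul, add_mul]
      r_mul := fun a b => by simp only [LinearMap.add_apply, m.r_mul, n.r_mul, mul_add]
      central := fun a b => by
        simp only [LinearMap.add_apply, mul_add, add_mul, m.central, n.central] }

instance : Zero (Multiplier A) where
  zero :=
    { l := 0
      r := 0
      l_mul := fun a b => by simp only [LinearMap.zero_apply, zero_mul]
      r_mul := fun a b => by simp only [LinearMap.zero_apply, mul_zero]
      central := fun a b => by simp only [LinearMap.zero_apply, mul_zero, zero_mul] }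

instance : Neg (Multiplier A) where
  neg m :=
    { l := -m.l
      r := -m.r
      l_mul := fun a b => by simp only [LinearMap.neg_apply, m.l_mul, neg_mul]
      r_mul := fun a b => by simp only [LinearMap.neg_apply, m.r_mul, mul_neg]
      central := fun a b => by simp only [LinearMap.neg_apply, mul_neg, neg_mul, m.central] }

instance : Mul (Multiplier A) where
  mul m n :=
    { l := m.l ∘ₗ n.l
      r := n.r ∘ₗ m.r
      l_mul := fun a b => by simp only [LinearMap.comp_apply, m.l_mul, n.l_mul]
      r_mul := fun a b => by simp only [LinearMap.comp_apply, m.r_mul, n.r_mul]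
      central := fun a b => by simp only [LinearMap.comp_apply, m.central, n.central] }

instance : One (Multiplier A) where
  one :=
    { l := LinearMap.id
      r := LinearMap.id
      l_mul := fun _ _ => rfl
      r_mul := fun _ _ => rfl
      central := fun _ _ => rfl }

lemma add_l (m n : Multiplier A) : (m + n).l = m.l + n.l := rfl
lemma add_r (m n : Multiplier A) : (m + n).r = m.r + n.r := rfl
lemma mul_l (m n : Multiplier A) : (m * n).l = m.l ∘ₗ n.l := rfl
lemma mul_r (m n : Multiplier A) : (m * n).r = n.r ∘ₗ m.r := rfl

/-- The multiplier algebra `M(A)`, with `(l₁, r₁) (l₂, r₂) = (l₁ l₂, r₂ r₁)`. -/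
instance : Ring (Multiplier A) where
  add_assoc _ _ _ := Multiplier.ext (add_assoc _ _ _) (add_assoc _ _ _)
  zero_add _ := Multiplier.ext (zero_add _) (zero_add _)
  add_zero _ := Multiplier.ext (add_zero _) (add_zero _)
  neg_add_cancel _ := Multiplier.ext (neg_add_cancel _) (neg_add_cancel _)
  add_comm _ _ := Multiplier.ext (add_comm _ _) (add_comm _ _)
  nsmul := nsmulRec
  zsmul := zsmulRec
  left_distrib m n k := Multiplier.ext (LinearMap.comp_add _ _ _) (LinearMap.add_comp _ _ _)
  right_distrib m n k := Multiplier.ext (LinearMap.add_comp _ _ _) (LinearMap.comp_add _ _ _)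
  zero_mul _ := Multiplier.ext (LinearMap.zero_comp _) (LinearMap.comp_zero _)
  mul_zero _ := Multiplier.ext (LinearMap.comp_zero _) (LinearMap.zero_comp _)
  mul_assoc _ _ _ := Multiplier.ext rfl rfl
  one_mul _ := Multiplier.ext rfl rfl
  mul_one _ := Multiplier.ext rfl rfl

section

variable [IsScalarTower ℂ A A] [SMulCommClass ℂ A A]

instance : SMul ℂ (Multiplier A) where
  smul c m :=
    { l := c • m.l
      r := c • m.r
      l_mul := fun a b => by simp only [LinearMap.smul_apply, m.l_mul, smul_mul_assoc]
      r_mul := fun a b => by simp only [LinearMap.smul_apply, m.r_mul, mul_smul_comm]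
      central := fun a b => by
        simp only [LinearMap.smul_apply, mul_smul_comm, smul_mul_assoc, m.central] }

instance : Module ℂ (Multiplier A) where
  one_smul _ := Multiplier.ext (one_smul _ _) (one_smul _ _)
  mul_smul _ _ _ := Multiplier.ext (mul_smul _ _ _) (mul_smul _ _ _)
  smul_zero _ := Multiplier.ext (smul_zero _) (smul_zero _)
  smul_add _ _ _ := Multiplier.ext (smul_add _ _ _) (smul_add _ _ _)
  add_smul _ _ _ := Multiplier.ext (add_smul _ _ _) (add_smul _ _ _)
  zero_smul _ := Multiplier.ext (zero_smul _ _) (zero_smul _ _)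

instance : IsScalarTower ℂ (Multiplier A) (Multiplier A) where
  smul_assoc _ _ _ := Multiplier.ext (LinearMap.smul_comp _ _ _) (LinearMap.comp_smul _ _ _)

instance : SMulCommClass ℂ (Multiplier A) (Multiplier A) where
  smul_comm _ _ _ := Multiplier.ext (LinearMap.comp_smul _ _ _).symm (LinearMap.smul_comp _ _ _).symm

lemma smul_l (c : ℂ) (m : Multiplier A) : (c • m).l = c • m.l := rfl
lemma smul_r (c : ℂ) (m : Multiplier A) : (c • m).r = c • m.r := rfl

end

section

variable [StarModule ℂ A]

/-- For a linear map `f`, the linear map `a ↦ f(a*)*`. -/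
def starConj (f : A →ₗ[ℂ] A) : A →ₗ[ℂ] A where
  toFun a := star (f (star a))
  map_add' a b := by rw [star_add, map_add, star_add]
  map_smul' c a := by rw [star_smul, map_smul, star_smul, star_star]; rfl

lemma starConj_apply (f : A →ₗ[ℂ] A) (a : A) : starConj f a = star (f (star a)) := rfl

/-- The involution `(l, r)* = (a ↦ r(a*)*, a ↦ l(a*)*)`. -/
instance : Star (Multiplier A) where
  star m :=
    { l := starConj m.r
      r := starConj m.l
      l_mul := fun a b => by
        simp only [starConj_apply, star_mul, m.r_mul, star_star]
      r_mul := fun a b => by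
        simp only [starConj_apply, star_mul, m.l_mul, star_star]
      central := fun a b => by
        simp only [starConj_apply]
        rw [← star_star a, ← star_mul, ← m.central, star_mul, star_star, star_star] }

lemma star_l (m : Multiplier A) (a : A) : (star m).l a = star (m.r (star a)) := rfl
lemma star_r (m : Multiplier A) (a : A) : (star m).r a = star (m.l (star a)) := rfl

instance : StarRing (Multiplier A) where
  star_involutive m := by
    apply Multiplier.ext <;> ext a
    · rw [star_l, star_r, star_star, star_star]
    · rw [star_r, star_l, star_star, star_star]
  star_mul m n := by
    apply Multiplier.ext <;> ext a
    · simp only [star_l, mul_l, mul_r, LinearMap.comp_apply, star_star]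
    · simp only [star_r, mul_l, mul_r, LinearMap.comp_apply, star_star]
  star_add m n := by
    apply Multiplier.ext <;> ext a
    · simp only [star_l, add_l, add_r, LinearMap.add_apply, star_add]
    · simp only [star_r, add_l, add_r, LinearMap.add_apply, star_add]

instance [IsScalarTower ℂ A A] [SMulCommClass ℂ A A] : StarModule ℂ (Multiplier A) where
  star_smul c m := by
    apply Multiplier.ext <;> ext a
    · simp only [star_l, smul_l, smul_r, LinearMap.smul_apply, star_smul]
    · simp only [star_r, smul_l, smul_r, LinearMap.smul_apply, star_smul]

end

section

variable [IsScalarTower ℂ A A] [SMulCommClass ℂ A A] [StarModule ℂ A]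

/-- The element `a` of `A` as the multiplier `(b ↦ a b, b ↦ b a)`. -/
def ofElt (a : A) : Multiplier A where
  l := LinearMap.mulLeft ℂ a
  r := LinearMap.mulRight ℂ a
  l_mul b c := (mul_assoc a b c).symm
  r_mul b c := mul_assoc b c a
  central b c := (mul_assoc b a c).symm

/-- The identification of `M(A)` with `L_A(A)`, from left to right: `(l, r)` acts as `l`. -/
def toAdj (m : Multiplier A) : AdjointableMap A A A where
  toFun := m.l
  adj := (star m).l
  map_act := m.l_mul
  adj_act := (star m).l_mul
  ip_adj a b := by
    rw [ip_self, ip_self, star_l]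
    apply star_injective
    rw [star_mul, star_mul, star_star, star_star, star_star, m.central]

/-- The identification of `M(A)` with `L_A(A)`, from right to left: `T` is the multiplier
`(T, a ↦ T*(a*)*)`. -/
def ofAdj (T : AdjointableMap A A A) : Multiplier A where
  l := T.toFun
  r := starConj T.adj
  l_mul := T.map_act
  r_mul a b := by
    have := T.adj_act (star b) (star a)
    rw [act_self, act_self] at this
    rw [starConj_apply, starConj_apply, star_mul, this, star_mul, star_star]
  central a b := by
    have := T.ip_adj' (star a) b
    rw [ip_self, ip_self, star_star] at this
    exact this.symm

end

/-- The set `{N (l a) | N a ≤ 1}`. -/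
def ballValues (N : A → ℝ) (m : Multiplier A) : Set ℝ := {x | ∃ a, N a ≤ 1 ∧ x = N (m.l a)}

/-- The seminorm `(l, r) ↦ sup {N (l a) | N a ≤ 1}` on `M(A)` defined by a seminorm `N` on
`A`. -/
def mnorm (N : A → ℝ) (m : Multiplier A) : ℝ := sSup (ballValues N m)

section Map

variable {B : Type v} [NonUnitalRing B] [StarRing B] [Module ℂ B]
  [IsScalarTower ℂ A A] [SMulCommClass ℂ A A] [StarModule ℂ A]
  [IsScalarTower ℂ B B] [SMulCommClass ℂ B B] [StarModule ℂ B] [PreHilbertModule B B]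

lemma eq_zero_of_star_mul_self {b : B} (h : star b * b = 0) : b = 0 :=
  PreHilbertModule.ip_self_eq_zero (A := B) b h

variable (φ : A →⋆ₙₐ[ℂ] B)

lemma map_l_eq_zero (m : Multiplier A) {a : A} (h : φ a = 0) : φ (m.l a) = 0 := by
  apply eq_zero_of_star_mul_self
  rw [← map_star, ← map_mul, m.central, map_mul, h, mul_zero]

lemma map_r_eq_zero (m : Multiplier A) {a : A} (h : φ a = 0) : φ (m.r a) = 0 := by
  have h' : φ (star a) = 0 := by rw [map_star, h, star_zero]
  have := map_l_eq_zero φ (star m) h'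
  rwa [star_l, star_star, map_star, star_eq_zero] at this

variable {φ} (hφ : Function.Surjective φ)

/-- The linear map `B → B` induced by a linear map `f : A → A` through the surjection `φ`. -/
def descend (f : A →ₗ[ℂ] A) (hf : ∀ a, φ a = 0 → φ (f a) = 0) : B →ₗ[ℂ] B where
  toFun b := φ (f (Function.surjInv hφ b))
  map_add' b c := by
    rw [← map_add, ← map_add, ← sub_eq_zero, ← map_sub, ← map_sub]
    apply hf
    simp only [map_sub, map_add, Function.surjInv_eq, sub_self]
  map_smul' c b := by
    rw [RingHom.id_apply, ← map_smul, ← map_smul, ← sub_eq_zero, ← map_sub, ← map_sub]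
    apply hf
    simp only [map_sub, map_smul, Function.surjInv_eq, sub_self]

lemma descend_apply (f : A →ₗ[ℂ] A) (hf : ∀ a, φ a = 0 → φ (f a) = 0) (a : A) :
    descend hφ f hf (φ a) = φ (f a) := by
  change φ (f (Function.surjInv hφ (φ a))) = φ (f a)
  rw [← sub_eq_zero, ← map_sub, ← map_sub]
  apply hf
  simp only [map_sub, Function.surjInv_eq, sub_self]

/-- The multiplier `(l', r')` of `B` with `l' (φ a) = φ (l a)` and `r' (φ a) = φ (r a)`. -/
def mapElt (m : Multiplier A) : Multiplier B where
  l := descend hφ m.l fun _ => map_l_eq_zero φ m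
  r := descend hφ m.r fun _ => map_r_eq_zero φ m
  l_mul x y := by
    obtain ⟨a, rfl⟩ := hφ x
    obtain ⟨b, rfl⟩ := hφ y
    rw [← map_mul, descend_apply, descend_apply, m.l_mul, map_mul]
  r_mul x y := by
    obtain ⟨a, rfl⟩ := hφ x
    obtain ⟨b, rfl⟩ := hφ y
    rw [← map_mul, descend_apply, descend_apply, m.r_mul, map_mul]
  central x y := by
    obtain ⟨a, rfl⟩ := hφ x
    obtain ⟨b, rfl⟩ := hφ y
    rw [descend_apply, descend_apply, ← map_mul, ← map_mul, m.central]

lemma mapElt_l (m : Multiplier A) (a : A) : (mapElt hφ m).l (φ a) = φ (m.l a) :=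
  descend_apply hφ m.l (fun _ => map_l_eq_zero φ m) a

lemma mapElt_r (m : Multiplier A) (a : A) : (mapElt hφ m).r (φ a) = φ (m.r a) :=
  descend_apply hφ m.r (fun _ => map_r_eq_zero φ m) a

lemma ext_of_surjective (hφ : Function.Surjective φ) {m n : Multiplier B} (hl : ∀ a, m.l (φ a) = n.l (φ a))
    (hr : ∀ a, m.r (φ a) = n.r (φ a)) : m = n := by
  apply Multiplier.ext <;> ext x <;> obtain ⟨a, rfl⟩ := hφ x
  exacts [hl a, hr a]

/-- The *-homomorphism `M(A) → M(B)` extending a surjective *-homomorphism `φ : A → B`: it maps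
`(l, r)` to the multiplier `(l', r')` with `l' (φ a) = φ (l a)` and `r' (φ a) = φ (r a)`. -/
def map : Multiplier A →⋆ₙₐ[ℂ] Multiplier B where
  toFun := mapElt hφ
  map_smul' c m := ext_of_surjective hφ
    (fun a => by
      change (mapElt hφ (c • m)).l (φ a) = c • (mapElt hφ m).l (φ a)
      rw [mapElt_l, mapElt_l, smul_l, LinearMap.smul_apply, map_smul])
    (fun a => by
      change (mapElt hφ (c • m)).r (φ a) = c • (mapElt hφ m).r (φ a)
      rw [mapElt_r, mapElt_r, smul_r, LinearMap.smul_apply, map_smul])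
  map_zero' := ext_of_surjective hφ
    (fun a => by rw [mapElt_l]; exact map_zero φ) (fun a => by rw [mapElt_r]; exact map_zero φ)
  map_add' m n := ext_of_surjective hφ
    (fun a => by
      rw [mapElt_l, add_l, add_l, LinearMap.add_apply, LinearMap.add_apply, mapElt_l, mapElt_l,
        map_add])
    (fun a => by
      rw [mapElt_r, add_r, add_r, LinearMap.add_apply, LinearMap.add_apply, mapElt_r, mapElt_r,
        map_add])
  map_mul' m n := ext_of_surjective hφ
    (fun a => by
      rw [mapElt_l, mul_l, mul_l, LinearMap.comp_apply, LinearMap.comp_apply, mapElt_l, mapElt_l])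
    (fun a => by
      rw [mapElt_r, mul_r, mul_r, LinearMap.comp_apply, LinearMap.comp_apply, mapElt_r, mapElt_r])
  map_star' m := ext_of_surjective hφ
    (fun a => by rw [mapElt_l, star_l, star_l, ← map_star φ, mapElt_r, map_star φ])
    (fun a => by rw [mapElt_r, star_r, star_r, ← map_star φ, mapElt_l, map_star φ])

lemma map_l (m : Multiplier A) (a : A) : (map hφ m).l (φ a) = φ (m.l a) := mapElt_l hφ m a
lemma map_r (m : Multiplier A) (a : A) : (map hφ m).r (φ a) = φ (m.r a) := mapElt_r hφ m a

end Map

end Multiplier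

end Multiplier

/-! ### Operators induced on quotients -/

section Push

variable {A : Type u} [NonUnitalRing A] [StarRing A] [Module ℂ A]
variable {X : Type v} [AddCommGroup X] [Module ℂ X] [InnerModule A X]
variable {Y : Type w} [AddCommGroup Y] [Module ℂ Y] [InnerModule A Y]
variable {B : Type*} [NonUnitalRing B] [StarRing B] [Module ℂ B]
variable {X' : Type*} [AddCommGroup X'] [Module ℂ X'] [InnerModule B X']
variable {Y' : Type*} [AddCommGroup Y'] [Module ℂ Y'] [InnerModule B Y']

/-- A surjective linear map `σ : X → X'` compatible with the module actions and the inner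
products along a surjective *-homomorphism `φ : A → B`. -/
structure IsModuleQuotient (φ : A →⋆ₙₐ[ℂ] B) (σ : X →ₗ[ℂ] X') : Prop where
  surj_alg : Function.Surjective φ
  surj : Function.Surjective σ
  map_act : ∀ x a, σ (act x a) = act (σ x) (φ a)
  map_ip : ∀ x y, φ (ip x y) = ip (σ x) (σ y)

section Descend

variable {φ : A →⋆ₙₐ[ℂ] B} {σ : X →ₗ[ℂ] X'} {τ : Y →ₗ[ℂ] Y'}
  (hσ : IsModuleQuotient φ σ) (hτ : IsModuleQuotient φ τ)

lemma descend_eq_zero [PreHilbertModule B Y'] (T : AdjointableMap A X Y) {x : X}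
    (hx : σ x = 0) (hσ : IsModuleQuotient φ σ) (hτ : IsModuleQuotient φ τ) : τ (T x) = 0 := by
  apply PreHilbertModule.ip_self_eq_zero (A := B)
  rw [← hτ.map_ip, T.ip_adj, hσ.map_ip, hx, ip_zero_left]

lemma descend_congr [PreHilbertModule B Y'] (T : AdjointableMap A X Y) {x y : X}
    (hx : σ x = σ y) (hσ : IsModuleQuotient φ σ) (hτ : IsModuleQuotient φ τ) :
    τ (T x) = τ (T y) := by
  rw [← sub_eq_zero, ← map_sub, ← map_sub]
  exact descend_eq_zero T (by rw [map_sub, hx, sub_self]) hσ hτ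

/-- The linear map `T'` with `T' (σ x) = τ (T x)`. -/
def descendMap [PreHilbertModule B Y'] (T : AdjointableMap A X Y) : X' →ₗ[ℂ] Y' where
  toFun x' := τ (T (Function.surjInv hσ.surj x'))
  map_add' x y := by
    rw [← map_add, ← map_add]
    exact descend_congr T (by simp only [map_add, Function.surjInv_eq]) hσ hτ
  map_smul' c x := by
    rw [RingHom.id_apply, ← map_smul, ← map_smul]
    exact descend_congr T (by simp only [map_smul, Function.surjInv_eq]) hσ hτ

lemma descendMap_apply [PreHilbertModule B Y'] (T : AdjointableMap A X Y) (x : X) :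
    descendMap hσ hτ T (σ x) = τ (T x) :=
  descend_congr T (Function.surjInv_eq hσ.surj _) hσ hτ

variable [PreHilbertModule B X'] [PreHilbertModule B Y']

/-- The adjointable operator `T' : X' → Y'` induced by `T : X → Y`: it is given by
`T' (σ x) = τ (T x)` and `T'* (τ y) = σ (T* y)`. -/
def pushElt (T : AdjointableMap A X Y) : AdjointableMap B X' Y' where
  toFun := descendMap hσ hτ T
  adj := descendMap hτ hσ T.adjoint
  map_act x b := by
    obtain ⟨x, rfl⟩ := hσ.surj x
    obtain ⟨a, rfl⟩ := hσ.surj_alg b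
    rw [← hσ.map_act, descendMap_apply, descendMap_apply, T.map_act, hτ.map_act]
  adj_act y b := by
    obtain ⟨y, rfl⟩ := hτ.surj y
    obtain ⟨a, rfl⟩ := hσ.surj_alg b
    rw [← hτ.map_act, descendMap_apply, descendMap_apply, T.adjoint.map_act, hσ.map_act]
  ip_adj x y := by
    obtain ⟨x, rfl⟩ := hσ.surj x
    obtain ⟨y, rfl⟩ := hτ.surj y
    rw [descendMap_apply, descendMap_apply, ← hτ.map_ip, ← hσ.map_ip, T.ip_adj]
    rfl

variable [StarModule ℂ A] [StarModule ℂ B]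

/-- The map `T ↦ T'`, linear in `T`. -/
def push : AdjointableMap A X Y →ₗ[ℂ] AdjointableMap B X' Y' where
  toFun := pushElt hσ hτ
  map_add' S T := by
    apply AdjointableMap.ext_of_toFun
    intro x
    obtain ⟨x, rfl⟩ := hσ.surj x
    change descendMap hσ hτ (S + T) (σ x) = descendMap hσ hτ S (σ x) + descendMap hσ hτ T (σ x)
    rw [descendMap_apply, descendMap_apply, descendMap_apply, AdjointableMap.add_toFun,
      LinearMap.add_apply, map_add]
  map_smul' c T := by
    apply AdjointableMap.ext_of_toFun
    intro x
    obtain ⟨x, rfl⟩ := hσ.surj x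
    change descendMap hσ hτ (c • T) (σ x) = c • descendMap hσ hτ T (σ x)
    rw [descendMap_apply, descendMap_apply, AdjointableMap.smul_toFun,
      LinearMap.smul_apply, map_smul]

lemma push_apply (T : AdjointableMap A X Y) (x : X) : push hσ hτ T (σ x) = τ (T x) :=
  descendMap_apply hσ hτ T x

lemma push_adj (T : AdjointableMap A X Y) (y : Y) : (push hσ hτ T).adj (τ y) = σ (T.adj y) :=
  descendMap_apply hτ hσ T.adjoint y

end Descend

end Push

/-! ### The multiplier module -/

section MultiplierModule

variable (A : Type u) [NonUnitalRing A] [StarRing A] [Module ℂ A] [IsScalarTower ℂ A A]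
  [SMulCommClass ℂ A A]
variable (E : Type v) [AddCommGroup E] [Module ℂ E] [InnerModule A E]

/-- The multiplier module `M(E) = L_A(A, E)`. -/
abbrev MultiplierModule : Type (max u v) := AdjointableMap A A E

namespace MultiplierModule

variable {A E}

lemma ofAdj_l (T : AdjointableMap A A A) [StarModule ℂ A] : (Multiplier.ofAdj T).l = T.toFun := rfl
lemma ofAdj_r (T : AdjointableMap A A A) [StarModule ℂ A] (a : A) :
    (Multiplier.ofAdj T).r a = star (T.adj (star a)) := rfl

/-- `M(E)` as an inner product `M(A)`-module: `t · m = t ∘ m` and `⟨s, t⟩ = s* ∘ t`, where `M(A)`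
is identified with `L_A(A)`. -/
instance [StarModule ℂ A] : InnerModule (Multiplier A) (MultiplierModule A E) where
  act t m := t.comp m.toAdj
  ip s t := Multiplier.ofAdj (s.adjoint.comp t)
  add_act s t m := AdjointableMap.ext' (LinearMap.add_comp _ _ _) (LinearMap.comp_add _ _ _)
  act_add t m n := AdjointableMap.ext' (LinearMap.comp_add _ _ _) (by
    change (star (m + n)).l ∘ₗ t.adj = (star m).l ∘ₗ t.adj + (star n).l ∘ₗ t.adj
    rw [star_add, Multiplier.add_l, LinearMap.add_comp])
  act_mul t m n := AdjointableMap.ext' rfl (by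
    change (star (m * n)).l ∘ₗ t.adj = (star n).l ∘ₗ ((star m).l ∘ₗ t.adj)
    rw [star_mul, Multiplier.mul_l, LinearMap.comp_assoc])
  smul_act c t m := AdjointableMap.ext' (LinearMap.smul_comp _ _ _) (LinearMap.comp_smul _ _ _)
  act_smul c t m := AdjointableMap.ext' (LinearMap.comp_smul _ _ _) (by
    change (star (c • m)).l ∘ₗ t.adj = star c • ((star m).l ∘ₗ t.adj)
    rw [star_smul, Multiplier.smul_l, LinearMap.smul_comp])
  ip_add_right s t t' := by
    apply Multiplier.ext
    · exact LinearMap.comp_add _ _ _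
    · ext a
      change star ((t.adj + t'.adj) (s (star a))) =
        star (t.adj (s (star a))) + star (t'.adj (s (star a)))
      rw [LinearMap.add_apply, star_add]
  ip_smul_right c s t := by
    apply Multiplier.ext
    · exact LinearMap.comp_smul _ _ _
    · ext a
      change star ((star c • t.adj) (s (star a))) = c • star (t.adj (s (star a)))
      rw [LinearMap.smul_apply, star_smul, star_star]
  ip_act_right s t m := by
    apply Multiplier.ext
    · rfl
    · ext a
      change star ((star m).l (t.adj (s (star a)))) = m.r (star (t.adj (s (star a))))
      rw [Multiplier.star_l, star_star]
  star_ip s t := by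
    apply Multiplier.ext <;> ext a
    · change star (star (t.adj (s (star (star a))))) = t.adj (s a)
      rw [star_star, star_star]
    · rfl

lemma act_apply [StarModule ℂ A] (t : MultiplierModule A E) (m : Multiplier A) (a : A) :
    (act t m : MultiplierModule A E) a = t (m.l a) := rfl

lemma ip_l [StarModule ℂ A] (s t : MultiplierModule A E) (a : A) :
    (ip s t : Multiplier A).l a = s.adj (t a) := rfl

variable (A E) in
/-- The map `i_E : E → M(E)`, `i_E(ξ)(a) = ξ a`. -/
def embed [StarModule ℂ A] : E →ₗ[ℂ] MultiplierModule A E where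
  toFun ξ :=
    { toFun :=
        { toFun := fun a => act ξ a
          map_add' := act_add ξ
          map_smul' := fun c a => act_smul c ξ a }
      adj :=
        { toFun := fun η => ip ξ η
          map_add' := ip_add_right ξ
          map_smul' := fun c η => ip_smul_right c ξ η }
      map_act := fun a b => act_mul ξ a b
      adj_act := fun η a => ip_act_right ξ η a
      ip_adj := fun a η => ip_act_left ξ η a }
  map_add' ξ η := AdjointableMap.ext' (LinearMap.ext fun a => add_act ξ η a)
    (LinearMap.ext fun ζ => ip_add_left ξ η ζ)
  map_smul' c ξ := AdjointableMap.ext' (LinearMap.ext fun a => smul_act c ξ a)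
    (LinearMap.ext fun ζ => ip_smul_left c ξ ζ)

/-- The seminorms `‖t‖_{i, a, ξ} = ‖t(a)‖ᵢ + ‖t*(ξ)‖ᵢ` on `M(E)`, for a family of seminorms `N i`
that defines the topology of `A`. -/
def strictSeminorm {ι : Type*} (N : ι → A → ℝ) (i : ι × A × E) (t : MultiplierModule A E) : ℝ :=
  hnorm (N i.1) (t i.2.1) + N i.1 (t.adj i.2.2)

end MultiplierModule

end MultiplierModule

/-! ### The inverse systems `M(A_p)` and `M(E_p)` and their limits -/

section Limits

variable {A : Type u} [NonUnitalRing A] [StarRing A] [Module ℂ A] [IsScalarTower ℂ A A]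
  [SMulCommClass ℂ A A] [StarModule ℂ A]
variable {E : Type v} [AddCommGroup E] [Module ℂ E] [InnerModule A E] [PreHilbertModule A E]

section Top

variable [TopologicalSpace A]

lemma QuotAlg.mk_isModuleQuotient (p : ContCStarSeminorm A) :
    IsModuleQuotient (QuotAlg.mk p) (QuotAlg.mkₗ p) where
  surj_alg := QuotAlg.mk_surjective
  surj := QuotAlg.mkₗ_surjective
  map_act _ _ := rfl
  map_ip _ _ := rfl

lemma QuotAlg.trans_isModuleQuotient {p q : ContCStarSeminorm A} (h : q ≤ p) :
    IsModuleQuotient (QuotAlg.trans h) (QuotAlg.transₗ h) where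
  surj_alg := QuotAlg.trans_surjective h
  surj := QuotAlg.trans_surjective h
  map_act x y := map_mul (QuotAlg.trans h) x y
  map_ip x y := by
    rw [ip_self, map_mul, map_star]
    rfl

variable (E) in
lemma QuotMod.mk_isModuleQuotient (p : ContCStarSeminorm A) :
    IsModuleQuotient (QuotAlg.mk p) (QuotMod.mk E p) where
  surj_alg := QuotAlg.mk_surjective
  surj := QuotMod.mk_surjective
  map_act _ _ := rfl
  map_ip _ _ := rfl

variable (E) in
lemma QuotMod.trans_isModuleQuotient {p q : ContCStarSeminorm A} (h : q ≤ p) :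
    IsModuleQuotient (QuotAlg.trans h) (QuotMod.trans E h) where
  surj_alg := QuotAlg.trans_surjective h
  surj y := by
    obtain ⟨ξ, rfl⟩ := QuotMod.mk_surjective y
    exact ⟨QuotMod.mk E p ξ, rfl⟩
  map_act x a := by
    obtain ⟨ξ, rfl⟩ := QuotMod.mk_surjective x
    obtain ⟨a, rfl⟩ := QuotAlg.mk_surjective a
    rfl
  map_ip x y := by
    obtain ⟨ξ, rfl⟩ := QuotMod.mk_surjective x
    obtain ⟨η, rfl⟩ := QuotMod.mk_surjective y
    rfl

/-- The connecting *-homomorphism `π''_pq : M(A_p) → M(A_q)`, the extension of `π_pq`. -/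
def multTrans {p q : ContCStarSeminorm A} (h : q ≤ p) :
    Multiplier (QuotAlg p) →⋆ₙₐ[ℂ] Multiplier (QuotAlg q) :=
  Multiplier.map (QuotAlg.trans_surjective h)

/-- The canonical *-homomorphism `M(A) → M(A_p)`, the extension of `π_p`. -/
def multProj (p : ContCStarSeminorm A) : Multiplier A →⋆ₙₐ[ℂ] Multiplier (QuotAlg p) :=
  Multiplier.map QuotAlg.mk_surjective

variable (E) in
/-- The connecting map `(π_pq)_* : M(E_p) → M(E_q)`, given by
`(π_pq)_*(t) (π_q a) = σ_pq (t (π_p a))`. -/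
def modTrans {p q : ContCStarSeminorm A} (h : q ≤ p) :
    MultiplierModule (QuotAlg p) (QuotMod E p) →ₗ[ℂ]
      MultiplierModule (QuotAlg q) (QuotMod E q) :=
  push (QuotAlg.trans_isModuleQuotient h) (QuotMod.trans_isModuleQuotient E h)

variable (A) in
/-- The inverse limit of the system of *-algebras `M(A_p)`. -/
def LimMult : NonUnitalStarSubalgebra ℂ (∀ p : ContCStarSeminorm A, Multiplier (QuotAlg p)) where
  carrier := {m | ∀ (p q : ContCStarSeminorm A) (h : q ≤ p), multTrans h (m p) = m q}
  add_mem' {m n} hm hn p q h := by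
    rw [Pi.add_apply, Pi.add_apply, map_add, hm p q h, hn p q h]
  zero_mem' p q h := map_zero (multTrans h)
  mul_mem' {m n} hm hn p q h := by
    rw [Pi.mul_apply, Pi.mul_apply, map_mul, hm p q h, hn p q h]
  smul_mem' c m hm p q h := by
    rw [Pi.smul_apply, Pi.smul_apply, map_smul, hm p q h]
  star_mem' {m} hm p q h := by
    rw [Pi.star_apply, Pi.star_apply, map_star, hm p q h]

variable (A E) in
/-- The inverse limit of the system of vector spaces `M(E_p)`. -/
def LimMod :
    Submodule ℂ (∀ p : ContCStarSeminorm A, MultiplierModule (QuotAlg p) (QuotMod E p)) where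
  carrier := {t | ∀ (p q : ContCStarSeminorm A) (h : q ≤ p), modTrans E h (t p) = t q}
  add_mem' {s t} hs ht p q h := by
    rw [Pi.add_apply, Pi.add_apply, map_add, hs p q h, ht p q h]
  zero_mem' p q h := map_zero (modTrans E h)
  smul_mem' c t ht p q h := by
    rw [Pi.smul_apply, Pi.smul_apply, map_smul, ht p q h]

variable (E) in
/-- The canonical map `(π_p)_* : M(E) → M(E_p)`, given by `(π_p)_*(t) (π_p a) = σ_p (t a)`. -/
def modProj (p : ContCStarSeminorm A) :
    MultiplierModule A E →ₗ[ℂ] MultiplierModule (QuotAlg p) (QuotMod E p) :=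
  push (QuotAlg.mk_isModuleQuotient p) (QuotMod.mk_isModuleQuotient E p)

lemma modTrans_apply {p q : ContCStarSeminorm A} (h : q ≤ p)
    (t : MultiplierModule (QuotAlg p) (QuotMod E p)) (x : QuotAlg p) :
    modTrans E h t (QuotAlg.trans h x) = QuotMod.trans E h (t x) :=
  push_apply (QuotAlg.trans_isModuleQuotient h) (QuotMod.trans_isModuleQuotient E h) t x

lemma modTrans_adj {p q : ContCStarSeminorm A} (h : q ≤ p)
    (t : MultiplierModule (QuotAlg p) (QuotMod E p)) (x : QuotMod E p) :
    (modTrans E h t).adj (QuotMod.trans E h x) = QuotAlg.trans h (t.adj x) :=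
  push_adj (QuotAlg.trans_isModuleQuotient h) (QuotMod.trans_isModuleQuotient E h) t x

lemma modProj_apply (p : ContCStarSeminorm A) (t : MultiplierModule A E) (a : A) :
    modProj E p t (QuotAlg.mk p a) = QuotMod.mk E p (t a) :=
  push_apply (QuotAlg.mk_isModuleQuotient p) (QuotMod.mk_isModuleQuotient E p) t a

lemma modProj_adj (p : ContCStarSeminorm A) (t : MultiplierModule A E) (ξ : E) :
    (modProj E p t).adj (QuotMod.mk E p ξ) = QuotAlg.mk p (t.adj ξ) :=
  push_adj (QuotAlg.mk_isModuleQuotient p) (QuotMod.mk_isModuleQuotient E p) t ξ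

lemma modTrans_act {p q : ContCStarSeminorm A} (h : q ≤ p)
    (t : MultiplierModule (QuotAlg p) (QuotMod E p)) (m : Multiplier (QuotAlg p)) :
    modTrans E h (act t m) = act (modTrans E h t) (multTrans h m) := by
  apply AdjointableMap.ext_of_toFun
  intro x
  obtain ⟨x, rfl⟩ := QuotAlg.trans_surjective h x
  rw [modTrans_apply, MultiplierModule.act_apply, MultiplierModule.act_apply, multTrans,
    Multiplier.map_l, modTrans_apply]

lemma modTrans_ip {p q : ContCStarSeminorm A} (h : q ≤ p)
    (s t : MultiplierModule (QuotAlg p) (QuotMod E p)) :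
    (ip (modTrans E h s) (modTrans E h t) : Multiplier (QuotAlg q)) =
      multTrans h (ip s t) := by
  apply Multiplier.ext_of_surjective (QuotAlg.trans_surjective h)
  · intro x
    rw [MultiplierModule.ip_l, modTrans_apply, modTrans_adj, multTrans, Multiplier.map_l,
      MultiplierModule.ip_l]
  · intro x
    rw [multTrans, Multiplier.map_r]
    change star ((modTrans E h t).adj (modTrans E h s (star (QuotAlg.trans h x)))) =
      QuotAlg.trans h (star (t.adj (s (star x))))
    rw [← map_star (QuotAlg.trans h), modTrans_apply, modTrans_adj, ← map_star (QuotAlg.trans h)]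

/-- `lim M(E_p)` as an inner product module over `lim M(A_p)`, with componentwise operations. -/
instance : InnerModule (LimMult A) (LimMod A E) where
  act t m := ⟨fun p => act (t.1 p) (m.1 p), fun p q h => by
    rw [modTrans_act, t.2 p q h, m.2 p q h]⟩
  ip s t := ⟨fun p => ip (s.1 p) (t.1 p), fun p q h => by
    rw [← modTrans_ip, s.2 p q h, t.2 p q h]⟩
  add_act _ _ _ := Subtype.ext (funext fun _ => add_act _ _ _)
  act_add _ _ _ := Subtype.ext (funext fun _ => act_add _ _ _)
  act_mul _ _ _ := Subtype.ext (funext fun _ => act_mul _ _ _)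
  smul_act _ _ _ := Subtype.ext (funext fun _ => smul_act _ _ _)
  act_smul _ _ _ := Subtype.ext (funext fun _ => act_smul _ _ _)
  ip_add_right _ _ _ := Subtype.ext (funext fun _ => ip_add_right _ _ _)
  ip_smul_right _ _ _ := Subtype.ext (funext fun _ => ip_smul_right _ _ _)
  ip_act_right _ _ _ := Subtype.ext (funext fun _ => ip_act_right _ _ _)
  star_ip _ _ := Subtype.ext (funext fun _ => star_ip _ _)

variable (A E) in
/-- The canonical map `U : M(E) → lim M(E_p)`, `U(t) = ((π_p)_*(t))_p`. -/
def limMap : MultiplierModule A E →ₗ[ℂ] LimMod A E where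
  toFun t := ⟨fun p => modProj E p t, fun p q h => by
    apply AdjointableMap.ext_of_toFun
    intro x
    obtain ⟨a, rfl⟩ := QuotAlg.mk_surjective x
    rw [← QuotAlg.trans_mk h, modTrans_apply, modProj_apply, QuotMod.trans_mk, QuotAlg.trans_mk,
      modProj_apply]⟩
  map_add' _ _ := Subtype.ext (funext fun p => map_add (modProj E p) _ _)
  map_smul' _ _ := Subtype.ext (funext fun p => map_smul (modProj E p) _ _)

/-- The seminorm `p_{M(A)}(l, r) = sup {p(l a) | p(a) ≤ 1}` on `M(A)`. -/
def multSeminorm (p : ContCStarSeminorm A) : Multiplier A → ℝ := Multiplier.mnorm p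

/-- The norm of `M(A_p)`. -/
def multNorm (p : ContCStarSeminorm A) : Multiplier (QuotAlg p) → ℝ :=
  Multiplier.mnorm fun x => ‖x‖

variable (A E) in
/-- The strict topology on `M(E)`. -/
@[reducible]
def strictTopology : TopologicalSpace (MultiplierModule A E) :=
  seminormTopology (MultiplierModule.strictSeminorm (E := E) fun p : ContCStarSeminorm A => p)

variable (E) in
/-- The strict topology on `M(E_p)`, for the Hilbert module `E_p` over the C*-algebra `A_p`. -/
@[reducible]
def strictTopologyQuot (p : ContCStarSeminorm A) :
    TopologicalSpace (MultiplierModule (QuotAlg p) (QuotMod E p)) :=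
  seminormTopology
    (MultiplierModule.strictSeminorm (E := QuotMod E p) fun (_ : Unit) (x : QuotAlg p) => ‖x‖)

variable (A E) in
/-- The inverse limit of the strict topologies of the `M(E_p)`: the topology on `lim M(E_p)`
induced by the product topology. -/
@[reducible]
def limStrictTopology : TopologicalSpace (LimMod A E) :=
  @instTopologicalSpaceSubtype _ _ (@Pi.topologicalSpace _ _ (strictTopologyQuot E))

end Top

end Limits

/-! ### Unitary operators -/

section Unitary

variable {B : Type*} [NonUnitalRing B] [StarRing B] [Module ℂ B]
  {C : Type*} [NonUnitalRing C] [StarRing C] [Module ℂ C]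
  {X : Type*} [AddCommGroup X] [Module ℂ X] [InnerModule B X]
  {Y : Type*} [AddCommGroup Y] [Module ℂ Y] [InnerModule C Y]

/-- `U : X → Y` is a unitary operator from the `B`-module `X` to the `C`-module `Y`, where `B` and
`C` are identified through the *-isomorphism `Φ`: `U` is a module morphism that has an adjoint
`V`, a module morphism with `V U = id` and `U V = id`. -/
def IsUnitaryAlong (Φ : B ≃⋆ₐ[ℂ] C) (U : X →ₗ[ℂ] Y) : Prop :=
  (∀ x b, U (act x b) = act (U x) (Φ b)) ∧
    ∃ V : Y →ₗ[ℂ] X, (∀ y b, V (act y (Φ b)) = act (V y) b) ∧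
      (∀ x y, (ip (U x) y : C) = Φ (ip x (V y))) ∧
      V ∘ₗ U = LinearMap.id ∧ U ∘ₗ V = LinearMap.id

end Unitary

end HilbertMult

end

open HilbertMult

/-!
The proof rests on one fact about a Hilbert module `E` over a locally C*-algebra `A`: modulo
`ker p̄_E` every `ξ` has a representative `η` with `q̄_E η ≤ p̄_E ξ` for *all* continuous
C*-seminorms `q` (`exists_bounded_representative`). It is `η = ξ f(⟨ξ, ξ⟩)` for the continuous
function `f(t) = (s / max(s, t))^{1/2}`, `s = p ⟨ξ, ξ⟩`. The calculus is carried out with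
polynomials approximating `f` locally uniformly, whose action on `ξ` is estimated in a unital
C*-algebra through `hnorm_aeval_sq_le`; the completeness of `E` provides the limit. Summing a
series of such representatives shows that `E` is complete for each single seminorm `p̄_E`
(`isCompleteFor_single`), so that `E_p` is a Hilbert module without any completion, and, with
`E = A`, that `A_p` is a C*-algebra.

Hence multipliers of `A_p` are bounded, by the closed graph theorem, and `M(A_p)` is Mathlib's
C*-algebra of double centralizers. There an element `m = m*` is positive as soon as all `a* m(a)`
are (`Multiplier.centralizer_nonneg`), which makes `⟨t, t⟩ = t* t` positive for `t ∈ M(E_p)`. The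
norm of `M(E_p)` is the operator norm, and `M(E_p)` is norm complete because it is strictly
complete: pointwise limits of adjointable maps and of their adjoints form an adjointable map
(`isCompleteFor_strictSemi`).

Because `A` and `E` are complete and `S(A)` is directed, every coherent family in the quotients
`A_p` or `E_p` comes from an element of `A` or `E` (`exists_of_coherent`). Applied to the values of
coherent families of multipliers and of adjointable maps, this gives the surjectivity of `Φ` and
`U`. Positivity in `lim M(A_p)`, and thus in `M(A)`, is componentwise, since positive square roots
are unique and therefore coherent; completeness of `M(A)` and `M(E)` is transported from the
limits. The strict seminorms of `t` are those of its images in the `M(E_p)`, so `U` is a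
homeomorphism. Finally, for an approximate unit `e` of `A_p`, lifted to `A`, the elements `i_E(t e)`
approximate `t` strictly, and the elements `ξ e` approximate `ξ`, which gives density and the
invariance of the closed range of `i_E`.
-/

namespace HilbertMult

noncomputable section

universe u v w

open Filter Topology InnerModule

/-! ### Convergence with respect to a family of seminorms -/

section Families

variable {ι κ α X Y : Type*} [AddCommGroup X] [Module ℂ X] [AddCommGroup Y] [Module ℂ Y]

/-- Convergence of `f` along the filter `F` to `x`, with respect to a family of seminorms. -/
def TendstoFor (S : ι → Seminorm ℂ X) (F : Filter α) (f : α → X) (x : X) : Prop :=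
  ∀ i, Tendsto (fun s => S i (f s - x)) F (𝓝 0)

/-- `f` is Cauchy along the filter `F`, with respect to a family of seminorms. -/
def CauchyFor (S : ι → Seminorm ℂ X) (F : Filter α) (f : α → X) : Prop :=
  ∀ i, ∀ ε : ℝ, 0 < ε → ∃ T ∈ F, ∀ s ∈ T, ∀ t ∈ T, S i (f s - f t) < ε

variable {S : ι → Seminorm ℂ X} {S' : κ → Seminorm ℂ Y} {F : Filter α} {f g : α → X} {x y : X}

lemma tendsto_zero_iff_eventually_lt (p : Seminorm ℂ X) :
    Tendsto (fun s => p (f s)) F (𝓝 0) ↔ ∀ ε : ℝ, 0 < ε → ∀ᶠ s in F, p (f s) < ε := by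
  rw [Metric.tendsto_nhds]
  simp only [Real.dist_eq, sub_zero, abs_of_nonneg (apply_nonneg p _), gt_iff_lt]

lemma IsCompleteFor.exists_tendstoFor (h : IsCompleteFor fun i x => S i x) [F.NeBot]
    (hf : CauchyFor S F f) : ∃ x, TendstoFor S F f x := by
  obtain ⟨x, hx⟩ := h (F.map f) inferInstance fun i ε hε => by
    obtain ⟨T, hT, h⟩ := hf i ε hε
    exact ⟨f '' T, image_mem_map hT, by rintro _ ⟨s, hs, rfl⟩ _ ⟨t, ht, rfl⟩; exact h s hs t ht⟩
  exact ⟨x, fun i => (tendsto_zero_iff_eventually_lt (S i)).2 fun ε hε => hx i ε hε⟩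

lemma isCompleteFor_of_exists_tendstoFor
    (h : ∀ F : Filter X, F.NeBot → CauchyFor S F id → ∃ x, TendstoFor S F id x) :
    IsCompleteFor fun i x => S i x := fun F hF hc => by
  obtain ⟨x, hx⟩ := h F hF hc
  exact ⟨x, fun i ε hε => (tendsto_zero_iff_eventually_lt (S i)).1 (hx i) ε hε⟩

lemma CauchyFor.map (hf : CauchyFor S F f) (L : X → Y)
    (hL : ∀ j, ∃ i, ∃ C : ℝ, ∀ x y, S' j (L x - L y) ≤ C * S i (x - y)) :
    CauchyFor S' F fun s => L (f s) := fun j ε hε => by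
  obtain ⟨i, C, hC⟩ := hL j
  obtain ⟨T, hT, h⟩ := hf i (ε / (|C| + 1)) (by positivity)
  refine ⟨T, hT, fun s hs t ht => (hC _ _).trans_lt ?_⟩
  have h1 := h s hs t ht
  rw [lt_div_iff₀ (by positivity)] at h1
  have h2 : 0 ≤ S i (f s - f t) := apply_nonneg _ _
  nlinarith [le_abs_self C]

lemma TendstoFor.map (hf : TendstoFor S F f x) (L : X → Y)
    (hL : ∀ j, ∃ i, ∃ C : ℝ, ∀ x y, S' j (L x - L y) ≤ C * S i (x - y)) :
    TendstoFor S' F (fun s => L (f s)) (L x) := fun j => by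
  obtain ⟨i, C, hC⟩ := hL j
  refine squeeze_zero (fun s => apply_nonneg _ _) (fun s => hC _ _) ?_
  simpa using (hf i).const_mul C

lemma TendstoFor.add (hf : TendstoFor S F f x) (hg : TendstoFor S F g y) :
    TendstoFor S F (fun s => f s + g s) (x + y) := fun i => by
  refine squeeze_zero (fun s => apply_nonneg _ _) (fun s => ?_)
    (by simpa using (hf i).add (hg i))
  rw [add_sub_add_comm]
  exact map_add_le_add _ _ _

lemma TendstoFor.const_smul (hf : TendstoFor S F f x) (c : ℂ) :
    TendstoFor S F (fun s => c • f s) (c • x) := fun i => by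
  simpa only [← smul_sub, map_smul_eq_mul, mul_zero] using (hf i).const_mul ‖c‖

lemma TendstoFor.unique (hS : ∀ x, (∀ i, S i x = 0) → x = 0) [F.NeBot]
    (hx : TendstoFor S F f x) (hy : TendstoFor S F f y) : x = y := by
  refine sub_eq_zero.1 (hS _ fun i => le_antisymm ?_ (apply_nonneg _ _))
  refine ge_of_tendsto (f := fun s => S i (f s - x) + S i (f s - y))
    (by simpa using (hx i).add (hy i)) (Eventually.of_forall fun s => ?_)
  rw [map_sub_rev (S i) (f s) x]
  exact (congrArg (S i) (sub_add_sub_cancel x (f s) y).symm).le.trans (map_add_le_add _ _ _)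

/-- Completeness is inherited along a surjection that pulls the seminorms back to seminorms. -/
lemma IsCompleteFor.of_surjective {N : ι → X → ℝ} {N' : ι → Y → ℝ} {L : X →+ Y}
    (hL : Function.Surjective L) (hN : ∀ i x, N' i (L x) = N i x) (h : IsCompleteFor N) :
    IsCompleteFor N' := fun F hF hc => by
  obtain ⟨x, hx⟩ := h (F.comap L) (hF.comap_of_surj hL) fun i ε hε => by
    obtain ⟨T, hT, h⟩ := hc i ε hε
    refine ⟨L ⁻¹' T, preimage_mem_comap hT, fun s hs t ht => ?_⟩
    rw [← hN, map_sub]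
    exact h _ hs _ ht
  refine ⟨L x, fun i ε hε => ?_⟩
  have := hx i ε hε
  rw [eventually_comap] at this
  filter_upwards [this] with y hy
  obtain ⟨z, rfl⟩ := hL y
  rw [← map_sub, hN]
  exact hy z rfl

lemma tendsto_seminormTopology :
    Tendsto f F (@nhds _ (seminormTopology fun i x => S i x) x) ↔ TendstoFor S F f x := by
  rw [TopologicalSpace.nhds_generateFrom]
  simp only [tendsto_iInf, tendsto_principal, TendstoFor,
    fun i => tendsto_zero_iff_eventually_lt (S i) (F := F) (f := fun s => f s - x)]
  refine ⟨fun h i ε hε => h {y | S i (y - x) < ε} ⟨by simpa using hε, i, x, ε, hε, rfl⟩, ?_⟩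
  rintro h _ ⟨hx, i, z, ε, hε, rfl⟩
  have hx' : S i (x - z) < ε := hx
  filter_upwards [h i (ε - S i (x - z)) (by linarith)] with s hs
  have := map_add_le_add (S i) (f s - x) (x - z)
  rw [sub_add_sub_cancel] at this
  change S i (f s - z) < ε
  linarith

lemma continuous_seminormTopology {L : X → Y}
    (hL : ∀ j, ∃ i, ∃ C : ℝ, ∀ x y, S' j (L x - L y) ≤ C * S i (x - y)) :
    @Continuous _ _ (seminormTopology fun i x => S i x) (seminormTopology fun i x => S' i x)
      L := by
  let _ := seminormTopology fun i x => S i x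
  let _ := seminormTopology fun i x => S' i x
  refine continuous_iff_continuousAt.2 fun x => ?_
  refine (tendsto_seminormTopology (S := S')).2 (TendstoFor.map (S := S) ?_ L hL)
  exact tendsto_seminormTopology.1 tendsto_id

/-- An isometric additive map from a complete space into a separated space is a closed
embedding. -/
lemma isClosedEmbedding_seminormTopology {S' : ι → Seminorm ℂ Y} {L : X →ₗ[ℂ] Y}
    (hL : ∀ i x, S' i (L x) = S i x) (hS : ∀ x, (∀ i, S i x = 0) → x = 0)
    (hS' : ∀ x, (∀ i, S' i x = 0) → x = 0) (hc : IsCompleteFor fun i x => S i x) :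
    @IsClosedEmbedding _ _ (seminormTopology fun i x => S i x)
      (seminormTopology fun i x => S' i x) L := by
  let _ := seminormTopology fun i x => S i x
  let _ := seminormTopology fun i x => S' i x
  have hsub : ∀ i x y, S' i (L x - L y) = S i (x - y) := fun i x y => by rw [← map_sub, hL]
  refine ⟨⟨⟨?_⟩, ?_⟩, ?_⟩
  · refine TopologicalSpace.ext_nhds fun x => ?_
    rw [nhds_induced]
    refine le_antisymm (tendsto_iff_comap.1 ?_) ?_
    · exact (continuous_seminormTopology fun j =>
        ⟨j, 1, fun x y => by rw [hsub, one_mul]⟩).continuousAt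
    · refine tendsto_id'.1 (tendsto_seminormTopology.2 fun i => ?_)
      have : Tendsto L (comap L (𝓝 (L x))) (𝓝 (L x)) := tendsto_comap
      simpa only [hsub, id] using tendsto_seminormTopology.1 this i
  · refine (injective_iff_map_eq_zero L).2 fun x hx => hS x fun i => ?_
    rw [← hL, hx, map_zero]
  · refine isClosed_of_closure_subset fun y hy => ?_
    have : (comap L (𝓝 y)).NeBot := comap_neBot_iff.2 fun t ht => by
      obtain ⟨_, ht, x, rfl⟩ := mem_closure_iff_nhds.1 hy t ht
      exact ⟨x, ht⟩
    have hy' : TendstoFor S' (comap L (𝓝 y)) L y := tendsto_seminormTopology.1 tendsto_comap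
    obtain ⟨x, hx⟩ := IsCompleteFor.exists_tendstoFor (S := S) (F := comap L (𝓝 y)) (f := id) hc
      fun i ε hε => by
        have h1 := (tendsto_zero_iff_eventually_lt (S' i)).1 (hy' i) (ε / 2) (by positivity)
        refine ⟨_, h1, fun s hs t ht => ?_⟩
        have hs' : S' i (L s - y) < ε / 2 := hs
        have ht' : S' i (L t - y) < ε / 2 := ht
        have := map_sub_le_add (S' i) (L s - y) (L t - y)
        rw [sub_sub_sub_cancel_right, hsub] at this
        change S i (s - t) < ε
        linarith
    refine ⟨x, TendstoFor.unique hS' (TendstoFor.map hx L fun j => ⟨j, 1, fun x y => ?_⟩) hy'⟩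
    rw [hsub, one_mul]

end Families

/-! ### The seminorms of a pre-Hilbert module -/

section HSemi

variable {A : Type u} [NonUnitalRing A] [StarRing A] [Module ℂ A] [IsScalarTower ℂ A A]
  [SMulCommClass ℂ A A] [StarModule ℂ A] [TopologicalSpace A]
variable {E : Type v} [AddCommGroup E] [Module ℂ E] [InnerModule A E] [PreHilbertModule A E]
variable (p : ContCStarSeminorm A)

lemma hnorm_nonneg (ξ : E) : 0 ≤ hnorm p ξ := Real.sqrt_nonneg _

lemma hnorm_sq (ξ : E) : hnorm p ξ ^ 2 = p (ip ξ ξ) := Real.sq_sqrt (apply_nonneg _ _)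

lemma ip_le (ξ η : E) : p (ip ξ η) ≤ hnorm p ξ * hnorm p η := by
  refine le_of_sq_le_sq ?_ (mul_nonneg (hnorm_nonneg _ _) (hnorm_nonneg _ _))
  rw [mul_pow, hnorm_sq, hnorm_sq]
  exact cauchy_schwarz p ξ η

variable (E) in
/-- The seminorm `p̄_E ξ = p(⟨ξ, ξ⟩)^{1/2}` as a bundled seminorm. -/
def hsemi : Seminorm ℂ E :=
  Seminorm.of (hnorm p)
    (fun ξ η => by
      refine le_of_sq_le_sq ?_ (add_nonneg (hnorm_nonneg _ _) (hnorm_nonneg _ _))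
      have h1 := ip_le p ξ η
      have h2 := ip_le p η ξ
      have h3 : p (ip (ξ + η) (ξ + η)) ≤
          p (ip ξ ξ) + p (ip ξ η) + (p (ip η ξ) + p (ip η η)) := by
        rw [ip_add_left, ip_add_right, ip_add_right]
        exact (map_add_le_add p.toSeminorm _ _).trans
          (add_le_add (map_add_le_add p.toSeminorm _ _) (map_add_le_add p.toSeminorm _ _))
      rw [hnorm_sq]
      nlinarith [hnorm_sq p ξ, hnorm_sq p η])
    (fun c ξ => by
      rw [hnorm, hnorm, ip_smul_left, ip_smul_right, map_smul_eq_mul, map_smul_eq_mul, norm_star,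
        ← mul_assoc, Real.sqrt_mul (by positivity), Real.sqrt_mul_self (norm_nonneg _)])

lemma hsemi_apply (ξ : E) : hsemi E p ξ = hnorm p ξ := rfl

lemma hnorm_act_le (ξ : E) (a : A) : hnorm p (act ξ a) ≤ hnorm p ξ * p a := by
  refine le_of_sq_le_sq ?_ (mul_nonneg (hnorm_nonneg _ _) (apply_nonneg _ _))
  rw [hnorm_sq, mul_pow, hnorm_sq, ip_act_left, ip_act_right]
  have h1 := p.mul_le (star a) (ip ξ ξ * a)
  have h2 := p.mul_le (ip ξ ξ : A) a
  rw [p.apply_star] at h1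
  nlinarith [apply_nonneg p.toSeminorm a]

lemma hnorm_self (a : A) : hnorm p a = p a := by
  rw [hnorm, ip_self, p.star_mul_self, Real.sqrt_sq (apply_nonneg _ _)]

lemma hnorm_mono {p q : ContCStarSeminorm A} (h : q ≤ p) (ξ : E) : hnorm q ξ ≤ hnorm p ξ :=
  Real.sqrt_le_sqrt (ContCStarSeminorm.apply_le h _)

lemma hsemi_separating {ι : Type*} {P : ι → ContCStarSeminorm A}
    (hP : ∀ a, (∀ i, P i a = 0) → a = 0) (ξ : E) (h : ∀ i, hsemi E (P i) ξ = 0) : ξ = 0 :=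
  PreHilbertModule.ip_self_eq_zero (A := A) ξ <| hP _ fun i => by
    rw [← hnorm_sq, ← hsemi_apply, h, zero_pow two_ne_zero]

end HSemi

/-! ### Polynomial calculus in a pre-Hilbert module -/

section Calculus

open Polynomial

variable {A : Type u} [NonUnitalRing A] [StarRing A] [Module ℂ A] [IsScalarTower ℂ A A]
  [SMulCommClass ℂ A A] [StarModule ℂ A] [TopologicalSpace A]
variable {E : Type v} [AddCommGroup E] [Module ℂ E] [InnerModule A E]

/-- Every C*-seminorm is the norm of a *-homomorphism into a unital C*-algebra. -/
lemma exists_hom_cstarAlgebra (p : ContCStarSeminorm A) :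
    ∃ (B : Type u) (_ : CStarAlgebra B) (ψ : A →⋆ₙₐ[ℂ] B), ∀ a, ‖ψ a‖ = p a := by
  obtain ⟨B, _, φ, hmul, hstar⟩ := exists_cstar_embedding (QuotAlg p)
  let φ' : QuotAlg p →⋆ₙₐ[ℂ] B :=
    { toFun := φ
      map_smul' := φ.map_smul
      map_zero' := φ.map_zero
      map_add' := φ.map_add
      map_mul' := hmul
      map_star' := hstar }
  refine ⟨Unitization ℂ B, inferInstance,
    (Unitization.inrNonUnitalStarAlgHom ℂ B).comp (φ'.comp (QuotAlg.mk p)), fun a => ?_⟩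
  exact (Unitization.norm_inr (𝕜 := ℂ) _).trans (φ.norm_map _)

variable (E) in
/-- The right multiplication `ξ ↦ ξ a`. For a polynomial `h` with constant term `c`, the operator
`h(actRight E a)` replaces the expression `ξ h(a) = c ξ + ξ (h - c)(a)`, although `A` need not have
a unit. -/
def actRight (a : A) : Module.End ℂ E where
  toFun ξ := act ξ a
  map_add' ξ η := add_act ξ η a
  map_smul' c ξ := smul_act c ξ a

lemma map_ip_aeval {B : Type*} [CStarAlgebra B] (ψ : A →⋆ₙₐ[ℂ] B) (a : A) (ξ η : E)
    (h : ℝ[X]) :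
    ψ (ip ξ (aeval (actRight E a) h η)) = ψ (ip ξ η) * aeval (ψ a) h := by
  induction h using Polynomial.induction_on with
  | C c =>
    have h1 : aeval (actRight E a) (C c) η = (c : ℂ) • η := by rw [aeval_C]; rfl
    rw [h1, ip_smul_right, map_smul, aeval_C, Algebra.algebraMap_eq_smul_one, mul_smul_comm,
      mul_one]
    rfl
  | add f g hf hg =>
    rw [map_add, map_add, LinearMap.add_apply, ip_add_right, map_add, hf, hg, mul_add]
  | monomial n c h =>
    have h1 : aeval (actRight E a) (C c * X ^ (n + 1)) η =
        act (aeval (actRight E a) (C c * X ^ n) η) a := by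
      rw [pow_succ', ← mul_assoc, mul_comm (C c), mul_assoc, map_mul, aeval_X]
      rfl
    rw [h1, ip_act_right, map_mul, h, pow_succ, ← mul_assoc, map_mul _ _ X, aeval_X, mul_assoc]

variable [PreHilbertModule A E]

/-- The norm of `ξ h(⟨ξ, ξ⟩)` is the supremum norm of `t ↦ t^{1/2} h(t)` on the spectrum of
`⟨ξ, ξ⟩`, which lies in `[0, p ⟨ξ, ξ⟩]`. -/
lemma hnorm_aeval_sq_le (p : ContCStarSeminorm A) (ξ : E) (h : ℝ[X]) {C : ℝ}
    (hC : ∀ t, 0 ≤ t → t ≤ hnorm p ξ ^ 2 → t * h.eval t ^ 2 ≤ C) :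
    hnorm p (aeval (actRight E (ip ξ ξ : A)) h ξ) ^ 2 ≤ C := by
  obtain ⟨B, _, ψ, hψ⟩ := exists_hom_cstarAlgebra p
  let _ : PartialOrder B := CStarAlgebra.spectralOrder B
  have _ : StarOrderedRing B := CStarAlgebra.spectralOrderedRing B
  set b : B := ψ (ip ξ ξ) with hb
  have hb0 : 0 ≤ b := by
    obtain ⟨d, hd⟩ := PreHilbertModule.ip_self_nonneg (A := A) ξ
    rw [hb, hd, map_mul, map_star]
    exact star_mul_self_nonneg _
  have hbsa : IsSelfAdjoint b := .of_nonneg hb0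
  have hpoly : ∀ f : ℝ[X], aeval b f = cfc (fun x => f.eval x) b := fun f =>
    (cfc_polynomial f b).symm
  have hstar : ∀ f : ℝ[X], star (aeval b f) = aeval b f := fun f => by
    rw [hpoly]
    exact (cfc_predicate (fun x : ℝ => f.eval x) b : IsSelfAdjoint _).star_eq
  have key : ψ (ip (aeval (actRight E (ip ξ ξ : A)) h ξ) (aeval (actRight E (ip ξ ξ : A)) h ξ)) =
      aeval b (h * X * h) := by
    rw [map_ip_aeval, ← star_ip, map_star, map_ip_aeval, star_mul, ← hb, hstar, hbsa.star_eq,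
      map_mul, map_mul, aeval_X]
  rw [hnorm_sq, ← hψ, key, hpoly]
  have hC0 : 0 ≤ C := by simpa using hC 0 le_rfl (sq_nonneg _)
  refine norm_cfc_le hC0 fun t ht => ?_
  have ht0 : 0 ≤ t := spectrum_nonneg_of_nonneg hb0 ht
  have ht1 : ‖t‖ ≤ ‖b‖ := by
    have := (norm_cfc_le_iff (id : ℝ → ℝ) b (norm_nonneg b)).1 (by rw [cfc_id ℝ b])
    exact this t ht
  rw [hb, hψ, ← hnorm_sq, Real.norm_of_nonneg ht0] at ht1
  have := hC t ht0 ht1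
  rw [eval_mul, eval_mul, eval_X, Real.norm_of_nonneg (by nlinarith [sq_nonneg (h.eval t)])]
  linarith

/-- Every vector can be changed within its class modulo `ker p̄_E` so that all its seminorms are
bounded by `p̄_E`. The new vector is `ξ f(⟨ξ, ξ⟩)` with `f(t) = (s / max(s, t))^{1/2}` and
`s = p ⟨ξ, ξ⟩`: the function `t f(t)²` is bounded by `s`, and `f = 1` on `[0, s]`. -/
lemma exists_bounded_representative (hE : IsCompleteFor fun q : ContCStarSeminorm A => hsemi E q)
    (p : ContCStarSeminorm A) (ξ : E) :
    ∃ η : E, hnorm p (ξ - η) = 0 ∧ ∀ q : ContCStarSeminorm A, hnorm q η ≤ hnorm p ξ := by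
  rcases (hnorm_nonneg p ξ).eq_or_lt with h0 | h0
  · refine ⟨0, by rw [sub_zero, ← h0], fun q => ?_⟩
    rw [← hsemi_apply, map_zero]
    exact hnorm_nonneg p ξ
  set s := hnorm p ξ ^ 2 with hs
  have hs0 : 0 < s := by positivity
  set f : ℝ → ℝ := fun t => √(s / max s t) with hf
  have hmax : ∀ t, 0 < max s t := fun t => lt_max_of_lt_left hs0
  have hfc : Continuous f :=
    (continuous_const.div (continuous_const.max continuous_id) fun t => (hmax t).ne').sqrt
  have hf0 : ∀ t, 0 ≤ f t := fun t => Real.sqrt_nonneg _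
  have hf1 : ∀ t, f t ≤ 1 := fun t => by
    exact Real.sqrt_le_one.2 ((div_le_one (hmax t)).2 (le_max_left _ _))
  have hfs : ∀ t, t ≤ s → f t = 1 := fun t ht => by
    simp only [hf, max_eq_left ht, div_self hs0.ne', Real.sqrt_one]
  have htf : ∀ t, 0 ≤ t → t * f t ^ 2 ≤ s := fun t ht => by
    rw [Real.sq_sqrt (div_nonneg hs0.le (hmax t).le), mul_div_assoc', div_le_iff₀ (hmax t)]
    nlinarith [le_max_right s t]
  have happrox : ∀ n : ℕ, ∃ h : ℝ[X], ∀ t ∈ Set.Icc (0 : ℝ) n,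
      |h.eval t - f t| < 1 / ((n : ℝ) + 1) := fun n =>
    exists_polynomial_near_of_continuousOn 0 n f hfc.continuousOn _ (by positivity)
  choose h hh using happrox
  have hδ : Tendsto (fun n : ℕ => 1 / ((n : ℝ) + 1)) atTop (𝓝 0) :=
    tendsto_one_div_add_atTop_nhds_zero_nat
  set z : ℕ → E := fun n => aeval (actRight E (ip ξ ξ : A)) (h n) ξ with hz
  -- only the interval `[0, q ⟨ξ, ξ⟩]` matters for the seminorm `q`, and it lies in `[0, n]` for
  -- large `n`
  have hcauchy : CauchyFor (fun q : ContCStarSeminorm A => hsemi E q) atTop z := by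
    intro q ε hε
    set M := hnorm q ξ ^ 2 with hM
    have hM0 : 0 ≤ M := sq_nonneg _
    have hlim : Tendsto (fun n : ℕ => M * (2 * (1 / ((n : ℝ) + 1))) ^ 2) atTop (𝓝 0) := by
      simpa using ((hδ.const_mul 2).pow 2).const_mul M
    obtain ⟨K, hK⟩ := ((hlim.eventually_lt_const (by positivity : (0 : ℝ) < ε ^ 2)).and
      (tendsto_natCast_atTop_atTop.eventually_ge_atTop M)).exists
    have hle : ∀ n, K ≤ n → ∀ t, 0 ≤ t → t ≤ M → |(h n).eval t - f t| ≤ 1 / ((K : ℝ) + 1) := by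
      intro n hn t ht htM
      have hKn : (K : ℝ) ≤ n := by exact_mod_cast hn
      exact (hh n t ⟨ht, htM.trans (hK.2.trans hKn)⟩).le.trans
        (one_div_le_one_div_of_le (by positivity) (by linarith))
    refine ⟨Set.Ici K, Ici_mem_atTop K, fun m hm n hn => ?_⟩
    have hsub : z m - z n = aeval (actRight E (ip ξ ξ : A)) (h m - h n) ξ := by
      rw [hz, map_sub, LinearMap.sub_apply]
    refine lt_of_pow_lt_pow_left₀ 2 hε.le (lt_of_le_of_lt ?_ hK.1)
    rw [hsub]
    refine hnorm_aeval_sq_le q ξ _ fun t ht htM => ?_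
    have h1 := abs_le.1 (hle m hm t ht htM)
    have h2 := abs_le.1 (hle n hn t ht htM)
    refine mul_le_mul htM (sq_le_sq' ?_ ?_) (sq_nonneg _) hM0 <;> rw [eval_sub] <;> linarith
  obtain ⟨η, hη⟩ := hE.exists_tendstoFor hcauchy
  refine ⟨η, le_antisymm ?_ (hnorm_nonneg _ _), fun q => ?_⟩
  · -- `f = 1` on `[0, s]`, so that `ξ - z n` is small for `p̄_E`
    have h1 : ∀ᶠ n : ℕ in atTop, hnorm p (ξ - z n) ≤ hnorm p ξ * (1 / ((n : ℝ) + 1)) := by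
      filter_upwards [tendsto_natCast_atTop_atTop.eventually_ge_atTop s] with n hn
      refine le_of_sq_le_sq ?_ (mul_nonneg (hnorm_nonneg _ _) (by positivity))
      have hsub : ξ - z n = aeval (actRight E (ip ξ ξ : A)) (1 - h n) ξ := by
        rw [hz, map_sub, map_one, LinearMap.sub_apply]
        rfl
      rw [hsub, mul_pow, ← hs]
      refine hnorm_aeval_sq_le p ξ _ fun t ht hts => ?_
      have h2 := abs_le.1 (hh n t ⟨ht, hts.trans hn⟩).le
      rw [hfs t hts] at h2
      refine mul_le_mul hts (sq_le_sq' ?_ ?_) (sq_nonneg _) hs0.le <;>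
        rw [eval_sub, eval_one] <;> linarith
    refine ge_of_tendsto (f := fun n : ℕ => hnorm p ξ * (1 / ((n : ℝ) + 1)) + hsemi E p (z n - η))
      (by simpa using (hδ.const_mul (hnorm p ξ)).add (hη p)) (h1.mono fun n hn => ?_)
    have h2 := map_add_le_add (hsemi E p) (ξ - z n) (z n - η)
    rw [sub_add_sub_cancel] at h2
    simp only [hsemi_apply] at h2 ⊢
    linarith
  · set M := hnorm q ξ ^ 2 with hM
    have hM0 : 0 ≤ M := sq_nonneg _
    -- `t h² ≤ t f² + 3 t δ ≤ s + 3 M δ` for a polynomial `h` at distance `δ ≤ 1` from `f ≤ 1`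
    have h1 : ∀ᶠ n : ℕ in atTop, hnorm q (z n) ≤ √(s + M * (3 * (1 / ((n : ℝ) + 1)))) := by
      filter_upwards [tendsto_natCast_atTop_atTop.eventually_ge_atTop M] with n hn
      refine Real.le_sqrt_of_sq_le (hnorm_aeval_sq_le q ξ _ fun t ht htM => ?_)
      set δ := 1 / ((n : ℝ) + 1) with hδn
      have hδ0 : 0 ≤ δ := by positivity
      have hδ1 : δ ≤ 1 := by
        rw [hδn, div_le_one (by positivity)]
        linarith [Nat.cast_nonneg (α := ℝ) n]
      have h2 := abs_le.1 (hh n t ⟨ht, htM.trans hn⟩).le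
      have h3 : (h n).eval t ^ 2 ≤ f t ^ 2 + 3 * δ := by
        have h4 : (h n).eval t ^ 2 ≤ (f t + δ) ^ 2 :=
          sq_le_sq' (by linarith [hf0 t]) (by linarith)
        nlinarith [hf0 t, hf1 t]
      calc t * (h n).eval t ^ 2 ≤ t * (f t ^ 2 + 3 * δ) := mul_le_mul_of_nonneg_left h3 ht
        _ = t * f t ^ 2 + t * (3 * δ) := mul_add _ _ _
        _ ≤ s + M * (3 * δ) := add_le_add (htf t ht) (by gcongr)
    have h2 : Tendsto (fun n : ℕ => √(s + M * (3 * (1 / ((n : ℝ) + 1))))) atTop (𝓝 √s) := by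
      have := (((hδ.const_mul 3).const_mul M).const_add s)
      rw [mul_zero, mul_zero, add_zero] at this
      exact this.sqrt
    have h3 : √s = hnorm p ξ := Real.sqrt_sq (hnorm_nonneg _ _)
    rw [← h3]
    refine ge_of_tendsto (f := fun n : ℕ => √(s + M * (3 * (1 / ((n : ℝ) + 1)))) +
      hsemi E q (z n - η)) (by simpa using h2.add (hη q)) (h1.mono fun n hn => ?_)
    have h2 := map_sub_le_add (hsemi E q) (z n) (z n - η)
    rw [sub_sub_cancel] at h2
    simp only [hsemi_apply] at h2 ⊢
    linarith

/-- A Hilbert module is complete for each of its seminorms `p̄_E` alone. Hence its quotient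
`E / ker p̄_E` needs no further completion. -/
lemma isCompleteFor_single (hE : IsCompleteFor fun q : ContCStarSeminorm A => hsemi E q)
    (p : ContCStarSeminorm A) : IsCompleteFor fun (_ : Unit) (ξ : E) => hnorm p ξ := by
  refine isCompleteFor_of_exists_tendstoFor (S := fun _ : Unit => hsemi E p) fun F _ hc => ?_
  have hpos : ∀ n : ℕ, (0 : ℝ) < (1 / 2) ^ n := fun n => by positivity
  choose T hT hTd using fun n : ℕ => hc () _ (hpos n)
  have hT' : ∀ n : ℕ, (⋂ k ∈ Finset.range (n + 1), T k) ∈ F := fun n =>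
    (biInter_finset_mem _).2 fun k _ => hT k
  choose x hx using fun n => nonempty_of_mem (hT' n)
  have hxT : ∀ {k n : ℕ}, k ≤ n → x n ∈ T k := fun {k n} hkn =>
    Set.mem_iInter₂.1 (hx n) k (Finset.mem_range.2 (by omega))
  -- the increments of the Cauchy sequence `x` are replaced by representatives that are small for
  -- all seminorms, so that their sum converges in `E`
  choose y hy0 hy using fun n => exists_bounded_representative hE p (x (n + 1) - x n)
  have hy' : ∀ (q : ContCStarSeminorm A) n, hnorm q (y n) ≤ (1 / 2) ^ n := fun q n =>
    (hy n q).trans (hTd n _ (hxT n.le_succ) _ (hxT le_rfl)).le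
  set z : ℕ → E := fun n => x 0 + ∑ k ∈ Finset.range n, y k with hz
  have hzs : ∀ n, z (n + 1) = z n + y n := fun n => by
    simp only [hz, Finset.sum_range_succ, add_assoc]
  have hz0 : ∀ n, hsemi E p (x n - z n) = 0 := fun n => by
    induction n with
    | zero => simp [hz]
    | succ n ih =>
      refine le_antisymm ?_ (apply_nonneg _ _)
      have : x (n + 1) - z (n + 1) = (x n - z n) + (x (n + 1) - x n - y n) := by
        rw [hzs]; abel
      rw [this]
      refine (map_add_le_add _ _ _).trans ?_
      rw [ih, hsemi_apply, hy0, add_zero]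
  have hzc : ∀ q : ContCStarSeminorm A, ∀ m n, m ≤ n →
      hsemi E q (z n - z m) ≤ 2 * (1 / 2) ^ m - 2 * (1 / 2) ^ n := by
    intro q m n hmn
    induction n, hmn using Nat.le_induction with
    | base => simp
    | succ n hmn ih =>
      have : z (n + 1) - z m = (z n - z m) + y n := by
        rw [hzs]; abel
      rw [this]
      refine (map_add_le_add _ _ _).trans ?_
      have := hy' q n
      rw [hsemi_apply _ (y n), pow_succ]
      linarith
  have hlim : Tendsto (fun n : ℕ => 2 * (1 / 2 : ℝ) ^ n) atTop (𝓝 0) := by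
    simpa using (tendsto_pow_atTop_nhds_zero_of_lt_one (r := (1 / 2 : ℝ)) (by norm_num)
      (by norm_num)).const_mul 2
  have hzcauchy : CauchyFor (fun q : ContCStarSeminorm A => hsemi E q) atTop z := by
    intro q ε hε
    obtain ⟨K, hK⟩ := (hlim.eventually_lt_const (by positivity : 0 < ε / 2)).exists
    have hKn : ∀ n, K ≤ n → hsemi E q (z n - z K) < ε / 2 := fun n hn => by
      have := hzc q K n hn
      have := hpos n
      linarith
    refine ⟨Set.Ici K, Ici_mem_atTop K, fun m hm n hn => ?_⟩
    have := map_sub_le_add (hsemi E q) (z m - z K) (z n - z K)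
    rw [sub_sub_sub_cancel_right] at this
    linarith [hKn m hm, hKn n hn]
  obtain ⟨η, hη⟩ := hE.exists_tendstoFor hzcauchy
  refine ⟨η, fun _ => (tendsto_zero_iff_eventually_lt _).2 fun ε hε => ?_⟩
  have h1 : Tendsto (fun n : ℕ => (1 / 2 : ℝ) ^ n + hsemi E p (z n - η)) atTop (𝓝 0) := by
    simpa using (tendsto_pow_atTop_nhds_zero_of_lt_one (r := (1 / 2 : ℝ)) (by norm_num)
      (by norm_num)).add (hη p)
  obtain ⟨n, hn⟩ := (h1.eventually_lt_const hε).exists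
  filter_upwards [hT n] with ξ hξ
  have h2 := hTd n ξ hξ (x n) (hxT le_rfl)
  have h3 := map_add_le_add (hsemi E p) (ξ - x n) (x n - η)
  have h4 := map_add_le_add (hsemi E p) (x n - z n) (z n - η)
  rw [sub_add_sub_cancel] at h3 h4
  rw [hz0] at h4
  change hsemi E p (ξ - η) < ε
  change hsemi E p (ξ - x n) < _ at h2
  linarith

end Calculus

/-! ### The multiplier algebra of a C*-algebra -/

section MultiplierCStar

open scoped MultiplierAlgebra

variable {R : Type u} [NonUnitalCStarAlgebra R]

namespace Multiplier

lemma continuous_l (m : Multiplier R) : Continuous m.l := by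
  refine m.l.continuous_of_seq_closed_graph fun x a b hx hb => ?_
  have h : ∀ c : R, c * b = c * m.l a := fun c => by
    refine tendsto_nhds_unique (hb.const_mul c) ?_
    simp only [Function.comp_apply, m.central]
    exact hx.const_mul _
  rw [← sub_eq_zero, ← CStarRing.star_mul_self_eq_zero_iff, mul_sub, h, sub_self]

lemma r_eq_star (m : Multiplier R) (a : R) : m.r a = star ((star m).l (star a)) := by
  rw [star_l, star_star, star_star]

lemma continuous_r (m : Multiplier R) : Continuous m.r := by
  have h : ⇑m.r = fun a => star ((star m).l (star a)) := funext m.r_eq_star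
  rw [h]
  exact ((continuous_l (star m)).comp continuous_star).star

/-- A multiplier of a C*-algebra, whose components are bounded by the closed graph theorem, as a
double centralizer. -/
def toCentralizer (m : Multiplier R) : 𝓜(ℂ, R) where
  fst := ⟨m.l, m.continuous_l⟩
  snd := ⟨m.r, m.continuous_r⟩
  central a b := (m.central a b).symm

lemma centralizer_fst_mul (x : 𝓜(ℂ, R)) (a b : R) : x.fst (a * b) = x.fst a * b := by
  have h : ∀ c, c * x.fst (a * b) = c * (x.fst a * b) := fun c => by
    rw [← x.central, ← mul_assoc, ← mul_assoc, ← x.central]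
  rw [← sub_eq_zero, ← CStarRing.star_mul_self_eq_zero_iff, mul_sub, h, sub_self]

lemma centralizer_snd_mul (x : 𝓜(ℂ, R)) (a b : R) : x.snd (a * b) = a * x.snd b := by
  have h : ∀ c, x.snd (a * b) * c = a * x.snd b * c := fun c => by
    rw [x.central, mul_assoc, mul_assoc, x.central]
  rw [← sub_eq_zero, ← CStarRing.mul_star_self_eq_zero_iff, sub_mul, h, sub_self]

variable (R) in
/-- The *-isomorphism of the algebra of multipliers of a C*-algebra with Mathlib's algebra of
double centralizers. -/
def centralizerEquiv : Multiplier R ≃⋆ₐ[ℂ] 𝓜(ℂ, R) where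
  toFun := toCentralizer
  invFun x :=
    { l := x.fst
      r := x.snd
      l_mul := centralizer_fst_mul x
      r_mul := centralizer_snd_mul x
      central := fun a b => (x.central a b).symm }
  left_inv _ := rfl
  right_inv _ := rfl
  map_mul' _ _ := rfl
  map_add' _ _ := rfl
  map_star' _ := rfl
  map_smul' _ _ := rfl

lemma centralizerEquiv_fst (m : Multiplier R) (a : R) :
    (centralizerEquiv R m).fst a = m.l a := rfl

lemma ballValues_norm_eq (m : Multiplier R) :
    m.ballValues (fun a => ‖a‖) =
      (fun a => ‖(centralizerEquiv R m).fst a‖) '' Metric.closedBall 0 1 := by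
  ext x
  simp only [ballValues, Set.mem_ofPred_eq, Set.mem_image, mem_closedBall_zero_iff]
  exact exists_congr fun a => and_congr_right fun _ => eq_comm

lemma mnorm_norm_eq (m : Multiplier R) :
    mnorm (fun a => ‖a‖) m = ‖centralizerEquiv R m‖ := by
  rw [← DoubleCentralizer.norm_fst, mnorm, ballValues_norm_eq,
    ContinuousLinearMap.sSup_unitClosedBall_eq_norm]

lemma bddAbove_ballValues_norm (m : Multiplier R) : BddAbove (m.ballValues fun a => ‖a‖) := by
  refine ⟨‖(centralizerEquiv R m).fst‖, ?_⟩
  rintro _ ⟨a, ha, rfl⟩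
  exact (centralizerEquiv R m).fst.unit_le_opNorm a ha

lemma norm_l_le (m : Multiplier R) (a : R) : ‖m.l a‖ ≤ mnorm (fun a => ‖a‖) m * ‖a‖ := by
  rw [mnorm_norm_eq, ← DoubleCentralizer.norm_fst]
  exact (centralizerEquiv R m).fst.le_opNorm a

lemma mnorm_norm_le (m : Multiplier R) {C : ℝ} (hC : 0 ≤ C) (h : ∀ a, ‖m.l a‖ ≤ C * ‖a‖) :
    mnorm (fun a => ‖a‖) m ≤ C := by
  rw [mnorm_norm_eq, ← DoubleCentralizer.norm_fst]
  exact ContinuousLinearMap.opNorm_le_bound _ hC h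

variable (R) in
/-- The norm of `M(R)` as a C*-seminorm. -/
def normSeminorm : CStarSeminorm (Multiplier R) where
  toSeminorm := Seminorm.of (mnorm fun a => ‖a‖)
    (fun m n => by
      simp only [mnorm_norm_eq, map_add]
      exact norm_add_le _ _)
    (fun c m => by
      simp only [mnorm_norm_eq, map_smul]
      exact norm_smul _ _)
  mul_le' m n := by
    change mnorm _ _ ≤ mnorm _ _ * mnorm _ _
    simp only [mnorm_norm_eq, map_mul]
    exact norm_mul_le _ _
  star_mul_self' m := by
    change mnorm _ _ = mnorm _ _ ^ 2
    simp only [mnorm_norm_eq, map_mul, map_star]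
    rw [CStarRing.norm_star_mul_self, pow_two]

variable (R) in
lemma isCStarFor_norm : IsCStarFor (Multiplier R) (mnorm fun a => ‖a‖) where
  cstar _ := ⟨normSeminorm R, fun _ => rfl⟩
  separating m h := by
    have h := h ()
    rw [mnorm_norm_eq, norm_eq_zero] at h
    exact (centralizerEquiv R).injective (h.trans (map_zero _).symm)
  complete := by
    refine IsCompleteFor.of_surjective (N := fun (_ : Unit) (x : 𝓜(ℂ, R)) => ‖x‖)
      (L := ((centralizerEquiv R).symm : 𝓜(ℂ, R) ≃⋆ₐ[ℂ] Multiplier R).toRingEquiv.toAddEquiv.toAddMonoidHom)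
      (centralizerEquiv R).symm.surjective
      (fun _ x => (mnorm_norm_eq _).trans (congrArg _ ((centralizerEquiv R).apply_symm_apply x)))
      fun F hF hc => ?_
    have hF : Cauchy F := Metric.cauchy_iff.2 ⟨hF, fun ε hε => by
      simpa only [dist_eq_norm] using hc () ε hε⟩
    obtain ⟨x, hx⟩ := CompleteSpace.complete hF
    refine ⟨x, fun _ ε hε => ?_⟩
    simpa only [dist_eq_norm, id] using Metric.tendsto_nhds.1 (tendsto_id'.2 hx) ε hε

/-- A selfadjoint double centralizer `x` is positive as soon as all the elements `a* x(a)` are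
positive: for its negative part `y`, the element `y(a)* x(y(a)) = -a* y³(a)` is both positive and
negative, so that `y³ = 0`. -/
lemma centralizer_nonneg [PartialOrder R] [StarOrderedRing R] [PartialOrder 𝓜(ℂ, R)]
    [StarOrderedRing 𝓜(ℂ, R)] {x : 𝓜(ℂ, R)} (hx : IsSelfAdjoint x)
    (h : ∀ a : R, 0 ≤ star a * x.fst a) : 0 ≤ x := by
  rw [← CFC.negPart_eq_zero_iff x hx]
  set y := x⁻ with hy
  have hy0 : 0 ≤ y := CFC.negPart_nonneg x
  have hysa : star y = y := (IsSelfAdjoint.of_nonneg hy0).star_eq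
  have hyx : y * x * y = -(y * y * y) := by
    have h1 : x⁺ - y = x := CFC.posPart_sub_negPart x
    have h2 : y * x⁺ = 0 := CFC.negPart_mul_posPart x
    rw [← h1, mul_sub, h2, zero_sub, neg_mul]
  have hmove : ∀ (z : 𝓜(ℂ, R)) (a b : R), star (z.fst a) * b = star a * (star z).fst b := by
    intro z a b
    rw [DoubleCentralizer.star_fst]
    apply star_injective
    rw [star_mul, star_mul, star_star, star_star, star_star, z.central]
  have h3 : 0 ≤ star y * y * y := by
    rw [mul_assoc, hysa, ← mul_assoc]
    nth_rewrite 1 [← hysa]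
    exact star_left_conjugate_nonneg hy0 y
  obtain ⟨c, hc⟩ := CStarAlgebra.nonneg_iff_eq_star_mul_self.1 h3
  rw [hysa] at hc
  have hc0 : c = 0 := by
    have : ∀ a, c.fst a = 0 := fun a => by
      have h4 := h (y.fst a)
      have h5 : star (y.fst a) * x.fst (y.fst a) = -(star (c.fst a) * c.fst a) := by
        rw [hmove, hmove, hysa]
        change star a * (y * (x * y)).fst a = -(star a * (star c * c).fst a)
        rw [← hc, ← mul_assoc, hyx]
        exact mul_neg _ _
      rw [h5] at h4
      exact (CStarRing.star_mul_self_eq_zero_iff _).1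
        (le_antisymm (neg_nonneg.1 h4) (star_mul_self_nonneg _))
    rw [← norm_eq_zero, ← DoubleCentralizer.norm_fst, norm_eq_zero]
    exact ContinuousLinearMap.ext this
  rw [hc0, mul_zero] at hc
  have h6 : star (y * y) * (y * y) = 0 := by
    rw [star_mul, hysa, ← mul_assoc, hc, zero_mul]
  have h7 := (CStarRing.star_mul_self_eq_zero_iff _).1 h6
  refine (CStarRing.star_mul_self_eq_zero_iff y).1 ?_
  rwa [hysa]

lemma exists_sqrt {m : Multiplier R} (hm : star m = m)
    (h : ∀ a : R, IsPositiveElt (star a * m.l a)) :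
    ∃ n : Multiplier R, IsPositiveElt n ∧ n * n = m := by
  let _ : PartialOrder R := CStarAlgebra.spectralOrder R
  have _ : StarOrderedRing R := CStarAlgebra.spectralOrderedRing R
  let _ : PartialOrder 𝓜(ℂ, R) := CStarAlgebra.spectralOrder 𝓜(ℂ, R)
  have _ : StarOrderedRing 𝓜(ℂ, R) := CStarAlgebra.spectralOrderedRing 𝓜(ℂ, R)
  have hm0 : 0 ≤ centralizerEquiv R m := by
    refine centralizer_nonneg ?_ fun a => ?_
    · rw [IsSelfAdjoint, ← map_star, hm]
    · rw [centralizerEquiv_fst]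
      obtain ⟨b, hb⟩ := h a
      rw [hb]
      exact star_mul_self_nonneg b
  obtain ⟨b, hb⟩ := CStarAlgebra.nonneg_iff_eq_star_mul_self.1
    (CFC.sqrt_nonneg (centralizerEquiv R m))
  refine ⟨(centralizerEquiv R).symm (CFC.sqrt (centralizerEquiv R m)),
    ⟨(centralizerEquiv R).symm b, by rw [hb, map_mul, map_star]⟩, ?_⟩
  rw [← map_mul, CFC.sqrt_mul_sqrt_self _ hm0]
  exact (centralizerEquiv R).symm_apply_apply m

lemma sqrt_unique {m n : Multiplier R} (hm : IsPositiveElt m) (hn : IsPositiveElt n)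
    (h : m * m = n * n) : m = n := by
  let _ : PartialOrder 𝓜(ℂ, R) := CStarAlgebra.spectralOrder 𝓜(ℂ, R)
  have _ : StarOrderedRing 𝓜(ℂ, R) := CStarAlgebra.spectralOrderedRing 𝓜(ℂ, R)
  have hpos : ∀ k : Multiplier R, IsPositiveElt k → 0 ≤ centralizerEquiv R k := by
    rintro _ ⟨b, rfl⟩
    rw [map_mul, map_star]
    exact star_mul_self_nonneg _
  refine (centralizerEquiv R).injective (?_ : centralizerEquiv R m = centralizerEquiv R n)
  rw [← CFC.sqrt_unique (map_mul (centralizerEquiv R) m m).symm (hpos m hm),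
    ← CFC.sqrt_unique (map_mul (centralizerEquiv R) n n).symm (hpos n hn), h]

end Multiplier

/-- A selfadjoint contraction that is almost a left unit for finitely many given elements. -/
lemma exists_approximate_unit (I : Finset R) {ε : ℝ} (hε : 0 < ε) :
    ∃ e : R, star e = e ∧ ‖e‖ ≤ 1 ∧ ∀ a ∈ I, ‖e * a - a‖ < ε := by
  let _ : PartialOrder R := CStarAlgebra.spectralOrder R
  have _ : StarOrderedRing R := CStarAlgebra.spectralOrderedRing R
  have hu := CStarAlgebra.increasingApproximateUnit R
  have := hu.neBot
  refine (hu.eventually_star_eq.and (hu.eventually_norm.and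
    ((eventually_all_finset I).2 fun a _ => ?_))).exists
  simpa only [dist_eq_norm] using Metric.tendsto_nhds.1 (hu.tendsto_mul_right a) ε hε

end MultiplierCStar

/-! ### Strict completeness -/

section Strict

variable {A : Type u} [NonUnitalRing A] [StarRing A] [Module ℂ A]

namespace AdjointableMap

variable {X : Type v} [AddCommGroup X] [Module ℂ X] [InnerModule A X]
variable {Y : Type w} [AddCommGroup Y] [Module ℂ Y] [InnerModule A Y]

lemma sub_apply (S T : AdjointableMap A X Y) (x : X) : (S - T) x = S x - T x := by
  rw [sub_eq_add_neg, sub_eq_add_neg]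
  rfl

lemma sub_adj_apply (S T : AdjointableMap A X Y) (y : Y) :
    (S - T).adj y = S.adj y - T.adj y := by
  rw [sub_eq_add_neg, sub_eq_add_neg]
  rfl

end AdjointableMap

variable [IsScalarTower ℂ A A] [SMulCommClass ℂ A A] [StarModule ℂ A] [TopologicalSpace A]
variable {E : Type v} [AddCommGroup E] [Module ℂ E] [InnerModule A E] [PreHilbertModule A E]
variable {ι : Type*}

variable (E) in
/-- The seminorms of the strict topology on `M(E)` as bundled seminorms. -/
def strictSemi (P : ι → ContCStarSeminorm A) (i : ι × A × E) :
    Seminorm ℂ (MultiplierModule A E) :=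
  Seminorm.of (MultiplierModule.strictSeminorm (fun i => P i) i)
    (fun s t => by
      have h1 := map_add_le_add (hsemi E (P i.1)) (s i.2.1) (t i.2.1)
      have h2 := map_add_le_add (P i.1).toSeminorm (s.adj i.2.2) (t.adj i.2.2)
      exact (add_le_add h1 h2).trans (add_add_add_comm _ _ _ _).le)
    (fun c t => by
      have h1 := map_smul_eq_mul (hsemi E (P i.1)) c (t i.2.1)
      have h2 := map_smul_eq_mul (P i.1).toSeminorm (star c) (t.adj i.2.2)
      rw [norm_star] at h2
      exact (congrArg₂ (· + ·) h1 h2).trans (mul_add _ _ _).symm)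

lemma strictSemi_sub (P : ι → ContCStarSeminorm A) (i : ι) (a : A) (ξ : E)
    (s t : MultiplierModule A E) :
    strictSemi E P (i, a, ξ) (s - t) =
      hsemi E (P i) (s a - t a) + P i (s.adj ξ - t.adj ξ) := by
  rw [← AdjointableMap.sub_apply, ← AdjointableMap.sub_adj_apply]
  rfl

/-- A strictly Cauchy filter of adjointable maps converges pointwise, together with the adjoints,
and the pointwise limits form an adjointable map. -/
lemma isCompleteFor_strictSemi {P : ι → ContCStarSeminorm A}
    (hP : ∀ a, (∀ i, P i a = 0) → a = 0) (hA : IsCompleteFor fun i (a : A) => P i a)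
    (hE : IsCompleteFor fun i (ξ : E) => hsemi E (P i) ξ) :
    IsCompleteFor fun i (t : MultiplierModule A E) => strictSemi E P i t := by
  refine isCompleteFor_of_exists_tendstoFor fun F _ hc => ?_
  have hPE := hsemi_separating (E := E) hP
  have h1 : ∀ a : A, ∃ ξ, TendstoFor (fun i => hsemi E (P i)) F (fun t => t a) ξ := fun a =>
    hE.exists_tendstoFor (hc.map (fun t : MultiplierModule A E => t a) fun i =>
      ⟨(i, a, 0), 1, fun s t => by
        rw [strictSemi_sub, one_mul]
        exact le_add_of_nonneg_right (apply_nonneg _ _)⟩)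
  have h2 : ∀ ξ : E, ∃ a, TendstoFor (fun i => (P i).toSeminorm) F (fun t => t.adj ξ) a :=
    fun ξ => IsCompleteFor.exists_tendstoFor hA
      (hc.map (fun t : MultiplierModule A E => t.adj ξ) fun i =>
      ⟨(i, 0, ξ), 1, fun s t => by
        rw [strictSemi_sub, one_mul]
        exact le_add_of_nonneg_left (apply_nonneg _ _)⟩)
  choose f hf using h1
  choose g hg using h2
  let t : MultiplierModule A E :=
    { toFun :=
        { toFun := f
          map_add' := fun a b => (hf (a + b)).unique hPE (by
            simpa only [map_add] using (hf a).add (hf b))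
          map_smul' := fun c a => (hf (c • a)).unique hPE (by
            simpa only [map_smul, RingHom.id_apply] using (hf a).const_smul c) }
      adj :=
        { toFun := g
          map_add' := fun a b => (hg (a + b)).unique hP (by
            simpa only [map_add] using (hg a).add (hg b))
          map_smul' := fun c a => (hg (c • a)).unique hP (by
            simpa only [map_smul, RingHom.id_apply] using (hg a).const_smul c) }
      map_act := fun a b => (hf (act a b)).unique hPE (by
        simp only [AdjointableMap.map_act]
        refine (hf a).map (fun y => act y b) fun i => ⟨i, P i b, fun x y => ?_⟩
        rw [← sub_act, mul_comm]
        exact hnorm_act_le _ _ _)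
      adj_act := fun ξ b => (hg (act ξ b)).unique hP (by
        simp only [AdjointableMap.adj_act]
        refine (hg ξ).map (fun y => act y b) fun i => ⟨i, P i b, fun x y => ?_⟩
        rw [← sub_act, mul_comm]
        exact (P i).mul_le _ _)
      ip_adj := fun a ξ => by
        refine TendstoFor.unique hP (F := F) (f := fun t => (ip (t a) ξ : A)) ?_ ?_
        · refine (hf a).map (fun y => (ip y ξ : A)) fun i => ⟨i, hnorm (P i) ξ, fun x y => ?_⟩
          rw [← ip_sub_left, mul_comm]
          exact ip_le _ _ _
        · simp only [AdjointableMap.ip_adj]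
          refine (hg ξ).map (fun y => (ip a y : A)) fun i => ⟨i, P i (star a), fun x y => ?_⟩
          rw [← ip_sub_right]
          exact (P i).mul_le _ _ }
  refine ⟨t, fun ⟨i, a, ξ⟩ => ?_⟩
  simp only [strictSemi_sub]
  exact (add_zero (0 : ℝ)) ▸ (hf a i).add (hg ξ i)

end Strict

/-! ### The quotients of a locally C*-algebra and of its Hilbert modules -/

section LocallyCStar

section Seminorms

variable {A : Type u} [NonUnitalRing A] [StarRing A] [Module ℂ A] [TopologicalSpace A]

/-- The pointwise maximum of two continuous C*-seminorms. -/
def ContCStarSeminorm.max (p q : ContCStarSeminorm A) : ContCStarSeminorm A where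
  toSeminorm := p.toSeminorm ⊔ q.toSeminorm
  mul_le' a b := by
    simp only [Seminorm.sup_apply]
    refine max_le ((p.mul_le a b).trans ?_) ((q.mul_le a b).trans ?_)
    · exact mul_le_mul (le_max_left _ _) (le_max_left _ _) (apply_nonneg _ _)
        (le_max_of_le_left (apply_nonneg _ _))
    · exact mul_le_mul (le_max_right _ _) (le_max_right _ _) (apply_nonneg _ _)
        (le_max_of_le_left (apply_nonneg _ _))
  star_mul_self' a := by
    simp only [Seminorm.sup_apply, p.star_mul_self, q.star_mul_self]
    exact ((pow_left_monotoneOn (n := 2)).map_max (apply_nonneg p.toSeminorm a)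
      (apply_nonneg q.toSeminorm a)).symm
  continuous' := p.continuous'.max q.continuous'

instance : IsDirectedOrder (ContCStarSeminorm A) where
  directed p q := ⟨p.max q, (le_sup_left : p.toSeminorm ≤ p.toSeminorm ⊔ q.toSeminorm),
    (le_sup_right : q.toSeminorm ≤ p.toSeminorm ⊔ q.toSeminorm)⟩

instance : Nonempty (ContCStarSeminorm A) :=
  ⟨{ toSeminorm := 0
     mul_le' := fun _ _ => by simp
     star_mul_self' := fun _ => by simp
     continuous' := continuous_const }⟩

/-- The norm of `A_p` as a continuous C*-seminorm. -/
def QuotAlg.normSeminorm (p : ContCStarSeminorm A) : ContCStarSeminorm (QuotAlg p) where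
  toSeminorm := _root_.normSeminorm ℂ (QuotAlg p)
  mul_le' := norm_mul_le
  star_mul_self' a := by
    rw [pow_two]
    exact CStarRing.norm_star_mul_self (x := a)
  continuous' := continuous_norm

lemma QuotAlg.normSeminorm_apply (p : ContCStarSeminorm A) (x : QuotAlg p) :
    QuotAlg.normSeminorm p x = ‖x‖ := rfl

lemma QuotAlg.norm_mk (p : ContCStarSeminorm A) (a : A) : ‖QuotAlg.mk p a‖ = p a := rfl

end Seminorms

variable {A : Type u} [NonUnitalRing A] [StarRing A] [Module ℂ A] [IsScalarTower ℂ A A]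
  [SMulCommClass ℂ A A] [StarModule ℂ A]

section

variable [TopologicalSpace A]
variable {E : Type v} [AddCommGroup E] [Module ℂ E] [InnerModule A E] [PreHilbertModule A E]

lemma QuotMod.hnorm_mk (p : ContCStarSeminorm A) (ξ : E) :
    hnorm (QuotAlg.normSeminorm p) (QuotMod.mk E p ξ) = hnorm p ξ := rfl

lemma QuotMod.isCompleteFor (hE : IsCompleteFor fun q : ContCStarSeminorm A => hsemi E q)
    (p : ContCStarSeminorm A) :
    IsCompleteFor fun (_ : Unit) (x : QuotMod E p) =>
      hsemi (QuotMod E p) (QuotAlg.normSeminorm p) x :=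
  (isCompleteFor_single hE p).of_surjective (L := (QuotMod.mk E p).toAddMonoidHom)
    QuotMod.mk_surjective fun _ _ => rfl

/-- A coherent family in the quotients `E_p`, given by representatives, comes from an element
of `E`. -/
lemma exists_of_coherent (hE : IsCompleteFor fun q : ContCStarSeminorm A => hsemi E q)
    {ξ : ContCStarSeminorm A → E} (h : ∀ p q : ContCStarSeminorm A, q ≤ p → hnorm q (ξ p - ξ q) = 0) :
    ∃ η : E, ∀ q : ContCStarSeminorm A, hnorm q (η - ξ q) = 0 := by
  have hc : CauchyFor (fun q : ContCStarSeminorm A => hsemi E q) atTop ξ := by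
    refine fun q ε hε => ⟨Set.Ici q, Ici_mem_atTop q, fun r hr s hs => ?_⟩
    have h1 := map_sub_le_add (hsemi E q) (ξ r - ξ q) (ξ s - ξ q)
    simp only [hsemi_apply, h r q hr, h s q hs, sub_sub_sub_cancel_right] at h1 ⊢
    linarith
  obtain ⟨η, hη⟩ := hE.exists_tendstoFor hc
  refine ⟨η, fun q => ?_⟩
  have h1 : Tendsto (fun p => hsemi E q (ξ p - η)) atTop (𝓝 (hsemi E q (η - ξ q))) := by
    refine tendsto_const_nhds.congr' ?_
    filter_upwards [eventually_ge_atTop q] with p hp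
    rw [map_sub_rev]
    have h2 := map_sub_le_add (hsemi E q) (ξ p - η) (ξ p - ξ q)
    have h3 := map_add_le_add (hsemi E q) (ξ p - ξ q) (ξ q - η)
    have h4 := h p q hp
    rw [sub_sub_sub_cancel_left] at h2
    rw [sub_add_sub_cancel] at h3
    simp only [hsemi_apply] at h2 h3 ⊢
    exact le_antisymm (by linarith) (by linarith)
  exact tendsto_nhds_unique h1 (hη q)

end

variable [UniformSpace A] [LocallyCStarAlgebra A]

lemma eq_zero_of_forall_seminorm {a : A} (h : ∀ p : ContCStarSeminorm A, p a = 0) : a = 0 := by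
  by_contra ha
  obtain ⟨p, hp⟩ := LocallyCStarAlgebra.withSeminorms.separating_of_T1 a ha
  exact hp (h p)

variable (A) in
lemma isCompleteFor_algebra : IsCompleteFor fun (p : ContCStarSeminorm A) (a : A) => p a := by
  intro F hF hc
  have hW : WithSeminorms fun p : ContCStarSeminorm A => p.toSeminorm :=
    LocallyCStarAlgebra.withSeminorms
  have hF : Cauchy F := by
    refine ⟨hF, ?_⟩
    rw [uniformity_eq_comap_nhds_zero A, ← tendsto_iff_comap, hW.tendsto_nhds]
    intro p ε hε
    obtain ⟨T, hT, h⟩ := hc p ε hε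
    filter_upwards [prod_mem_prod hT hT] with x hx
    rw [sub_zero]
    exact h _ hx.2 _ hx.1
  obtain ⟨a, ha⟩ := CompleteSpace.complete hF
  exact ⟨a, fun p ε hε => (hW.tendsto_nhds id a).1 ha p ε hε⟩

variable (A) in
lemma isCompleteFor_hsemi_self :
    IsCompleteFor fun (p : ContCStarSeminorm A) (a : A) => hsemi A p a := by
  simpa only [hsemi_apply, hnorm_self] using isCompleteFor_algebra A

lemma QuotAlg.isCompleteFor_norm (p : ContCStarSeminorm A) :
    IsCompleteFor fun (_ : Unit) (x : QuotAlg p) => ‖x‖ :=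
  (isCompleteFor_single (isCompleteFor_hsemi_self A) p).of_surjective
    (L := (QuotAlg.mkₗ p).toAddMonoidHom) QuotAlg.mkₗ_surjective fun _ a => (hnorm_self p a).symm

/-- The quotients `A_p` of a locally C*-algebra are complete, hence C*-algebras. -/
@[reducible]
def QuotAlg.cstarAlgebra (p : ContCStarSeminorm A) : NonUnitalCStarAlgebra (QuotAlg p) where
  __ := (inferInstance : NonUnitalNormedRing (QuotAlg p))
  __ := (inferInstance : StarRing (QuotAlg p))
  __ := (inferInstance : CStarRing (QuotAlg p))
  __ := (inferInstance : NormedSpace ℂ (QuotAlg p))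
  __ := (inferInstance : IsScalarTower ℂ (QuotAlg p) (QuotAlg p))
  __ := (inferInstance : SMulCommClass ℂ (QuotAlg p) (QuotAlg p))
  __ := (inferInstance : StarModule ℂ (QuotAlg p))
  complete := fun {F} hF => by
    obtain ⟨x, hx⟩ := QuotAlg.isCompleteFor_norm p F hF.1 fun _ ε hε => by
      simpa only [dist_eq_norm] using (Metric.cauchy_iff.1 hF).2 ε hε
    refine ⟨x, tendsto_id'.1 (Metric.tendsto_nhds.2 fun ε hε => ?_)⟩
    simpa only [dist_eq_norm, id] using hx () ε hε

end LocallyCStar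

/-! ### The inverse system -/

section InverseSystem

variable {A : Type u} [NonUnitalRing A] [StarRing A] [Module ℂ A] [IsScalarTower ℂ A A]
  [SMulCommClass ℂ A A] [StarModule ℂ A]
variable {E : Type v} [AddCommGroup E] [Module ℂ E] [InnerModule A E] [PreHilbertModule A E]

section

variable [TopologicalSpace A] {p q r : ContCStarSeminorm A}

lemma QuotAlg.trans_refl (x : QuotAlg p) : QuotAlg.trans (le_refl p) x = x := by
  obtain ⟨a, rfl⟩ := QuotAlg.mk_surjective x
  rfl

lemma QuotAlg.trans_trans (h : q ≤ p) (h' : r ≤ q) (x : QuotAlg p) :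
    QuotAlg.trans (h'.trans h) x = QuotAlg.trans h' (QuotAlg.trans h x) := by
  obtain ⟨a, rfl⟩ := QuotAlg.mk_surjective x
  rfl

lemma QuotMod.trans_refl (x : QuotMod E p) : QuotMod.trans E (le_refl p) x = x := by
  obtain ⟨ξ, rfl⟩ := QuotMod.mk_surjective x
  rfl

lemma QuotMod.trans_trans (h : q ≤ p) (h' : r ≤ q) (x : QuotMod E p) :
    QuotMod.trans E (h'.trans h) x = QuotMod.trans E h' (QuotMod.trans E h x) := by
  obtain ⟨ξ, rfl⟩ := QuotMod.mk_surjective x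
  rfl

lemma multTrans_l (h : q ≤ p) (m : Multiplier (QuotAlg p)) (x : QuotAlg p) :
    (multTrans h m).l (QuotAlg.trans h x) = QuotAlg.trans h (m.l x) :=
  Multiplier.map_l _ _ _

lemma multTrans_r (h : q ≤ p) (m : Multiplier (QuotAlg p)) (x : QuotAlg p) :
    (multTrans h m).r (QuotAlg.trans h x) = QuotAlg.trans h (m.r x) :=
  Multiplier.map_r _ _ _

lemma multTrans_refl (m : Multiplier (QuotAlg p)) : multTrans (le_refl p) m = m := by
  refine Multiplier.ext_of_surjective (QuotAlg.trans_surjective (le_refl p))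
    (fun x => ?_) fun x => ?_
  · rw [multTrans_l, QuotAlg.trans_refl, QuotAlg.trans_refl]
  · rw [multTrans_r, QuotAlg.trans_refl, QuotAlg.trans_refl]

lemma multTrans_trans (h : q ≤ p) (h' : r ≤ q) (m : Multiplier (QuotAlg p)) :
    multTrans h' (multTrans h m) = multTrans (h'.trans h) m := by
  refine Multiplier.ext_of_surjective (QuotAlg.trans_surjective (h'.trans h))
    (fun x => ?_) fun x => ?_
  · rw [multTrans_l, QuotAlg.trans_trans h h', QuotAlg.trans_trans h h', multTrans_l, multTrans_l]
  · rw [multTrans_r, QuotAlg.trans_trans h h', QuotAlg.trans_trans h h', multTrans_r, multTrans_r]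

lemma modTrans_refl (t : MultiplierModule (QuotAlg p) (QuotMod E p)) :
    modTrans E (le_refl p) t = t := by
  refine AdjointableMap.ext_of_toFun fun x => ?_
  conv_lhs => rw [← QuotAlg.trans_refl x]
  rw [modTrans_apply, QuotMod.trans_refl]

lemma modTrans_trans (h : q ≤ p) (h' : r ≤ q)
    (t : MultiplierModule (QuotAlg p) (QuotMod E p)) :
    modTrans E h' (modTrans E h t) = modTrans E (h'.trans h) t := by
  refine AdjointableMap.ext_of_toFun fun x => ?_
  obtain ⟨x, rfl⟩ := QuotAlg.trans_surjective (h'.trans h) x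
  rw [modTrans_apply, QuotMod.trans_trans h h', QuotAlg.trans_trans h h', modTrans_apply,
    modTrans_apply]

end

end InverseSystem

/-! ### The Hilbert modules `M(E_p)` over the C*-algebras `M(A_p)` -/

section MultQuot

variable {A : Type u} [NonUnitalRing A] [StarRing A] [Module ℂ A] [IsScalarTower ℂ A A]
  [SMulCommClass ℂ A A] [StarModule ℂ A] [UniformSpace A] [LocallyCStarAlgebra A]
variable {E : Type v} [AddCommGroup E] [Module ℂ E] [InnerModule A E] [PreHilbertModule A E]
variable {p q : ContCStarSeminorm A}

lemma bddAbove_multNorm (m : Multiplier (QuotAlg p)) : BddAbove (m.ballValues fun x => ‖x‖) :=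
  let _ := QuotAlg.cstarAlgebra p
  Multiplier.bddAbove_ballValues_norm m

lemma norm_l_le_multNorm (m : Multiplier (QuotAlg p)) (x : QuotAlg p) :
    ‖m.l x‖ ≤ multNorm p m * ‖x‖ :=
  let _ := QuotAlg.cstarAlgebra p
  Multiplier.norm_l_le m x

lemma multNorm_le {m : Multiplier (QuotAlg p)} {C : ℝ} (hC : 0 ≤ C)
    (h : ∀ x, ‖m.l x‖ ≤ C * ‖x‖) : multNorm p m ≤ C :=
  let _ := QuotAlg.cstarAlgebra p
  Multiplier.mnorm_norm_le m hC h

variable (p) in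
lemma isCStarFor_multNorm : IsCStarFor (Multiplier (QuotAlg p)) (multNorm p) :=
  let _ := QuotAlg.cstarAlgebra p
  Multiplier.isCStarFor_norm (QuotAlg p)

variable (p) in
/-- The norm of `M(A_p)` as a bundled C*-seminorm. -/
def multCStarSeminorm : CStarSeminorm (Multiplier (QuotAlg p)) :=
  let _ := QuotAlg.cstarAlgebra p
  Multiplier.normSeminorm (QuotAlg p)

lemma multCStarSeminorm_apply (m : Multiplier (QuotAlg p)) :
    (multCStarSeminorm p).toSeminorm m = multNorm p m := rfl

lemma multNorm_nonneg (m : Multiplier (QuotAlg p)) : 0 ≤ multNorm p m :=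
  apply_nonneg (multCStarSeminorm p).toSeminorm m

lemma multNorm_multTrans_le (h : q ≤ p) (m : Multiplier (QuotAlg p)) :
    multNorm q (multTrans h m) ≤ multNorm p m := by
  -- every element of `A_q` lifts to `A_p` without increasing its norm
  refine multNorm_le (multNorm_nonneg m) fun x => ?_
  obtain ⟨a, rfl⟩ := QuotAlg.mk_surjective x
  obtain ⟨b, hb0, hb⟩ := exists_bounded_representative (isCompleteFor_hsemi_self A) q a
  rw [hnorm_self] at hb0
  have hab : QuotAlg.mk q a = QuotAlg.mk q b := QuotAlg.mkₗ_eq.2 hb0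
  have hb' : p b ≤ q a := by
    simpa only [hnorm_self] using hb p
  rw [hab, ← QuotAlg.trans_mk h, multTrans, Multiplier.map_l]
  have hcontr : ∀ y : QuotAlg p, ‖QuotAlg.trans h y‖ ≤ ‖y‖ := fun y => by
    obtain ⟨c, rfl⟩ := QuotAlg.mk_surjective y
    exact ContCStarSeminorm.apply_le h c
  refine (hcontr _).trans ((norm_l_le_multNorm m _).trans ?_)
  rw [QuotAlg.trans_mk, ← hab]
  exact mul_le_mul_of_nonneg_left hb' (multNorm_nonneg m)

lemma IsPositiveElt.star_eq {B : Type*} [NonUnitalRing B] [StarRing B] {b : B}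
    (hb : IsPositiveElt b) : star b = b := by
  obtain ⟨c, rfl⟩ := hb
  rw [star_mul, star_star]

lemma IsPositiveElt.map {B C : Type*} [NonUnitalRing B] [StarRing B] [Module ℂ B]
    [NonUnitalRing C] [StarRing C] [Module ℂ C] (φ : B →⋆ₙₐ[ℂ] C) {b : B}
    (hb : IsPositiveElt b) : IsPositiveElt (φ b) := by
  obtain ⟨c, rfl⟩ := hb
  exact ⟨φ c, by rw [map_mul, map_star]⟩

lemma eq_of_isPositiveElt_of_mul_self {m n : Multiplier (QuotAlg p)} (hm : IsPositiveElt m)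
    (hn : IsPositiveElt n) (h : m * m = n * n) : m = n :=
  let _ := QuotAlg.cstarAlgebra p
  Multiplier.sqrt_unique hm hn h

/-- The inner square `⟨t, t⟩ = t* t` of an adjointable map has a positive square root. -/
lemma exists_sqrt_ip (t : MultiplierModule (QuotAlg p) (QuotMod E p)) :
    ∃ n : Multiplier (QuotAlg p), IsPositiveElt n ∧ n * n = ip t t := by
  let _ := QuotAlg.cstarAlgebra p
  refine Multiplier.exists_sqrt (star_ip t t) fun x => ?_
  have : star x * (ip t t : Multiplier (QuotAlg p)).l x = ip (t x) (t x) :=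
    (t.ip_adj x (t x)).symm
  rw [this]
  exact PreHilbertModule.ip_self_nonneg (t x)

lemma isPositiveElt_of_sqrt {B : Type*} [NonUnitalRing B] [StarRing B] {b n : B}
    (hn : IsPositiveElt n) (h : n * n = b) : IsPositiveElt b :=
  ⟨n, by rw [hn.star_eq, h]⟩

/-- `t* t = 0` forces `t = 0`, because `⟨t a, t a⟩ = a* (t* t)(a)`. -/
lemma multiplierModule_eq_zero {B : Type*} [NonUnitalRing B] [StarRing B] [Module ℂ B]
    [IsScalarTower ℂ B B] [SMulCommClass ℂ B B] [StarModule ℂ B] [PreHilbertModule B B]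
    {X : Type*} [AddCommGroup X] [Module ℂ X] [InnerModule B X] [PreHilbertModule B X]
    {t : MultiplierModule B X} (h : (ip t t : Multiplier B) = 0) : t = 0 := by
  refine AdjointableMap.ext_of_toFun fun a => ?_
  refine PreHilbertModule.ip_self_eq_zero (A := B) (t a) ?_
  rw [t.ip_adj, ← MultiplierModule.ip_l, h]
  exact ip_zero_right a

instance : PreHilbertModule (Multiplier (QuotAlg p)) (MultiplierModule (QuotAlg p) (QuotMod E p))
    where
  ip_self_nonneg t := by
    obtain ⟨n, hn, h⟩ := exists_sqrt_ip t
    exact isPositiveElt_of_sqrt hn h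
  ip_self_eq_zero _ h := multiplierModule_eq_zero h

section Norm

variable (t : MultiplierModule (QuotAlg p) (QuotMod E p))

lemma hnorm_multNorm_sq : hnorm (multNorm p) t ^ 2 = multNorm p (ip t t) :=
  Real.sq_sqrt (multNorm_nonneg _)

lemma hnorm_apply_le (x : QuotAlg p) :
    hnorm (QuotAlg.normSeminorm p) (t x) ≤ hnorm (multNorm p) t * ‖x‖ := by
  refine le_of_sq_le_sq ?_ (mul_nonneg (Real.sqrt_nonneg _) (norm_nonneg _))
  rw [hnorm_sq, mul_pow, hnorm_multNorm_sq, t.ip_adj, QuotAlg.normSeminorm_apply]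
  have h1 : ‖star x * t.adj (t x)‖ ≤ ‖star x‖ * ‖t.adj (t x)‖ := norm_mul_le _ _
  have h2 : ‖t.adj (t x)‖ ≤ multNorm p (ip t t) * ‖x‖ := norm_l_le_multNorm (ip t t) x
  rw [norm_star] at h1
  refine h1.trans ?_
  nlinarith [norm_nonneg x]

variable {t} in
lemma norm_adj_le_of_bound {C : ℝ} (hC : 0 ≤ C)
    (h : ∀ x, hnorm (QuotAlg.normSeminorm p) (t x) ≤ C * ‖x‖) (y : QuotMod E p) :
    ‖t.adj y‖ ≤ C * hnorm (QuotAlg.normSeminorm p) y := by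
  have hy := hnorm_nonneg (QuotAlg.normSeminorm p) y
  rcases (norm_nonneg (t.adj y)).eq_or_lt with h0 | h0
  · rw [← h0]
    exact mul_nonneg hC hy
  have h1 : ‖t.adj y‖ ^ 2 = ‖(ip (t (t.adj y)) y : QuotAlg p)‖ := by
    rw [t.ip_adj, ip_self, CStarRing.norm_star_mul_self, pow_two]
  have h2 := ip_le (QuotAlg.normSeminorm p) (t (t.adj y)) y
  rw [QuotAlg.normSeminorm_apply, ← h1] at h2
  have h3 := h2.trans (mul_le_mul_of_nonneg_right (h (t.adj y)) hy)
  refine le_of_mul_le_mul_left ?_ h0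
  linarith

lemma norm_adj_le (y : QuotMod E p) :
    ‖t.adj y‖ ≤ hnorm (multNorm p) t * hnorm (QuotAlg.normSeminorm p) y :=
  norm_adj_le_of_bound (Real.sqrt_nonneg _) (hnorm_apply_le t) y

variable {t} in
/-- The Hilbert module norm of `M(E_p)` is the operator norm. -/
lemma hnorm_multNorm_le {C : ℝ} (hC : 0 ≤ C)
    (h : ∀ x, hnorm (QuotAlg.normSeminorm p) (t x) ≤ C * ‖x‖) : hnorm (multNorm p) t ≤ C := by
  refine le_of_sq_le_sq ?_ hC
  rw [hnorm_multNorm_sq]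
  refine multNorm_le (sq_nonneg C) fun x => ?_
  rw [MultiplierModule.ip_l, pow_two, mul_assoc]
  exact (norm_adj_le_of_bound hC h _).trans (mul_le_mul_of_nonneg_left (h x) hC)

end Norm

variable (E p) in
/-- The norm of `M(E_p)` as a bundled seminorm. -/
def multModSeminorm : Seminorm ℂ (MultiplierModule (QuotAlg p) (QuotMod E p)) :=
  Seminorm.of (hnorm (multNorm p))
    (fun s t => by
      refine hnorm_multNorm_le (add_nonneg (Real.sqrt_nonneg _) (Real.sqrt_nonneg _)) fun x => ?_
      rw [add_mul]
      exact (map_add_le_add (hsemi _ (QuotAlg.normSeminorm p)) (s x) (t x)).trans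
        (add_le_add (hnorm_apply_le s x) (hnorm_apply_le t x)))
    (fun c t => by
      rw [hnorm, hnorm, ip_smul_left, ip_smul_right, ← multCStarSeminorm_apply,
        ← multCStarSeminorm_apply, map_smul_eq_mul, map_smul_eq_mul, norm_star, ← mul_assoc,
        Real.sqrt_mul (by positivity), Real.sqrt_mul_self (norm_nonneg _)])

lemma multModSeminorm_apply (t : MultiplierModule (QuotAlg p) (QuotMod E p)) :
    multModSeminorm E p t = hnorm (multNorm p) t := rfl

lemma multModSeminorm_eq_zero {t : MultiplierModule (QuotAlg p) (QuotMod E p)}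
    (h : multModSeminorm E p t = 0) : t = 0 := by
  refine PreHilbertModule.ip_self_eq_zero (A := Multiplier (QuotAlg p)) t ?_
  refine (isCStarFor_multNorm p).separating _ fun _ => ?_
  rw [← hnorm_multNorm_sq, ← multModSeminorm_apply, h, zero_pow two_ne_zero]

/-- `M(E_p)` is complete in norm: a norm Cauchy filter is strictly Cauchy, and its strict limit is
a limit in norm. -/
lemma isCompleteFor_multModSeminorm
    (hE : IsCompleteFor fun q : ContCStarSeminorm A => hsemi E q) :
    IsCompleteFor fun (_ : Unit) t => multModSeminorm E p t := by
  refine isCompleteFor_of_exists_tendstoFor (S := fun _ => multModSeminorm E p) fun F _ hc => ?_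
  have hstrict := isCompleteFor_strictSemi (E := QuotMod E p)
    (P := fun _ : Unit => QuotAlg.normSeminorm p) (fun x hx => norm_eq_zero.1 (hx ()))
    (QuotAlg.isCompleteFor_norm p) (QuotMod.isCompleteFor hE p)
  have hbound : ∀ i, ∃ _ : Unit, ∃ C : ℝ, ∀ s t : MultiplierModule (QuotAlg p) (QuotMod E p),
      strictSemi (QuotMod E p) (fun _ : Unit => QuotAlg.normSeminorm p) i (s - t) ≤
        C * multModSeminorm E p (s - t) := fun ⟨_, x, y⟩ =>
    ⟨(), ‖x‖ + hnorm (QuotAlg.normSeminorm p) y, fun s t => by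
      rw [add_mul, mul_comm ‖x‖, mul_comm (hnorm _ y)]
      exact add_le_add (hnorm_apply_le (s - t) x) (norm_adj_le (s - t) y)⟩
  obtain ⟨t, ht⟩ := IsCompleteFor.exists_tendstoFor
    (S := strictSemi (QuotMod E p) fun _ : Unit => QuotAlg.normSeminorm p) hstrict
    (hc.map id hbound)
  refine ⟨t, fun _ => (tendsto_zero_iff_eventually_lt _).2 fun ε hε => ?_⟩
  obtain ⟨T, hT, h⟩ := hc () (ε / 2) (half_pos hε)
  filter_upwards [hT] with s hs
  refine lt_of_le_of_lt (hnorm_multNorm_le (half_pos hε).le fun x => ?_) (half_lt_self hε)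
  have h1 := ht ((), x, 0)
  refine ge_of_tendsto (f := fun r => ε / 2 * ‖x‖ +
      strictSemi (QuotMod E p) (fun _ : Unit => QuotAlg.normSeminorm p) ((), x, 0) (r - t))
    (by simpa using h1.const_add (ε / 2 * ‖x‖)) ?_
  filter_upwards [hT] with r hr
  rw [strictSemi_sub]
  have h2 : hnorm (QuotAlg.normSeminorm p) ((s - r) x) ≤ ε / 2 * ‖x‖ :=
    (hnorm_apply_le _ x).trans
      (mul_le_mul_of_nonneg_right (h s hs r hr).le (norm_nonneg x))
  have h3 := map_add_le_add (hsemi (QuotMod E p) (QuotAlg.normSeminorm p)) (s x - r x) (r x - t x)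
  rw [sub_add_sub_cancel, ← AdjointableMap.sub_apply s r] at h3
  have h4 := apply_nonneg (QuotAlg.normSeminorm p).toSeminorm (r.adj 0 - t.adj 0)
  rw [AdjointableMap.sub_apply]
  exact h3.trans (add_le_add h2 (le_add_of_nonneg_right h4))

lemma multModSeminorm_modTrans_le (h : q ≤ p)
    (t : MultiplierModule (QuotAlg p) (QuotMod E p)) :
    multModSeminorm E q (modTrans E h t) ≤ multModSeminorm E p t := by
  refine Real.sqrt_le_sqrt ?_
  rw [modTrans_ip]
  exact multNorm_multTrans_le h _

end MultQuot

/-! ### The inverse limits -/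

section Limit

section Generic

variable {ι : Type*} [LE ι] {X : Type*} [AddCommGroup X] [Module ℂ X] {Y : ι → Type*}
  [∀ i, AddCommGroup (Y i)] [∀ i, Module ℂ (Y i)]

/-- An inverse limit of Banach spaces along contractions is complete. -/
lemma isCompleteFor_inverseLimit (N : ∀ i, Seminorm ℂ (Y i))
    (hsep : ∀ i y, N i y = 0 → y = 0) (hcomp : ∀ i, IsCompleteFor fun (_ : Unit) y => N i y)
    (T : ∀ i j, j ≤ i → Y i →ₗ[ℂ] Y j) (hT : ∀ i j h y, N j (T i j h y) ≤ N i y)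
    (ev : ∀ i, X →ₗ[ℂ] Y i) (hev : ∀ i j h x, T i j h (ev i x) = ev j x)
    (hlift : ∀ y : ∀ i, Y i, (∀ i j h, T i j h (y i) = y j) → ∃ x, ∀ i, ev i x = y i) :
    IsCompleteFor fun i x => N i (ev i x) := by
  refine isCompleteFor_of_exists_tendstoFor (S := fun i => (N i).comp (ev i)) fun F _ hc => ?_
  have hlim : ∀ i, ∃ y, TendstoFor (fun _ : Unit => N i) F (fun x => ev i x) y := fun i =>
    IsCompleteFor.exists_tendstoFor (S := fun _ : Unit => N i) (hcomp i)
      (hc.map (ev i) fun _ => ⟨i, 1, fun x y => by rw [one_mul, ← map_sub]; rfl⟩)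
  choose y hy using hlim
  obtain ⟨x, hx⟩ := hlift y fun i j h => by
    refine TendstoFor.unique (S := fun _ : Unit => N j) (fun z hz => hsep j z (hz ()))
      ((hy i).map (S' := fun _ : Unit => N j) (T i j h) fun _ => ⟨(), 1, fun a b => ?_⟩) ?_
    · rw [one_mul, ← map_sub]
      exact hT i j h _
    · simpa only [hev] using hy j
  refine ⟨x, fun i => ?_⟩
  simpa only [Seminorm.comp_apply, map_sub, hx, id] using hy i ()

end Generic

variable {A : Type u} [NonUnitalRing A] [StarRing A] [Module ℂ A] [IsScalarTower ℂ A A]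
  [SMulCommClass ℂ A A] [StarModule ℂ A] [UniformSpace A] [LocallyCStarAlgebra A]
variable {E : Type v} [AddCommGroup E] [Module ℂ E] [InnerModule A E] [PreHilbertModule A E]

variable (A) in
lemma isLocallyCStarFor_limMult :
    IsLocallyCStarFor (LimMult A) fun p m => multNorm p (m.1 p) where
  cstar p := ⟨{
    toSeminorm := (multCStarSeminorm p).toSeminorm.comp
      ({ toFun := fun m => m.1 p
         map_add' := fun _ _ => rfl
         map_smul' := fun _ _ => rfl } : LimMult A →ₗ[ℂ] Multiplier (QuotAlg p))
    mul_le' := fun m n => (multCStarSeminorm p).mul_le' (m.1 p) (n.1 p)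
    star_mul_self' := fun m => (multCStarSeminorm p).star_mul_self' (m.1 p) }, fun _ => rfl⟩
  separating _ h := Subtype.ext <| funext fun p =>
    (isCStarFor_multNorm p).separating _ fun _ => h p
  complete := isCompleteFor_inverseLimit (fun p => (multCStarSeminorm p).toSeminorm)
    (fun p m h => (isCStarFor_multNorm p).separating m fun _ => h)
    (fun p => (isCStarFor_multNorm p).complete)
    (fun _ _ h =>
      { toFun := multTrans h
        map_add' := map_add (multTrans h)
        map_smul' := map_smul (multTrans h) })
    (fun _ _ h m => multNorm_multTrans_le h m)
    (fun p =>
      { toFun := fun m : LimMult A => m.1 p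
        map_add' := fun _ _ => rfl
        map_smul' := fun _ _ => rfl })
    (fun p q h m => m.2 p q h) fun m hm => ⟨⟨m, hm⟩, fun _ => rfl⟩

/-- Positivity in `lim M(A_p)` is componentwise positivity, because positive square roots are
unique and hence coherent. -/
lemma isPositiveElt_limMult {m : LimMult A}
    (h : ∀ p, ∃ n : Multiplier (QuotAlg p), IsPositiveElt n ∧ n * n = m.1 p) :
    IsPositiveElt m := by
  choose n hn hnm using h
  refine ⟨⟨n, fun p q h => ?_⟩, Subtype.ext (funext fun p => ?_)⟩
  · refine eq_of_isPositiveElt_of_mul_self ((hn p).map (multTrans h)) (hn q) ?_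
    rw [← map_mul, hnm, hnm, m.2 p q h]
  · change m.1 p = star (n p) * n p
    rw [(hn p).star_eq, hnm]

instance : PreHilbertModule (LimMult A) (LimMod A E) where
  ip_self_nonneg t := isPositiveElt_limMult fun p => exists_sqrt_ip (t.1 p)
  ip_self_eq_zero t h := Subtype.ext <| funext fun p =>
    PreHilbertModule.ip_self_eq_zero (A := Multiplier (QuotAlg p)) (t.1 p)
      (congrFun (congrArg Subtype.val h) p)

lemma isHilbertModuleFor_limMod
    (hE : IsCompleteFor fun q : ContCStarSeminorm A => hsemi E q) :
    IsHilbertModuleFor (LimMod A E) fun p (m : LimMult A) => multNorm p (m.1 p) :=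
  ⟨inferInstance, isCompleteFor_inverseLimit (fun p => multModSeminorm E p)
    (fun _ _ h => multModSeminorm_eq_zero h)
    (fun _ => isCompleteFor_multModSeminorm hE)
    (fun _ _ h => modTrans E h) (fun _ _ h t => multModSeminorm_modTrans_le h t)
    (fun p => LinearMap.proj p ∘ₗ (LimMod A E).subtype)
    (fun p q h t => t.2 p q h) fun t ht => ⟨⟨t, ht⟩, fun _ => rfl⟩⟩

end Limit

/-! ### The isomorphism of `M(A)` with the inverse limit of the `M(A_p)` -/

section Iso

variable {A : Type u} [NonUnitalRing A] [StarRing A] [Module ℂ A] [IsScalarTower ℂ A A]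
  [SMulCommClass ℂ A A] [StarModule ℂ A] [UniformSpace A] [LocallyCStarAlgebra A]

lemma QuotAlg.mk_injective {a b : A} (h : ∀ p, QuotAlg.mk p a = QuotAlg.mk p b) : a = b :=
  sub_eq_zero.1 <| eq_zero_of_forall_seminorm fun p => QuotAlg.mkₗ_eq.1 (h p)

lemma QuotAlg.exists_mk_eq {x : ∀ p : ContCStarSeminorm A, QuotAlg p}
    (hx : ∀ p q (h : q ≤ p), QuotAlg.trans h (x p) = x q) : ∃ a, ∀ p, QuotAlg.mk p a = x p := by
  choose b hb using fun p => QuotAlg.mk_surjective (x p)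
  obtain ⟨a, ha⟩ := exists_of_coherent (isCompleteFor_hsemi_self A) (ξ := b) fun p q h => by
    rw [hnorm_self]
    refine QuotAlg.mkₗ_eq.1 (?_ : QuotAlg.mk q (b p) = QuotAlg.mk q (b q))
    rw [← QuotAlg.trans_mk h, hb, hb, hx]
  refine ⟨a, fun p => ?_⟩
  rw [← hb]
  refine QuotAlg.mkₗ_eq.2 ?_
  rw [ContCStarSeminorm.mem_ker, ← hnorm_self, ha]

lemma multTrans_multProj {p q : ContCStarSeminorm A} (h : q ≤ p) (m : Multiplier A) :
    multTrans h (multProj p m) = multProj q m := by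
  refine Multiplier.ext_of_surjective QuotAlg.mk_surjective (fun a => ?_) fun a => ?_
  · rw [← QuotAlg.trans_mk h, multTrans, Multiplier.map_l, multProj, Multiplier.map_l,
      QuotAlg.trans_mk, QuotAlg.trans_mk, multProj, Multiplier.map_l]
  · rw [← QuotAlg.trans_mk h, multTrans, Multiplier.map_r, multProj, Multiplier.map_r,
      QuotAlg.trans_mk, QuotAlg.trans_mk, multProj, Multiplier.map_r]

lemma multProj_l (p : ContCStarSeminorm A) (m : Multiplier A) (a : A) :
    (multProj p m).l (QuotAlg.mk p a) = QuotAlg.mk p (m.l a) :=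
  Multiplier.map_l _ _ _

lemma multProj_r (p : ContCStarSeminorm A) (m : Multiplier A) (a : A) :
    (multProj p m).r (QuotAlg.mk p a) = QuotAlg.mk p (m.r a) :=
  Multiplier.map_r _ _ _

lemma ballValues_multProj (p : ContCStarSeminorm A) (m : Multiplier A) :
    (multProj p m).ballValues (fun x => ‖x‖) = m.ballValues p := by
  ext c
  refine ⟨fun ⟨x, hx, hc⟩ => ?_, fun ⟨a, ha, hc⟩ => ⟨QuotAlg.mk p a, ha, ?_⟩⟩
  · obtain ⟨a, rfl⟩ := QuotAlg.mk_surjective x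
    rw [multProj_l] at hc
    exact ⟨a, hx, hc⟩
  · rw [multProj_l]
    exact hc

lemma multNorm_multProj (p : ContCStarSeminorm A) (m : Multiplier A) :
    multNorm p (multProj p m) = multSeminorm p m :=
  congrArg sSup (ballValues_multProj p m)

variable (A) in
/-- The *-homomorphism `M(A) → lim M(A_p)` given by the canonical maps `M(A) → M(A_p)`. -/
def limMultHom : Multiplier A →⋆ₙₐ[ℂ] LimMult A where
  toFun m := ⟨fun p => multProj p m, fun _ _ h => multTrans_multProj h m⟩
  map_smul' c m := Subtype.ext <| funext fun p => map_smul (multProj p) c m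
  map_zero' := Subtype.ext <| funext fun p => map_zero (multProj p)
  map_add' m n := Subtype.ext <| funext fun p => map_add (multProj p) m n
  map_mul' m n := Subtype.ext <| funext fun p => map_mul (multProj p) m n
  map_star' m := Subtype.ext <| funext fun p => map_star (multProj p) m

lemma limMultHom_injective : Function.Injective (limMultHom A) := fun m n h => by
  have h' : ∀ p, multProj p m = multProj p n := fun p => congrFun (congrArg Subtype.val h) p
  refine Multiplier.ext (LinearMap.ext fun a => QuotAlg.mk_injective fun p => ?_)
    (LinearMap.ext fun a => QuotAlg.mk_injective fun p => ?_)
  · rw [← multProj_l, h', multProj_l]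
  · rw [← multProj_r, h', multProj_r]

lemma limMultHom_surjective : Function.Surjective (limMultHom A) := fun m => by
  have hl : ∀ a, ∃ b, ∀ p, QuotAlg.mk p b = (m.1 p).l (QuotAlg.mk p a) := fun a =>
    QuotAlg.exists_mk_eq fun p q h => by
      rw [← QuotAlg.trans_mk h a, ← m.2 p q h]
      exact (Multiplier.map_l _ _ _).symm
  have hr : ∀ a, ∃ b, ∀ p, QuotAlg.mk p b = (m.1 p).r (QuotAlg.mk p a) := fun a =>
    QuotAlg.exists_mk_eq fun p q h => by
      rw [← QuotAlg.trans_mk h a, ← m.2 p q h]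
      exact (Multiplier.map_r _ _ _).symm
  choose l hl using hl
  choose r hr using hr
  refine ⟨{
    l :=
      { toFun := l
        map_add' := fun a b => QuotAlg.mk_injective fun p => by simp only [hl, map_add]
        map_smul' := fun c a => QuotAlg.mk_injective fun p => by
          simp only [hl, map_smul, RingHom.id_apply] }
    r :=
      { toFun := r
        map_add' := fun a b => QuotAlg.mk_injective fun p => by simp only [hr, map_add]
        map_smul' := fun c a => QuotAlg.mk_injective fun p => by
          simp only [hr, map_smul, RingHom.id_apply] }
    l_mul := fun a b => QuotAlg.mk_injective fun p => by
      simp only [LinearMap.coe_mk, AddHom.coe_mk, hl, map_mul, (m.1 p).l_mul]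
    r_mul := fun a b => QuotAlg.mk_injective fun p => by
      simp only [LinearMap.coe_mk, AddHom.coe_mk, hr, map_mul, (m.1 p).r_mul]
    central := fun a b => QuotAlg.mk_injective fun p => by
      simp only [LinearMap.coe_mk, AddHom.coe_mk, hl, hr, map_mul, (m.1 p).central] },
    Subtype.ext (funext fun p => ?_)⟩
  refine Multiplier.ext_of_surjective QuotAlg.mk_surjective (fun a => ?_) fun a => ?_
  · exact (multProj_l _ _ _).trans (hl a p)
  · exact (multProj_r _ _ _).trans (hr a p)

variable (A) in
/-- The *-isomorphism `M(A) ≃ lim M(A_p)`. -/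
def limMultEquiv : Multiplier A ≃⋆ₐ[ℂ] LimMult A :=
  StarAlgEquiv.ofBijective (limMultHom A) ⟨limMultHom_injective, limMultHom_surjective⟩

lemma limMultEquiv_apply (m : Multiplier A) (p : ContCStarSeminorm A) :
    (limMultEquiv A m).1 p = multProj p m := rfl

variable (A) in
lemma isLocallyCStarFor_multiplier :
    IsLocallyCStarFor (Multiplier A) (multSeminorm (A := A)) where
  cstar p := ⟨{
    toSeminorm := (multCStarSeminorm p).toSeminorm.comp
      ({ toFun := multProj p
         map_add' := map_add (multProj p)
         map_smul' := map_smul (multProj p) } : Multiplier A →ₗ[ℂ] Multiplier (QuotAlg p))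
    mul_le' := fun m n => by
      simp only [Seminorm.comp_apply, LinearMap.coe_mk, AddHom.coe_mk, map_mul]
      exact (multCStarSeminorm p).mul_le' _ _
    star_mul_self' := fun m => by
      simp only [Seminorm.comp_apply, LinearMap.coe_mk, AddHom.coe_mk, map_mul, map_star]
      exact (multCStarSeminorm p).star_mul_self' _ }, fun m => multNorm_multProj p m⟩
  separating m h := limMultHom_injective <| by
    rw [map_zero]
    exact (isLocallyCStarFor_limMult A).separating _ fun p => (multNorm_multProj p m).trans (h p)
  complete := (isLocallyCStarFor_limMult A).complete.of_surjective
    (L := (limMultEquiv A).symm.toRingEquiv.toAddEquiv.toAddMonoidHom)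
    (limMultEquiv A).symm.surjective fun p m => by
      refine (multNorm_multProj p _).symm.trans ?_
      exact congrArg (fun m : LimMult A => multNorm p (m.1 p))
        ((limMultEquiv A).apply_symm_apply m)

variable {E : Type v} [AddCommGroup E] [Module ℂ E] [InnerModule A E] [PreHilbertModule A E]

/-! ### The unitary operator from `M(E)` onto the inverse limit of the `M(E_p)` -/

lemma QuotMod.mk_injective {ξ η : E}
    (h : ∀ p : ContCStarSeminorm A, QuotMod.mk E p ξ = QuotMod.mk E p η) : ξ = η :=
  sub_eq_zero.1 <| hsemi_separating (P := fun p : ContCStarSeminorm A => p)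
    (fun _ => eq_zero_of_forall_seminorm) _ fun p => QuotMod.mk_eq.1 (h p)

lemma QuotMod.exists_mk_eq (hE : IsCompleteFor fun q : ContCStarSeminorm A => hsemi E q)
    {x : ∀ p : ContCStarSeminorm A, QuotMod E p}
    (hx : ∀ p q (h : q ≤ p), QuotMod.trans E h (x p) = x q) :
    ∃ ξ, ∀ p, QuotMod.mk E p ξ = x p := by
  choose b hb using fun p => QuotMod.mk_surjective (x p)
  obtain ⟨ξ, hξ⟩ := exists_of_coherent hE (ξ := b) fun p q h => by
    refine QuotMod.mk_eq.1 ?_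
    rw [← QuotMod.trans_mk h, hb, hb, hx]
  refine ⟨ξ, fun p => ?_⟩
  rw [← hb]
  exact QuotMod.mk_eq.2 (hξ p)

lemma limMap_injective : Function.Injective (limMap A E) := fun s t h => by
  have h' : ∀ p, modProj E p s = modProj E p t := fun p => congrFun (congrArg Subtype.val h) p
  refine AdjointableMap.ext_of_toFun fun a => QuotMod.mk_injective (A := A) fun p => ?_
  rw [← modProj_apply, h', modProj_apply]

lemma limMap_surjective (hE : IsCompleteFor fun q : ContCStarSeminorm A => hsemi E q) :
    Function.Surjective (limMap A E) := fun t => by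
  have hf : ∀ a, ∃ ξ, ∀ p, QuotMod.mk E p ξ = t.1 p (QuotAlg.mk p a) := fun a =>
    QuotMod.exists_mk_eq hE fun p q h => by
      rw [← QuotAlg.trans_mk h a, ← t.2 p q h, modTrans_apply]
  have hg : ∀ ξ : E, ∃ a, ∀ p, QuotAlg.mk p a = (t.1 p).adj (QuotMod.mk E p ξ) := fun ξ =>
    QuotAlg.exists_mk_eq fun p q h => by
      rw [← QuotMod.trans_mk h ξ, ← t.2 p q h, modTrans_adj]
  choose f hf using hf
  choose g hg using hg
  refine ⟨{
    toFun :=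
      { toFun := f
        map_add' := fun a b => QuotMod.mk_injective (A := A) fun p => by simp only [hf, map_add]
        map_smul' := fun c a => QuotMod.mk_injective (A := A) fun p => by
          simp only [hf, map_smul, RingHom.id_apply] }
    adj :=
      { toFun := g
        map_add' := fun a b => QuotAlg.mk_injective fun p => by simp only [hg, map_add]
        map_smul' := fun c a => QuotAlg.mk_injective fun p => by
          simp only [hg, map_smul, RingHom.id_apply] }
    map_act := fun a b => QuotMod.mk_injective (A := A) fun p => by
      simp only [LinearMap.coe_mk, AddHom.coe_mk, (QuotMod.mk_isModuleQuotient E p).map_act, hf,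
        ← (t.1 p).map_act]
      exact congrArg (t.1 p) ((QuotAlg.mk_isModuleQuotient p).map_act a b)
    adj_act := fun ξ b => QuotAlg.mk_injective fun p => by
      have h := (QuotAlg.mk_isModuleQuotient p).map_act (g ξ) b
      refine (hg _ _).trans (Eq.trans ?_ h.symm)
      rw [(QuotMod.mk_isModuleQuotient E p).map_act, (t.1 p).adj_act, ← hg]
      rfl
    ip_adj := fun a ξ => QuotAlg.mk_injective fun p => by
      have h := (QuotAlg.mk_isModuleQuotient p).map_ip a (g ξ)
      refine Eq.trans ?_ h.symm
      simp only [LinearMap.coe_mk, AddHom.coe_mk]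
      rw [(QuotMod.mk_isModuleQuotient E p).map_ip, hf, (t.1 p).ip_adj, ← hg]
      rfl },
    Subtype.ext (funext fun p => AdjointableMap.ext_of_toFun fun x => ?_)⟩
  obtain ⟨a, rfl⟩ := QuotAlg.mk_surjective x
  exact (modProj_apply _ _ _).trans (hf a p)

lemma modProj_act (p : ContCStarSeminorm A) (t : MultiplierModule A E) (m : Multiplier A) :
    modProj E p (act t m) = act (modProj E p t) (multProj p m) := by
  refine AdjointableMap.ext_of_toFun fun x => ?_
  obtain ⟨a, rfl⟩ := QuotAlg.mk_surjective x
  rw [modProj_apply, MultiplierModule.act_apply, MultiplierModule.act_apply, multProj_l,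
    modProj_apply]

lemma modProj_ip (p : ContCStarSeminorm A) (s t : MultiplierModule A E) :
    (ip (modProj E p s) (modProj E p t) : Multiplier (QuotAlg p)) = multProj p (ip s t) := by
  refine Multiplier.ext_of_surjective QuotAlg.mk_surjective (fun a => ?_) fun a => ?_
  · rw [MultiplierModule.ip_l, modProj_apply, modProj_adj, multProj_l, MultiplierModule.ip_l]
  · rw [multProj_r]
    change star ((modProj E p t).adj (modProj E p s (star (QuotAlg.mk p a)))) =
      QuotAlg.mk p (star (t.adj (s (star a))))
    rw [← map_star (QuotAlg.mk p), modProj_apply, modProj_adj, ← map_star (QuotAlg.mk p)]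

lemma limMap_act (t : MultiplierModule A E) (m : Multiplier A) :
    limMap A E (act t m) = act (limMap A E t) (limMultEquiv A m) :=
  Subtype.ext <| funext fun p => modProj_act p t m

lemma limMap_ip (s t : MultiplierModule A E) :
    (ip (limMap A E s) (limMap A E t) : LimMult A) = limMultEquiv A (ip s t) :=
  Subtype.ext <| funext fun p => modProj_ip p s t

/-- The map `U : M(E) → lim M(E_p)` as a linear isomorphism. -/
def limMapEquiv (hE : IsCompleteFor fun q : ContCStarSeminorm A => hsemi E q) :
    MultiplierModule A E ≃ₗ[ℂ] LimMod A E :=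
  LinearEquiv.ofBijective (limMap A E) ⟨limMap_injective, limMap_surjective hE⟩

lemma limMap_limMapEquiv_symm (hE : IsCompleteFor fun q : ContCStarSeminorm A => hsemi E q)
    (t : LimMod A E) : limMap A E ((limMapEquiv hE).symm t) = t :=
  (limMapEquiv hE).apply_symm_apply t

lemma isUnitaryAlong_limMap (hE : IsCompleteFor fun q : ContCStarSeminorm A => hsemi E q) :
    IsUnitaryAlong (limMultEquiv A) (limMap A E) := by
  refine ⟨limMap_act, (limMapEquiv hE).symm, fun y b => limMap_injective ?_, fun x y => ?_,
    LinearMap.ext (limMapEquiv hE).symm_apply_apply,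
    LinearMap.ext (limMapEquiv hE).apply_symm_apply⟩
  · rw [limMap_act]
    exact (limMap_limMapEquiv_symm hE _).trans
      (congrArg (fun z => act z (limMultEquiv A b)) (limMap_limMapEquiv_symm hE y).symm)
  · rw [← limMap_ip]
    exact congrArg _ (limMap_limMapEquiv_symm hE y).symm

variable (E) in
/-- The seminorms of the Hilbert `M(A)`-module `M(E)`, which are the norms of the images in the
`M(E_p)`, as bundled seminorms. -/
def multModSemi (p : ContCStarSeminorm A) : Seminorm ℂ (MultiplierModule A E) :=
  (multModSeminorm E p).comp (modProj E p)

lemma multModSemi_apply (p : ContCStarSeminorm A) (t : MultiplierModule A E) :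
    multModSemi E p t = hnorm (multSeminorm p) t := by
  change hnorm (multNorm p) (modProj E p t) = _
  rw [hnorm, modProj_ip, multNorm_multProj, hnorm]

instance : PreHilbertModule (Multiplier A) (MultiplierModule A E) where
  ip_self_nonneg t := by
    obtain ⟨n, hn⟩ := PreHilbertModule.ip_self_nonneg (A := LimMult A) (limMap A E t)
    refine ⟨(limMultEquiv A).symm n, (limMultEquiv A).injective ?_⟩
    change limMultEquiv A _ = limMultEquiv A _
    rw [← limMap_ip, hn, map_mul, map_star, StarAlgEquiv.apply_symm_apply]
  ip_self_eq_zero _ h := multiplierModule_eq_zero h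

lemma hnorm_limMapEquiv_symm (hE : IsCompleteFor fun q : ContCStarSeminorm A => hsemi E q)
    (p : ContCStarSeminorm A) (t : LimMod A E) :
    hnorm (multSeminorm p) ((limMapEquiv hE).symm t) = hnorm (multNorm p) (t.1 p) := by
  rw [← multModSemi_apply]
  change hnorm (multNorm p) ((limMap A E ((limMapEquiv hE).symm t)).1 p) = _
  rw [limMap_limMapEquiv_symm]

lemma isHilbertModuleFor_multiplierModule
    (hE : IsCompleteFor fun q : ContCStarSeminorm A => hsemi E q) :
    IsHilbertModuleFor (MultiplierModule A E) (multSeminorm (A := A)) :=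
  ⟨inferInstance, (isHilbertModuleFor_limMod hE).2.of_surjective
    (L := (limMapEquiv hE).symm.toLinearMap.toAddMonoidHom)
    (limMapEquiv hE).symm.surjective (hnorm_limMapEquiv_symm hE)⟩

/-! ### The strict topologies -/

lemma continuous_modTrans {p q : ContCStarSeminorm A} (h : q ≤ p) :
    @Continuous _ _ (strictTopologyQuot E p) (strictTopologyQuot E q) (modTrans E h) := by
  refine continuous_seminormTopology
    (S := strictSemi (QuotMod E p) fun _ : Unit => QuotAlg.normSeminorm p)
    (S' := strictSemi (QuotMod E q) fun _ : Unit => QuotAlg.normSeminorm q) ?_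
  rintro ⟨_, x, y⟩
  obtain ⟨a, rfl⟩ := QuotAlg.mk_surjective x
  obtain ⟨ξ, rfl⟩ := QuotMod.mk_surjective y
  refine ⟨((), QuotAlg.mk p a, QuotMod.mk E p ξ), 1, fun s t => ?_⟩
  rw [one_mul, ← map_sub]
  refine add_le_add ?_ ?_
  · change hnorm (QuotAlg.normSeminorm q) (modTrans E h (s - t) (QuotAlg.mk q a)) ≤
      hnorm (QuotAlg.normSeminorm p) ((s - t) (QuotAlg.mk p a))
    rw [← QuotAlg.trans_mk h, modTrans_apply]
    obtain ⟨η, hη⟩ := QuotMod.mk_surjective ((s - t) (QuotAlg.mk p a))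
    rw [← hη]
    exact hnorm_mono h η
  · change ‖(modTrans E h (s - t)).adj (QuotMod.mk E q ξ)‖ ≤ ‖(s - t).adj (QuotMod.mk E p ξ)‖
    rw [← QuotMod.trans_mk h, modTrans_adj]
    obtain ⟨b, hb⟩ := QuotAlg.mk_surjective ((s - t).adj (QuotMod.mk E p ξ))
    rw [← hb]
    exact ContCStarSeminorm.apply_le h b

/-- The strict seminorms of `t` are the strict seminorms of its images in the `M(E_p)`. -/
lemma strictSemi_modProj (p : ContCStarSeminorm A) (a : A) (ξ : E) (t : MultiplierModule A E) :
    strictSemi (QuotMod E p) (fun _ : Unit => QuotAlg.normSeminorm p)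
      ((), QuotAlg.mk p a, QuotMod.mk E p ξ) (modProj E p t) =
    strictSemi E (fun p : ContCStarSeminorm A => p) (p, a, ξ) t := by
  change hnorm (QuotAlg.normSeminorm p) (modProj E p t (QuotAlg.mk p a)) +
    ‖(modProj E p t).adj (QuotMod.mk E p ξ)‖ = _
  rw [modProj_apply, modProj_adj]
  rfl

lemma continuous_modProj (p : ContCStarSeminorm A) :
    @Continuous _ _ (strictTopology A E) (strictTopologyQuot E p) (modProj E p) := by
  refine continuous_seminormTopology (S := strictSemi E fun p : ContCStarSeminorm A => p)
    (S' := strictSemi (QuotMod E p) fun _ : Unit => QuotAlg.normSeminorm p) ?_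
  rintro ⟨_, x, y⟩
  obtain ⟨a, rfl⟩ := QuotAlg.mk_surjective x
  obtain ⟨ξ, rfl⟩ := QuotMod.mk_surjective y
  refine ⟨(p, a, ξ), 1, fun s t => ?_⟩
  rw [one_mul, ← map_sub, strictSemi_modProj]

lemma isHomeomorph_limMap (hE : IsCompleteFor fun q : ContCStarSeminorm A => hsemi E q) :
    @IsHomeomorph _ _ (strictTopology A E) (limStrictTopology A E) (limMap A E) := by
  let _ := strictTopology A E
  let _ (p : ContCStarSeminorm A) := strictTopologyQuot E p
  refine (@isHomeomorph_iff_exists_inverse _ _ (strictTopology A E) (limStrictTopology A E) _).2 ⟨?_, (limMapEquiv hE).symm,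
    (limMapEquiv hE).symm_apply_apply, (limMapEquiv hE).apply_symm_apply, ?_⟩
  · exact Continuous.subtype_mk (continuous_pi fun p => continuous_modProj p) _
  · refine continuous_iff_continuousAt.2 fun t => ?_
    refine (tendsto_seminormTopology (S := strictSemi E fun p : ContCStarSeminorm A => p)).2 ?_
    rintro ⟨p, a, ξ⟩
    have h1 : Tendsto (fun s : LimMod A E => s.1 p) (𝓝 t) (𝓝 (t.1 p)) :=
      ((continuous_apply p).comp continuous_subtype_val).continuousAt
    have h2 := (tendsto_seminormTopology
      (S := strictSemi (QuotMod E p) fun _ : Unit => QuotAlg.normSeminorm p)).1 h1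
      ((), QuotAlg.mk p a, QuotMod.mk E p ξ)
    refine h2.congr fun s => ?_
    rw [← map_sub, ← strictSemi_modProj]
    exact congrArg _ (congrArg (fun s : LimMod A E => s.1 p)
      (limMap_limMapEquiv_symm hE (s - t))).symm

lemma isCompleteFor_strict (hE : IsCompleteFor fun q : ContCStarSeminorm A => hsemi E q) :
    IsCompleteFor
      (MultiplierModule.strictSeminorm (E := E) fun p : ContCStarSeminorm A => p) :=
  isCompleteFor_strictSemi (P := fun p : ContCStarSeminorm A => p)
    (fun _ => eq_zero_of_forall_seminorm) (isCompleteFor_algebra A) hE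

/-! ### The embedding of `E` into `M(E)` -/

lemma embed_act (ξ : E) (a : A) : MultiplierModule.embed A E (act ξ a) =
    act (MultiplierModule.embed A E ξ) (Multiplier.ofElt a) :=
  AdjointableMap.ext_of_toFun fun b => (act_mul ξ a b).symm

lemma ip_embed_right (t : MultiplierModule A E) (ξ : E) :
    ip t (MultiplierModule.embed A E ξ) = Multiplier.ofElt (t.adj ξ) := by
  refine Multiplier.ext (LinearMap.ext fun a => t.adj_act ξ a) (LinearMap.ext fun a => ?_)
  change star (ip ξ (t (star a)) : A) = a * t.adj ξ
  rw [star_ip, t.ip_adj, ip_self, star_star]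

lemma act_ofElt (t : MultiplierModule A E) (a : A) :
    act t (Multiplier.ofElt a) = MultiplierModule.embed A E (t a) :=
  AdjointableMap.ext_of_toFun fun b => t.map_act a b

/-- The norm of `M(A)` extends the seminorms of `A`. -/
lemma multSeminorm_ofElt (p : ContCStarSeminorm A) (a : A) :
    multSeminorm p (Multiplier.ofElt a) = p a := by
  have h1 : ∀ b, p (a * b) ≤ p a * p b := p.mul_le a
  have hmem : ∀ c ∈ (Multiplier.ofElt a).ballValues p, c ≤ p a := by
    rintro _ ⟨b, hb, rfl⟩
    exact (h1 b).trans (mul_le_of_le_one_right (apply_nonneg _ _) hb)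
  refine le_antisymm (csSup_le ⟨_, 0, by simp, rfl⟩ hmem) ?_
  rcases (apply_nonneg p.toSeminorm a).eq_or_lt with h0 | h0
  · rw [← h0]
    refine le_csSup ⟨_, hmem⟩ ⟨0, by simp, ?_⟩
    simp
  · refine le_csSup ⟨_, hmem⟩ ⟨((p a)⁻¹ : ℂ) • star a, ?_, ?_⟩
    · rw [map_smul_eq_mul, p.apply_star, norm_inv, Complex.norm_real, Real.norm_of_nonneg h0.le,
        inv_mul_cancel₀ h0.ne']
    · change p a = p (a * _)
      rw [mul_smul_comm, map_smul_eq_mul, norm_inv, Complex.norm_real,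
        Real.norm_of_nonneg h0.le]
      have := p.star_mul_self (star a)
      rw [star_star, p.apply_star] at this
      rw [this, pow_two, inv_mul_cancel_left₀ h0.ne']

lemma multModSemi_embed (p : ContCStarSeminorm A) (ξ : E) :
    multModSemi E p (MultiplierModule.embed A E ξ) = hsemi E p ξ := by
  rw [multModSemi_apply, hnorm, ip_embed_right, multSeminorm_ofElt]
  rfl

lemma isClosedEmbedding_embed_multModSemi
    (hE : IsCompleteFor fun q : ContCStarSeminorm A => hsemi E q) :
    @IsClosedEmbedding _ _
      (seminormTopology fun (p : ContCStarSeminorm A) (ξ : E) => hsemi E p ξ)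
      (seminormTopology fun (p : ContCStarSeminorm A) (t : MultiplierModule A E) =>
        multModSemi E p t)
      (MultiplierModule.embed A E) :=
  isClosedEmbedding_seminormTopology multModSemi_embed
    (hsemi_separating fun _ => eq_zero_of_forall_seminorm)
    (fun _ ht => limMap_injective <| (Subtype.ext <| funext fun p =>
      multModSeminorm_eq_zero (ht p)).trans (map_zero _).symm) hE

lemma isClosedEmbedding_embed (hE : IsCompleteFor fun q : ContCStarSeminorm A => hsemi E q) :
    @IsClosedEmbedding _ _
      (seminormTopology fun (p : ContCStarSeminorm A) (ξ : E) => hnorm p ξ)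
      (seminormTopology fun (p : ContCStarSeminorm A) (t : MultiplierModule A E) =>
        hnorm (multSeminorm p) t)
      (MultiplierModule.embed A E) := by
  have h : (fun (p : ContCStarSeminorm A) (t : MultiplierModule A E) =>
      hnorm (multSeminorm p) t) = fun p t => multModSemi E p t :=
    funext fun p => funext fun t => (multModSemi_apply p t).symm
  rw [h]
  exact isClosedEmbedding_embed_multModSemi hE

lemma multModSemi_act_le (p : ContCStarSeminorm A) (t : MultiplierModule A E)
    (m : Multiplier A) :
    multModSemi E p (act t m) ≤ multModSemi E p t * multSeminorm p m := by
  change hnorm (multNorm p) (modProj E p (act t m)) ≤ hnorm (multNorm p) (modProj E p t) * _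
  rw [modProj_act, ← multNorm_multProj]
  refine hnorm_multNorm_le (mul_nonneg (Real.sqrt_nonneg _) (multNorm_nonneg _)) fun x => ?_
  rw [MultiplierModule.act_apply, mul_assoc]
  exact (hnorm_apply_le _ _).trans
    (mul_le_mul_of_nonneg_left (norm_l_le_multNorm _ _) (Real.sqrt_nonneg _))

/-- For an approximate unit `e`, the elements `ξ e` converge to `ξ`: the inner square of the
difference is `(x - e x) - (x - e x) e` with `x = ⟨ξ, ξ⟩`. -/
lemma exists_act_near (p : ContCStarSeminorm A) (ξ : E) {ε : ℝ} (hε : 0 < ε) :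
    ∃ e : A, hnorm p (ξ - act ξ e) < ε := by
  obtain ⟨e, he, he1, hx⟩ : ∃ e : QuotAlg p, star e = e ∧ ‖e‖ ≤ 1 ∧
      ∀ x ∈ ({QuotAlg.mk p (ip ξ ξ)} : Finset (QuotAlg p)), ‖e * x - x‖ < ε ^ 2 / 2 :=
    let _ := QuotAlg.cstarAlgebra p
    exists_approximate_unit _ (by positivity)
  have hx := hx _ (Finset.mem_singleton_self _)
  obtain ⟨e, rfl⟩ := QuotAlg.mk_surjective e
  refine ⟨e, lt_of_pow_lt_pow_left₀ 2 hε.le ?_⟩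
  set x := QuotAlg.mk p (ip ξ ξ) with hxdef
  have h1 : QuotAlg.mk p (ip (ξ - act ξ e) (ξ - act ξ e)) =
      (QuotAlg.mk p e * x - x) * QuotAlg.mk p e - (QuotAlg.mk p e * x - x) := by
    rw [ip_sub_left, ip_sub_right, ip_sub_right, ip_act_left, ip_act_left, ip_act_right]
    simp only [map_sub, map_mul, map_star, he, ← hxdef, sub_mul, mul_assoc]
    abel
  rw [hnorm_sq, ← QuotAlg.norm_mk, h1]
  have h2 : ‖(QuotAlg.mk p e * x - x) * QuotAlg.mk p e‖ ≤ ‖QuotAlg.mk p e * x - x‖ :=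
    (norm_mul_le _ _).trans (mul_le_of_le_one_right (norm_nonneg _) he1)
  have h3 := norm_sub_le ((QuotAlg.mk p e * x - x) * QuotAlg.mk p e) (QuotAlg.mk p e * x - x)
  linarith

/-- The range of `i_E` is invariant under `M(A)`: for an approximate unit `e`, the elements
`i_E(ξ r(e)) = i_E(ξ e) · m` of the closed range of `i_E` converge to `i_E(ξ) · m`. -/
lemma exists_act_embed (hE : IsCompleteFor fun q : ContCStarSeminorm A => hsemi E q) (ξ : E)
    (m : Multiplier A) :
    ∃ η : E, act (MultiplierModule.embed A E ξ) m = MultiplierModule.embed A E η := by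
  choose e he using fun i : ContCStarSeminorm A × ℕ =>
    exists_act_near i.1 ξ (Nat.one_div_pos_of_nat (α := ℝ) (n := i.2))
  have hact : ∀ a : A, act (MultiplierModule.embed A E (act ξ a)) m =
      MultiplierModule.embed A E (act ξ (m.r a)) := fun a => by
    refine AdjointableMap.ext_of_toFun fun b => ?_
    change act (act ξ a) (m.l b) = act (act ξ (m.r a)) b
    rw [← act_mul, ← act_mul, m.central]
  let _ := seminormTopology fun (p : ContCStarSeminorm A) (t : MultiplierModule A E) =>
    multModSemi E p t
  have : (atTop : Filter (ContCStarSeminorm A × ℕ)).NeBot := by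
    rw [← prod_atTop_atTop_eq]
    infer_instance
  have hmem : act (MultiplierModule.embed A E ξ) m ∈
      closure (Set.range (MultiplierModule.embed A E)) := by
    refine mem_closure_of_tendsto
      (f := fun i => act (MultiplierModule.embed A E (act ξ (e i))) m) (b := atTop)
      (tendsto_seminormTopology.2 fun p => ?_)
      (Eventually.of_forall fun i => ⟨_, (hact (e i)).symm⟩)
    have hM : 0 ≤ multSeminorm p m := by
      rw [← multNorm_multProj]
      exact multNorm_nonneg _
    refine (tendsto_zero_iff_eventually_lt _).2 fun ε hε => ?_
    obtain ⟨n, hn⟩ := exists_nat_one_div_lt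
      (show (0 : ℝ) < ε / (multSeminorm p m + 1) by positivity)
    filter_upwards [eventually_ge_atTop (p, n)] with i hi
    have h1 := hnorm_mono hi.1 (ξ - act ξ (e i))
    have h2 : 1 / ((i.2 : ℝ) + 1) ≤ 1 / ((n : ℝ) + 1) := Nat.one_div_le_one_div hi.2
    have h3 := h1.trans_lt ((he i).trans_le (h2.trans hn.le))
    rw [lt_div_iff₀ (by positivity)] at h3
    rw [map_sub_rev, ← sub_act, ← map_sub]
    refine (multModSemi_act_le _ _ _).trans_lt ?_
    rw [multModSemi_embed, hsemi_apply]
    nlinarith [hnorm_nonneg p (ξ - act ξ (e i))]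
  have hcl := (@IsClosedEmbedding.isClosed_range _ _
    (seminormTopology fun (p : ContCStarSeminorm A) (ξ : E) => hsemi E p ξ) _ _
    (isClosedEmbedding_embed_multModSemi hE)).closure_eq
  rw [hcl] at hmem
  obtain ⟨η, hη⟩ := hmem
  exact ⟨η, hη.symm⟩

/-- For an approximate unit `e`, the elements `i_E(t(e))` converge strictly to `t`: on `a` the
difference is `t(e a - a)`, and on `ξ` its adjoint is `e t*(ξ) - t*(ξ)`. -/
lemma exists_embed_near (t : MultiplierModule A E) (p : ContCStarSeminorm A) (I : Finset A)
    (J : Finset E) {ε : ℝ} (hε : 0 < ε) :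
    ∃ η : E, (∀ a ∈ I, hnorm p (MultiplierModule.embed A E η a - t a) < ε) ∧
      ∀ ξ ∈ J, p ((MultiplierModule.embed A E η).adj ξ - t.adj ξ) < ε := by
  classical
  have hC0 : 0 ≤ hnorm (multNorm p) (modProj E p t) := Real.sqrt_nonneg _
  set C := hnorm (multNorm p) (modProj E p t) with hC
  obtain ⟨e, he, -, hI⟩ : ∃ e : QuotAlg p, star e = e ∧ ‖e‖ ≤ 1 ∧
      ∀ x ∈ I.image (QuotAlg.mk p) ∪ J.image (fun ξ => QuotAlg.mk p (t.adj ξ)),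
        ‖e * x - x‖ < ε / (C + 1) :=
    let _ := QuotAlg.cstarAlgebra p
    exists_approximate_unit _ (by positivity)
  obtain ⟨e, rfl⟩ := QuotAlg.mk_surjective e
  have hle : ε / (C + 1) ≤ ε := div_le_self hε.le (by linarith)
  refine ⟨t e, fun a ha => ?_, fun ξ hξ => ?_⟩
  · have h1 := hI _ (Finset.mem_union_left _ (Finset.mem_image_of_mem _ ha))
    have h2 : MultiplierModule.embed A E (t e) a - t a = t (e * a - a) := by
      rw [map_sub]
      exact congrArg (· - t a) (t.map_act e a).symm
    rw [h2, ← QuotMod.hnorm_mk, ← modProj_apply]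
    refine (hnorm_apply_le _ _).trans_lt ?_
    rw [map_sub, map_mul]
    rw [lt_div_iff₀ (by positivity)] at h1
    nlinarith [norm_nonneg (QuotAlg.mk p e * QuotAlg.mk p a - QuotAlg.mk p a)]
  · have h1 := hI _ (Finset.mem_union_right _ (Finset.mem_image_of_mem _ hξ))
    refine lt_of_eq_of_lt ?_ (h1.trans_le hle)
    change p (ip (t e) ξ - t.adj ξ) = _
    rw [t.ip_adj, ip_self, ← QuotAlg.norm_mk, map_sub, map_mul, map_star, he]

variable (A E) in
lemma denseRange_embed :
    @DenseRange _ (strictTopology A E) _ (MultiplierModule.embed A E) := by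
  classical
  let _ := strictTopology A E
  intro t
  choose η h1 h2 using fun i : ContCStarSeminorm A × Finset A × Finset E × ℕ =>
    exists_embed_near t i.1 i.2.1 i.2.2.1 (Nat.one_div_pos_of_nat (α := ℝ) (n := i.2.2.2))
  have : (atTop : Filter (ContCStarSeminorm A × Finset A × Finset E × ℕ)).NeBot := by
    simp only [← prod_atTop_atTop_eq]
    infer_instance
  refine mem_closure_of_tendsto (f := fun i => MultiplierModule.embed A E (η i)) (b := atTop)
    ?_ (Eventually.of_forall fun i => Set.mem_range_self _)
  refine (tendsto_seminormTopology (S := strictSemi E fun p : ContCStarSeminorm A => p)).2 ?_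
  rintro ⟨p, a, ξ⟩
  refine (tendsto_zero_iff_eventually_lt _).2 fun ε hε => ?_
  obtain ⟨n, hn⟩ := exists_nat_one_div_lt (half_pos hε)
  filter_upwards [eventually_ge_atTop (p, {a}, {ξ}, n)] with i hi
  obtain ⟨hp, hI, hJ, hi⟩ := hi
  have h3 := h1 i a (hI (Finset.mem_singleton_self a))
  have h4 := h2 i ξ (hJ (Finset.mem_singleton_self ξ))
  have h5 := hnorm_mono hp (MultiplierModule.embed A E (η i) a - t a)
  have h6 := ContCStarSeminorm.apply_le hp ((MultiplierModule.embed A E (η i)).adj ξ - t.adj ξ)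
  have h7 : 1 / ((i.2.2.2 : ℝ) + 1) ≤ 1 / ((n : ℝ) + 1) := Nat.one_div_le_one_div hi
  rw [strictSemi_sub, hsemi_apply]
  linarith

end Iso

end

end HilbertMult

theorem theorem3p3 {A : Type*} [NonUnitalRing A] [StarRing A] [Module ℂ A] [IsScalarTower ℂ A A]
    [SMulCommClass ℂ A A] [StarModule ℂ A] [UniformSpace A] [LocallyCStarAlgebra A]
    {E : Type*} [AddCommGroup E] [Module ℂ E] [InnerModule A E]
    (hE : IsHilbertModuleFor (A := A) E fun p : ContCStarSeminorm A => p) :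
    haveI : PreHilbertModule A E := hE.1
    -- the `M(E_p)` form an inverse system of Hilbert C*-modules over the `M(A_p)`
    ((∀ p : ContCStarSeminorm A,
        (∀ m : Multiplier (QuotAlg p), BddAbove (m.ballValues fun x => ‖x‖)) ∧
        IsCStarFor (Multiplier (QuotAlg p)) (multNorm p) ∧
        IsHilbertModuleFor (MultiplierModule (QuotAlg p) (QuotMod E p))
          fun _ : Unit => multNorm p) ∧
      (∀ (p q : ContCStarSeminorm A) (h : q ≤ p),
        (∀ t x, modTrans E h t (QuotAlg.trans h x) = QuotMod.trans E h (t x)) ∧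
        (∀ t (m : Multiplier (QuotAlg p)),
          modTrans E h (InnerModule.act t m) =
            InnerModule.act (modTrans E h t) (multTrans h m)) ∧
        (∀ s t, (InnerModule.ip (modTrans E h s) (modTrans E h t) : Multiplier (QuotAlg q)) =
          multTrans h (InnerModule.ip s t))) ∧
      (∀ (p : ContCStarSeminorm A) m, multTrans (le_refl p) m = m) ∧
      (∀ (p q r : ContCStarSeminorm A) (h : q ≤ p) (h' : r ≤ q) m,
        multTrans h' (multTrans h m) = multTrans (h'.trans h) m) ∧
      (∀ (p : ContCStarSeminorm A) t, modTrans E (le_refl p) t = t) ∧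
      (∀ (p q r : ContCStarSeminorm A) (h : q ≤ p) (h' : r ≤ q) t,
        modTrans E h' (modTrans E h t) = modTrans E (h'.trans h) t)) ∧
    -- `M(E)` and `lim M(E_p)` are Hilbert modules over `M(A) = lim M(A_p)`, and they are
    -- unitarily equivalent through `U`
    ((∀ (p : ContCStarSeminorm A) (m : Multiplier A), BddAbove (m.ballValues p)) ∧
      IsLocallyCStarFor (Multiplier A) (multSeminorm (A := A)) ∧
      IsHilbertModuleFor (MultiplierModule A E) (multSeminorm (A := A)) ∧
      IsLocallyCStarFor (LimMult A) (fun p m => multNorm p (m.1 p)) ∧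
      IsHilbertModuleFor (LimMod A E) (fun p (m : LimMult A) => multNorm p (m.1 p)) ∧
      ∃ Φ : Multiplier A ≃⋆ₐ[ℂ] LimMult A,
        (∀ m p, (Φ m).1 p = multProj p m) ∧
        (∀ m p, multNorm p ((Φ m).1 p) = multSeminorm p m) ∧
        IsUnitaryAlong Φ (limMap A E)) ∧
    -- the strict topology is the inverse limit of the strict topologies
    ((∀ (p q : ContCStarSeminorm A) (h : q ≤ p),
        @Continuous _ _ (strictTopologyQuot E p) (strictTopologyQuot E q) (modTrans E h)) ∧
      @IsHomeomorph _ _ (strictTopology A E) (limStrictTopology A E) (limMap A E)) ∧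
    -- `M(E)` is strictly complete
    IsCompleteFor
      (MultiplierModule.strictSeminorm (E := E) fun p : ContCStarSeminorm A => p) ∧
    -- `E` is a closed submodule of `M(E)`
    ((∀ (ξ : E) (a : A), MultiplierModule.embed A E ξ a = InnerModule.act ξ a) ∧
      (∀ (ξ : E) (a : A), MultiplierModule.embed A E (InnerModule.act ξ a) =
        InnerModule.act (MultiplierModule.embed A E ξ) (Multiplier.ofElt a)) ∧
      (∀ ξ η : E, InnerModule.ip (MultiplierModule.embed A E ξ) (MultiplierModule.embed A E η) =
        Multiplier.ofElt (InnerModule.ip ξ η : A)) ∧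
      @Topology.IsClosedEmbedding _ _
        (seminormTopology fun (p : ContCStarSeminorm A) (ξ : E) => hnorm p ξ)
        (seminormTopology fun (p : ContCStarSeminorm A) (t : MultiplierModule A E) =>
          hnorm (multSeminorm p) t)
        (MultiplierModule.embed A E) ∧
      (∀ (ξ : E) (m : Multiplier A), ∃ η : E,
        InnerModule.act (MultiplierModule.embed A E ξ) m = MultiplierModule.embed A E η) ∧
      (∀ (t : MultiplierModule A E) (a : A),
        InnerModule.act t (Multiplier.ofElt a) = MultiplierModule.embed A E (t a)) ∧
      (∀ (t : MultiplierModule A E) (ξ : E),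
        InnerModule.ip t (MultiplierModule.embed A E ξ) = Multiplier.ofElt (t.adj ξ))) ∧
    -- `E` is strictly dense in `M(E)`
    @DenseRange _ (strictTopology A E) _ (MultiplierModule.embed A E) := by
  have _ : PreHilbertModule A E := hE.1
  have hc : IsCompleteFor fun q : ContCStarSeminorm A => hsemi E q := hE.2
  refine ⟨⟨fun p => ⟨bddAbove_multNorm, isCStarFor_multNorm p, inferInstance,
      isCompleteFor_multModSeminorm hc⟩,
    fun p q h => ⟨modTrans_apply h, modTrans_act h, modTrans_ip h⟩, fun p => multTrans_refl,
    fun p q r h h' => multTrans_trans h h', fun p => modTrans_refl,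
    fun p q r h h' => modTrans_trans h h'⟩,
    ⟨fun p m => ?_, isLocallyCStarFor_multiplier A, isHilbertModuleFor_multiplierModule hc,
      isLocallyCStarFor_limMult A, isHilbertModuleFor_limMod hc, limMultEquiv A,
      limMultEquiv_apply, fun m p => multNorm_multProj p m, isUnitaryAlong_limMap hc⟩,
    ⟨fun p q h => continuous_modTrans h, isHomeomorph_limMap hc⟩,
    isCompleteFor_strict hc,
    ⟨fun _ _ => rfl, embed_act, fun ξ η => ip_embed_right _ η, isClosedEmbedding_embed hc,
      exists_act_embed hc, act_ofElt, ip_embed_right⟩,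
    denseRange_embed A E⟩
  rw [← ballValues_multProj]
  exact bddAbove_multNorm _
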